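/- **Setting.** Consider massless scalar QED, $\mathcal L=-\tfrac14F_{\mu\nu}F^{\mu\nu}+|D\phi|^2$ with $D^\mu=\partial^\mu-igA^\mu$, at tree level (signature $(+,-,-,-)$, Feynman-gauge photon propagators). Let $N=2m$ and $$\mathcal O=\frac{1}{((N/2)!)^2}\,[\phi^*\phi]^{N/2},$$ so that $\langle p_1\cdots p_N|\mathcal O(0)|0\rangle=1$ for $N/2$ scalars and $N/2$ antiscalars at leading order. Let the outgoing state $\langle X|=\langle X_1\cdots X_N|$ be divided into $N$ sectors with a fixed content, $X_j$ consisting of $n_j$ scalars, antiscalars and photons of total charge $Q_j=\pm1$ (in units of the charge of the scalar), with $Q_j=1$ for $N/2$ of the sectors and $Q_j=-1$ for the others. **Kinematics.** Fix $c>0$. For a power-counting parameter $\lambda>0$ suppose that all momenta are lightlike with positive energy, and that there are lightlike directions $n_j=(1,\vec n_j)$, $\bar n_j=(1,-\vec n_j)$ such that * (collinear, no soft radiation) each momentum $p$ of $X_j$ satisfies $n_j\cdot p\le c^{-1}\lambda^2$, $c\le\bar n_j\cdot p\le c^{-1}$, and the components of its part $p_\perp$ transverse to $n_j,\bar n_j$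 are at most $c^{-1}\lambda$ in absolute value; * $p\cdot q\ge c\lambda^2$ for the momenta of any two distinct particles of the same sector; * $n_i\cdot n_j\ge c$ for $i\ne j$. Let $t_j$ be future-directed lightlike vectors with $t_j\cdot n_j\ge c\,t_j^0$. Each photon, of momentum $q$, has a helicity polarization vector $\epsilon$ with an arbitrary lightlike reference vector $r$ linearly independent of $q$: $\epsilon^2=0$, $\epsilon^*\cdot\epsilon=-1$, $q\cdot\epsilon=r\cdot\epsilon=0$. Let $$W_j(x)=\exp\Big(-ig\int_0^\infty ds\;t_j\cdot A(x+s\,t_j)\Big)$$ (with a convergence factor $e^{-\varepsilon s}$, $\varepsilon\to0^+$), and let $$M_j=\langle X_j|\phi^*W_j|0\rangle\ \text{ if } Q_j=1,\qquad M_j=\langle X_j|W_j^\dagger\phi|0\rangle\ \text{ if } Q_j=-1$$ be the tree-level matrix elements of these operators at $x=0$. **Claim.** There are constants $C$ and $\lambda_0>0$, depending only on the particle content of the sectors, on $g$ and on $c$, such that for all $0<\lambda\le\lambda_0$, all such momenta, directions $n_j$ and $t_j$, reference vectors and polarization vectors: 1. with $L=\sum_j(n_j-1)$, $$\Big|\langle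 X_1\cdots X_N|\mathcal O(0)|0\rangle-\prod_{j=1}^N M_j\Big|\le C\,\lambda\cdot\lambda^{-L};$$ 2. $|M_j|\le C\,\lambda^{-(n_j-1)}$ for every $j$, so that $\lambda^{-L}$ is the leading power and, by 1., $\langle X_1\cdots X_N|\mathcal O|0\rangle\cong\prod_jM_j$ at leading power; 3. each $M_j$ is gauge invariant: it does not change if for each photon (of momentum $q$) $\epsilon$ is replaced by $\epsilon+z\,q$ with any $z\in\mathbb C$; in particular it is independent of the reference vectors. -/

import Mathlib

open Finset

noncomputable section

namespace ScalarQED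

/-! ### Minkowski space, signature (+,-,-,-) -/

/-- The Minkowski product `x · y`; it is bilinear, also on complex vectors. -/
def mdot {R : Type*} [CommRing R] (x y : Fin 4 → R) : R :=
  x 0 * y 0 - x 1 * y 1 - x 2 * y 2 - x 3 * y 3

/-- A real four-vector seen as a complex one. -/
def toC (x : Fin 4 → ℝ) : Fin 4 → ℂ := fun μ => (x μ : ℂ)

/-- A nonzero future-directed lightlike vector. -/
def IsNull (x : Fin 4 → ℝ) : Prop := 0 < x 0 ∧ mdot x x = 0

/-- The vector `n̄` with the same time component as `n` and the opposite space components. -/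
def bar (n : Fin 4 → ℝ) : Fin 4 → ℝ := fun μ => if μ = 0 then n μ else -n μ

/-- The transverse part of `x` with respect to a lightlike `n = (1, 𝐧)`:
`x = ½ (n·x) n̄ + ½ (n̄·x) n + x_⊥`. -/
def perp (n x : Fin 4 → ℝ) : Fin 4 → ℝ :=
  fun μ => x μ - mdot n x / 2 * bar n μ - mdot (bar n) x / 2 * n μ

/-! ### Outgoing states -/

/-- The massless particles of scalar QED: the scalar, its antiparticle, the photon. -/
inductive Species
  | scalar
  | antiscalar
  | photon
  deriving DecidableEq

/-- The charge `Q` of a particle, in units of the charge of the scalar. -/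
def Species.charge : Species → ℤ
  | .scalar => 1
  | .antiscalar => -1
  | .photon => 0

/-- Momenta and polarization vectors of the outgoing particles, which are labelled by `α` and have
the species `sp`. The entry `pol a` is meaningful for photons only. -/
structure OutState {α : Type*} (sp : α → Species) where
  mom : α → Fin 4 → ℝ
  pol : α → Fin 4 → ℂ

/-- `ε` is a polarization vector of definite helicity of a photon of momentum `q`, with the lightlike
reference vector `r`: `ε² = 0`, `ε*·ε = -1`, `q·ε = 0`, `r·ε = 0`, with `q` and `r` linearly
independent. -/
def IsPolarization (q r : Fin 4 → ℝ) (ε : Fin 4 → ℂ) : Prop :=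
  IsNull r ∧ LinearIndependent ℝ ![q, r] ∧
    mdot ε ε = 0 ∧ mdot (star ε) ε = -1 ∧ mdot (toC q) ε = 0 ∧ mdot (toC r) ε = 0

section Amplitudes

variable {α : Type*} [Fintype α] [DecidableEq α] {sp : α → Species}

/-- The total momentum of the particles in `S`. -/
def OutState.total (X : OutState sp) (S : Finset α) : Fin 4 → ℂ :=
  fun μ => ∑ a ∈ S, (X.mom a μ : ℂ)

/-- The ordered decompositions `S = B ⊔ C` into two nonempty disjoint parts. -/
def splits₂ (S : Finset α) : Finset (Finset α × Finset α) :=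
  (S.powerset ×ˢ S.powerset).filter fun x =>
    x.1.Nonempty ∧ x.2.Nonempty ∧ Disjoint x.1 x.2 ∧ x.1 ∪ x.2 = S

/-- The ordered decompositions `S = B ⊔ C ⊔ D` into three nonempty disjoint parts. -/
def splits₃ (S : Finset α) : Finset (Finset α × Finset α × Finset α) :=
  (S.powerset ×ˢ S.powerset ×ˢ S.powerset).filter fun x =>
    x.1.Nonempty ∧ x.2.1.Nonempty ∧ x.2.2.Nonempty ∧
      Disjoint x.1 x.2.1 ∧ Disjoint x.1 x.2.2 ∧ Disjoint x.2.1 x.2.2 ∧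
        x.1 ∪ x.2.1 ∪ x.2.2 = S

variable (α) in
/-- The matrix elements `⟨S| φ*(0) |0⟩`, `⟨S| φ(0) |0⟩` and `⟨S| A^μ(0) |0⟩` of the fundamental
fields, for all sub-collections `S` of the outgoing particles. -/
structure FieldME where
  phiStar : Finset α → ℂ
  phi : Finset α → ℂ
  photon : Finset α → Fin 4 → ℂ

/-- One application of the tree-level Feynman rules of
`ℒ = -¼ F² + |D φ|²`, `D^μ = ∂^μ - i g A^μ`, with Feynman-gauge photon propagators.

The field either creates the single outgoing particle of `S` (external wave function `1` for a scalar
and `ε*` for a photon), or it propagates (propagator with momentum `P_S`) to a cubic or to a quartic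
vertex, the other legs of which create the parts of a decomposition of `S`. Equivalently, this is the
coefficient of the plane wave `exp(i P_S·x)`, linear in each outgoing particle of `S`, in the classical
field equations
`□ φ* = -i g ∂·(A φ*) - i g A·∂φ* + g² A² φ*`,
`□ φ = i g ∂·(A φ) + i g A·∂φ + g² A² φ`,
`□ A^μ = -i g (φ* ∂^μ φ - φ ∂^μ φ*) - 2 g² A^μ φ* φ`. -/
def feynmanStep (X : OutState sp) (g : ℝ) (F : FieldME α) : FieldME α where
  phiStar S :=
    (∑ a, if S = {a} ∧ sp a = .scalar then 1 else 0) +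
      (mdot (X.total S) (X.total S))⁻¹ *
        (-g * ∑ x ∈ splits₂ S, mdot (X.total S + X.total x.2) (F.photon x.1) * F.phiStar x.2
          - g ^ 2 * ∑ x ∈ splits₃ S,
              mdot (F.photon x.1) (F.photon x.2.1) * F.phiStar x.2.2)
  phi S :=
    (∑ a, if S = {a} ∧ sp a = .antiscalar then 1 else 0) +
      (mdot (X.total S) (X.total S))⁻¹ *
        (g * ∑ x ∈ splits₂ S, mdot (X.total S + X.total x.2) (F.photon x.1) * F.phi x.2
          - g ^ 2 * ∑ x ∈ splits₃ S,
              mdot (F.photon x.1) (F.photon x.2.1) * F.phi x.2.2)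
  photon S μ :=
    (∑ a, if S = {a} ∧ sp a = .photon then star (X.pol a μ) else 0) +
      (mdot (X.total S) (X.total S))⁻¹ *
        (g * ∑ x ∈ splits₂ S, (X.total x.1 μ - X.total x.2 μ) * F.phiStar x.1 * F.phi x.2
          + 2 * g ^ 2 * ∑ x ∈ splits₃ S,
              F.photon x.1 μ * F.phiStar x.2.1 * F.phi x.2.2)

/-- The tree-level matrix elements of the fundamental fields: the sums of all tree diagrams. A tree
with `k` outgoing particles is complete after `k` applications of the Feynman rules, see
`treeME_fixed`. -/
def treeME (X : OutState sp) (g : ℝ) : FieldME α :=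
  (feynmanStep X g)^[Fintype.card α] ⟨fun _ => 0, fun _ => 0, fun _ _ => 0⟩

/-- The tree-level matrix element `⟨X| 𝒪(0) |0⟩` in the state of all outgoing particles, of
`𝒪 = (1/(m!)²) (φ* φ)^m`. Each diagram consists of `2 m` trees attached to the vertex, so it
distributes the outgoing particles over the `m` fields `φ*` (`Sum.inl`) and the `m` fields `φ`
(`Sum.inr`). -/
def hardME (X : OutState sp) (g : ℝ) (m : ℕ) : ℂ :=
  ((m.factorial : ℂ) ^ 2)⁻¹ * ∑ f : α → Fin m ⊕ Fin m,
    (∏ i, (treeME X g).phiStar {a | f a = Sum.inl i}) *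
      ∏ i, (treeME X g).phi {a | f a = Sum.inr i}

/-- The tree-level matrix element `⟨B| (-i σ g ∫₀^∞ ds t·A(s t)) |0⟩` of the exponent of a Wilson line.
The matrix element of `A(s t)` depends on `s` through `exp(i s t·P_B)`, and
`∫₀^∞ ds exp(i s t·P_B - δ s) → i / (t·P_B)` as `δ → 0`, see `tendsto_wilson_integral`. -/
def wilsonExponentME (X : OutState sp) (g : ℝ) (σ : ℤ) (t : Fin 4 → ℝ) (B : Finset α) : ℂ :=
  -(Complex.I * σ * g) * mdot (toC t) ((treeME X g).photon B) *
    (Complex.I / mdot (toC t) (X.total B))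

/-- The tree-level matrix element in the state `S` of the outgoing Abelian Wilson line
`exp(-i σ g ∫₀^∞ ds t·A(s t))`, which is `W_t` for `σ = 1` and `W_t†` for `σ = -1`. By the expansion
of the exponential each diagram partitions `S` into the blocks created by one factor each. -/
def wilsonME (X : OutState sp) (g : ℝ) (σ : ℤ) (t : Fin 4 → ℝ) (S : Finset α) : ℂ :=
  ∑ π : Finpartition S, ∏ B ∈ π.parts, wilsonExponentME X g σ t B

/-- The tree-level matrix element `⟨S| φ*(0) W_t(0) |0⟩`. -/
def phiStarWilsonME (X : OutState sp) (g : ℝ) (t : Fin 4 → ℝ) (S : Finset α) : ℂ :=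
  ∑ B ∈ S.powerset, (treeME X g).phiStar B * wilsonME X g 1 t (S \ B)

/-- The tree-level matrix element `⟨S| W_t†(0) φ(0) |0⟩`. -/
def wilsonDagPhiME (X : OutState sp) (g : ℝ) (t : Fin 4 → ℝ) (S : Finset α) : ℂ :=
  ∑ B ∈ S.powerset, (treeME X g).phi B * wilsonME X g (-1) t (S \ B)

/-- The particles of the sector `j`. -/
def sectorSet {ι : Type*} [DecidableEq ι] (sector : α → ι) (j : ι) : Finset α :=
  {a | sector a = j}

/-- The charge of the field which creates a sector: `1` for `φ*` (`Sum.inl`), `-1` for `φ`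
(`Sum.inr`). -/
def sectorCharge {m : ℕ} : Fin m ⊕ Fin m → ℤ
  | .inl _ => 1
  | .inr _ => -1

/-- The matrix element of the collinear sector `j`: `⟨X_j| φ* W_j |0⟩` if it has the charge of the
scalar, `⟨X_j| W_j† φ |0⟩` if it has the charge of the antiscalar. -/
def collinearME {m : ℕ} (X : OutState sp) (g : ℝ) (t : Fin m ⊕ Fin m → Fin 4 → ℝ)
    (sector : α → Fin m ⊕ Fin m) : Fin m ⊕ Fin m → ℂ
  | .inl i => phiStarWilsonME X g (t (.inl i)) (sectorSet sector (.inl i))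
  | .inr i => wilsonDagPhiME X g (t (.inr i)) (sectorSet sector (.inr i))

/-- The exponent `L` such that matrix elements are of order `λ^(-L)` at leading power: each emission
of a collinear particle contributes `1/λ`. -/
def leadingExponent {ι : Type*} [Fintype ι] [DecidableEq ι] (sector : α → ι) : ℕ :=
  ∑ j, ((sectorSet sector j).card - 1)

end Amplitudes

/-! ### Collinear kinematics -/

/-- Collinear scaling `(n·p, n̄·p, p_⊥) ~ (λ², 1, λ)` with respect to `n`, with constants controlled
by `c`. The component `n̄·p` is bounded below, so that `p` is not soft. -/
def HasCollinearScaling (c lam : ℝ) (n p : Fin 4 → ℝ) : Prop :=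
  mdot n p ≤ c⁻¹ * lam ^ 2 ∧ c ≤ mdot (bar n) p ∧ mdot (bar n) p ≤ c⁻¹ ∧
    ∀ μ, |perp n p μ| ≤ c⁻¹ * lam

/-- The momenta `p a` form well-separated collinear sectors with directions `n j` and without soft
radiation, with power-counting parameter `lam` and constants controlled by `c`: massless momenta of
positive energy; collinear scaling with respect to the direction of the sector; `p·q ~ λ²` for two
particles of the same sector; no two sectors are collinear to each other. -/
structure CollinearKinematics {α ι : Type*} (sector : α → ι) (c lam : ℝ) (n : ι → Fin 4 → ℝ)
    (p : α → Fin 4 → ℝ) : Prop where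
  direction : ∀ j, n j 0 = 1 ∧ mdot (n j) (n j) = 0
  massless : ∀ a, IsNull (p a)
  collinear : ∀ a, HasCollinearScaling c lam (n (sector a)) (p a)
  resolved : ∀ a b, a ≠ b → sector a = sector b → c * lam ^ 2 ≤ mdot (p a) (p b)
  separated : ∀ i j, i ≠ j → c ≤ mdot (n i) (n j)

/-- The direction `t` of a Wilson line: lightlike, and not collinear to `n`. -/
def IsWilsonDirection (c : ℝ) (n t : Fin 4 → ℝ) : Prop :=
  IsNull t ∧ c * t 0 ≤ mdot t n

/-! ### Consistency of the definitions -/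

section Checks

theorem card_lt_of_mem_splits₂ {α : Type*} [DecidableEq α] {S : Finset α} {x : Finset α × Finset α} (hx : x ∈ splits₂ S) :
    x.1.card < S.card ∧ x.2.card < S.card := by
  simp only [splits₂, mem_filter] at hx
  obtain ⟨-, h1, h2, hd, rfl⟩ := hx
  rw [card_union_of_disjoint hd]
  have := h1.card_pos
  have := h2.card_pos
  omega

theorem card_lt_of_mem_splits₃ {α : Type*} [DecidableEq α] {S : Finset α} {x : Finset α × Finset α × Finset α}
    (hx : x ∈ splits₃ S) :
    x.1.card < S.card ∧ x.2.1.card < S.card ∧ x.2.2.card < S.card := by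
  simp only [splits₃, mem_filter] at hx
  obtain ⟨-, h1, h2, h3, d1, d2, d3, rfl⟩ := hx
  rw [card_union_of_disjoint (disjoint_union_left.2 ⟨d2, d3⟩), card_union_of_disjoint d1]
  have := h1.card_pos
  have := h2.card_pos
  have := h3.card_pos
  omega

variable {α : Type*} [Fintype α] [DecidableEq α] {sp : α → Species}

/-- The Feynman rules express the matrix elements in `S` through those in smaller states. -/
theorem feynmanStep_congr (X : OutState sp) (g : ℝ) {F G : FieldME α} {k : ℕ}
    (h : ∀ S : Finset α, S.card < k →
      F.phiStar S = G.phiStar S ∧ F.phi S = G.phi S ∧ F.photon S = G.photon S)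
    (S : Finset α) (hS : S.card < k + 1) :
    (feynmanStep X g F).phiStar S = (feynmanStep X g G).phiStar S ∧
      (feynmanStep X g F).phi S = (feynmanStep X g G).phi S ∧
        (feynmanStep X g F).photon S = (feynmanStep X g G).photon S := by
  have h2 : ∀ x ∈ splits₂ S, x.1.card < k ∧ x.2.card < k := fun x hx => by
    have := card_lt_of_mem_splits₂ hx
    omega
  have h3 : ∀ x ∈ splits₃ S, x.1.card < k ∧ x.2.1.card < k ∧ x.2.2.card < k := fun x hx => by
    have := card_lt_of_mem_splits₃ hx
    omega
  refine ⟨?_, ?_, funext fun μ => ?_⟩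
  · simp only [feynmanStep]
    rw [sum_congr (s₁ := splits₂ S) rfl fun x hx => by rw [(h _ (h2 x hx).1).2.2, (h _ (h2 x hx).2).1],
      sum_congr (s₁ := splits₃ S) rfl fun x hx => by
        rw [(h _ (h3 x hx).1).2.2, (h _ (h3 x hx).2.1).2.2, (h _ (h3 x hx).2.2).1]]
  · simp only [feynmanStep]
    rw [sum_congr (s₁ := splits₂ S) rfl fun x hx => by rw [(h _ (h2 x hx).1).2.2, (h _ (h2 x hx).2).2.1],
      sum_congr (s₁ := splits₃ S) rfl fun x hx => by
        rw [(h _ (h3 x hx).1).2.2, (h _ (h3 x hx).2.1).2.2, (h _ (h3 x hx).2.2).2.1]]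
  · simp only [feynmanStep]
    rw [sum_congr (s₁ := splits₂ S) rfl fun x hx => by rw [(h _ (h2 x hx).1).1, (h _ (h2 x hx).2).2.1],
      sum_congr (s₁ := splits₃ S) rfl fun x hx => by
        rw [(h _ (h3 x hx).1).2.2, (h _ (h3 x hx).2.1).1, (h _ (h3 x hx).2.2).2.1]]

/-- `treeME` solves the recursion given by the Feynman rules. -/
theorem treeME_fixed (X : OutState sp) (g : ℝ) : feynmanStep X g (treeME X g) = treeME X g := by
  set F₀ : FieldME α := ⟨fun _ => 0, fun _ => 0, fun _ _ => 0⟩ with hF₀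
  have key : ∀ (k : ℕ) (S : Finset α), S.card < k + 1 →
      (feynmanStep X g ((feynmanStep X g)^[k] (feynmanStep X g F₀))).phiStar S =
          ((feynmanStep X g)^[k] (feynmanStep X g F₀)).phiStar S ∧
        (feynmanStep X g ((feynmanStep X g)^[k] (feynmanStep X g F₀))).phi S =
            ((feynmanStep X g)^[k] (feynmanStep X g F₀)).phi S ∧
          (feynmanStep X g ((feynmanStep X g)^[k] (feynmanStep X g F₀))).photon S =
            ((feynmanStep X g)^[k] (feynmanStep X g F₀)).photon S := by
    intro k
    induction k with
    | zero =>
      intro S hS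
      exact feynmanStep_congr X g (k := 0) (fun T hT => absurd hT (Nat.not_lt_zero _)) S hS
    | succ k ih =>
      intro S hS
      rw [Function.iterate_succ_apply']
      exact feynmanStep_congr X g ih S hS
  have hb : ∀ S : Finset α, S.card < Fintype.card α + 1 := fun S =>
    Nat.lt_succ_of_le (card_le_univ S)
  have h0 : ∀ S : Finset α, S.card < 1 →
      (feynmanStep X g F₀).phiStar S = F₀.phiStar S ∧ (feynmanStep X g F₀).phi S = F₀.phi S ∧
        (feynmanStep X g F₀).photon S = F₀.photon S := by
    intro S hS
    obtain rfl : S = ∅ := by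
      rw [← card_eq_zero]
      omega
    have e : ∀ a : α, (∅ : Finset α) ≠ {a} := fun a => (singleton_ne_empty a).symm
    refine ⟨?_, ?_, funext fun μ => ?_⟩ <;> simp [feynmanStep, hF₀, e]
  have hk : ∀ (k : ℕ) (S : Finset α), S.card < k + 1 →
      ((feynmanStep X g)^[k] (feynmanStep X g F₀)).phiStar S =
          ((feynmanStep X g)^[k] F₀).phiStar S ∧
        ((feynmanStep X g)^[k] (feynmanStep X g F₀)).phi S =
            ((feynmanStep X g)^[k] F₀).phi S ∧
          ((feynmanStep X g)^[k] (feynmanStep X g F₀)).photon S =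
            ((feynmanStep X g)^[k] F₀).photon S := by
    intro k
    induction k with
    | zero => exact h0
    | succ k ih =>
      intro S hS
      rw [Function.iterate_succ_apply', Function.iterate_succ_apply']
      exact feynmanStep_congr X g ih S hS
  have e1 : feynmanStep X g (treeME X g) =
      (feynmanStep X g)^[Fintype.card α] (feynmanStep X g F₀) := by
    rw [treeME, ← hF₀, ← Function.iterate_succ_apply' (feynmanStep X g), Function.iterate_succ_apply]
  have ext : ∀ F G : FieldME α, F.phiStar = G.phiStar → F.phi = G.phi → F.photon = G.photon →
      F = G := by
    rintro ⟨_, _, _⟩ ⟨_, _, _⟩ rfl rfl rfl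
    rfl
  rw [e1, treeME, ← hF₀]
  exact ext _ _ (funext fun S => (hk _ S (hb S)).1) (funext fun S => (hk _ S (hb S)).2.1)
    (funext fun S => (hk _ S (hb S)).2.2)

/-- The integral along a Wilson line with its convergence factor, and its limit. -/
theorem tendsto_wilson_integral {x : ℝ} (hx : x ≠ 0) :
    Filter.Tendsto
      (fun δ : ℝ => ∫ s in Set.Ioi (0 : ℝ), Complex.exp ((Complex.I * x - δ) * s))
      (nhdsWithin 0 (Set.Ioi 0)) (nhds (Complex.I / x)) := by
  have hx' : (x : ℂ) ≠ 0 := by exact_mod_cast hx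
  have h : Filter.Tendsto (fun δ : ℝ => -(1 : ℂ) / (Complex.I * x - δ))
      (nhdsWithin 0 (Set.Ioi 0)) (nhds (-(1 : ℂ) / (Complex.I * x - ((0 : ℝ) : ℂ)))) := by
    refine Filter.Tendsto.mono_left ?_ nhdsWithin_le_nhds
    refine ContinuousAt.tendsto ?_
    refine ContinuousAt.div (by fun_prop) (by fun_prop) ?_
    simp [hx]
  have e : -(1 : ℂ) / (Complex.I * x - ((0 : ℝ) : ℂ)) = Complex.I / x := by
    have := Complex.I_ne_zero
    rw [Complex.ofReal_zero, sub_zero, div_eq_div_iff (mul_ne_zero this hx') hx']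
    linear_combination (-(x : ℂ)) * Complex.I_mul_I
  rw [e] at h
  refine h.congr' ?_
  filter_upwards [self_mem_nhdsWithin] with δ hδ
  rw [integral_exp_mul_complex_Ioi (by simpa using hδ)]
  simp

end Checks

end ScalarQED

end

/-! Tree diagrams solve the classical field equations, and these equations can be handled
algebraically. Functions of the set of outgoing particles form, under subset convolution, a
commutative ℂ-algebra: polynomials with one square-zero variable per particle. Multiplication by the
total momentum is a derivation of it. The matrix elements of `φ*`, `φ` and `A` thus become elements
Φ, Ψ, A of this algebra, and the Feynman rules say exactly that they satisfy the covariant wave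
equations and `P² A = g J`, with the external wave functions as values on singletons
(`feynmanStep_eq_self_iff`). The sum over set partitions is a genuine exponential there (`wder_exp`,
`exp_add`), so A → A + ∂χ, Φ → exp(-gχ) Φ, Ψ → exp(gχ) Ψ is an exact symmetry of the scalar
equations and of the current.

Two objects do not see χ: the coefficient of Φ^m Ψ^m, which is the hard matrix element up to (m!)²
(`hardME_eq`), and a field dressed with its Wilson line (`dressed_gauge`). Shifting polarizations by
multiples of the momenta is a gauge transformation with χ supported on single photons
(`treeME_shift_pol`), which yields claim 3.

For the estimates, everything is evaluated in temporal gauge A⁰ = 0, reached with χ = -A⁰/P⁰.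
External photons are then bounded whatever their reference vectors. Induction on |S|
(`exists_allBounds`) shows that every field at S is of order λ^(1-|S|), with one more factor λ if S
meets several sectors. For S inside one sector the propagator costs λ^(-2), but the cubic vertices
are suppressed by λ: collinear momenta are nearly parallel, and `P·A` is small because in temporal
gauge it is given by the charge density without a propagator. For mixed S the propagator is of order
1, so no vertex suppression is needed.

Factorization follows. In the hard vertex, a distribution containing a mixed block loses a factor λ.
If all blocks are pure and the term is nonzero, charge conservation forces each field to create
exactly one sector of its own charge; there are (m!)² such distributions, with equal contributions,
which cancels the normalization (`hard_sum_sub_le`). In the collinear matrix elements, an emission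
from the Wilson line has a denominator `t·P` that is not small, so it also loses a factor λ
(`dressed_sub_le`). Hence both sides of claim 1 agree, at leading power, with the product of the
undressed temporal-gauge fields on the sectors; the same bounds give claim 2. -/

noncomputable section

namespace ScalarQED

/-! ### The algebra of set functions under subset convolution -/

/-- Functions of sub-collections of the outgoing particles, with subset convolution as product. -/
@[ext]
structure SetAlg (α : Type*) where
  coeff : Finset α → ℂ

namespace SetAlg

variable {α : Type*}

instance : FunLike (SetAlg α) (Finset α) ℂ := ⟨coeff, fun _ _ => SetAlg.ext⟩

@[simp] theorem mk_apply (f : Finset α → ℂ) (S : Finset α) : (⟨f⟩ : SetAlg α) S = f S := rfl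

instance : Zero (SetAlg α) := ⟨⟨0⟩⟩
instance : Add (SetAlg α) := ⟨fun f g => ⟨f + g⟩⟩
instance : Neg (SetAlg α) := ⟨fun f => ⟨-f⟩⟩
instance : Sub (SetAlg α) := ⟨fun f g => ⟨f - g⟩⟩
instance {R : Type*} [SMul R ℂ] : SMul R (SetAlg α) := ⟨fun r f => ⟨r • ⇑f⟩⟩

instance : AddCommGroup (SetAlg α) :=
  DFunLike.coe_injective.addCommGroup _ rfl (fun _ _ => rfl) (fun _ => rfl) (fun _ _ => rfl)
    (fun _ _ => rfl) (fun _ _ => rfl)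

instance : Module ℂ (SetAlg α) :=
  Function.Injective.module ℂ (⟨⟨fun f => ⇑f, rfl⟩, fun _ _ => rfl⟩ : SetAlg α →+ Finset α → ℂ)
    DFunLike.coe_injective fun _ _ => rfl

@[simp] theorem add_apply (f g : SetAlg α) (S : Finset α) : (f + g) S = f S + g S := rfl
@[simp] theorem sub_apply (f g : SetAlg α) (S : Finset α) : (f - g) S = f S - g S := rfl
@[simp] theorem zero_apply (S : Finset α) : (0 : SetAlg α) S = 0 := rfl
@[simp] theorem smul_apply (z : ℂ) (f : SetAlg α) (S : Finset α) : (z • f) S = z * f S := rfl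

variable [DecidableEq α]

instance : Mul (SetAlg α) := ⟨fun f g => ⟨fun S => ∑ B ∈ S.powerset, f B * g (S \ B)⟩⟩

instance : One (SetAlg α) := ⟨⟨fun S => if S = ∅ then 1 else 0⟩⟩

theorem mul_apply (f g : SetAlg α) (S : Finset α) :
    (f * g) S = ∑ B ∈ S.powerset, f B * g (S \ B) := rfl

theorem one_apply (S : Finset α) : (1 : SetAlg α) S = if S = ∅ then 1 else 0 := rfl

theorem mul_apply_empty (f g : SetAlg α) : (f * g) ∅ = f ∅ * g ∅ := by
  simp [mul_apply]

protected theorem mul_comm (f g : SetAlg α) : f * g = g * f := by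
  refine DFunLike.ext _ _ fun S => ?_
  rw [mul_apply, mul_apply]
  refine sum_nbij' (S \ ·) (S \ ·) ?_ ?_ ?_ ?_ ?_
  · intro B _; simp
  · intro B _; simp
  · intro B hB; simpa using hB
  · intro B hB; simpa using hB
  · intro B hB
    have : S \ (S \ B) = B := by simpa using hB
    rw [this, mul_comm]

protected theorem one_mul (f : SetAlg α) : 1 * f = f := by
  refine DFunLike.ext _ _ fun S => ?_
  rw [mul_apply, sum_eq_single ∅]
  · simp [one_apply]
  · intro B _ hB; simp [one_apply, hB]
  · intro h; simp at h

protected theorem mul_assoc (f g h : SetAlg α) : f * g * h = f * (g * h) := by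
  refine DFunLike.ext _ _ fun S => ?_
  simp only [mul_apply, sum_mul, mul_sum]
  rw [sum_sigma', sum_sigma']
  refine sum_nbij' (fun x => ⟨x.2, x.1 \ x.2⟩) (fun x => ⟨x.1 ∪ x.2, x.1⟩) ?_ ?_ ?_ ?_ ?_
  · rintro ⟨B, C⟩ hx
    simp only [mem_sigma, mem_powerset] at hx ⊢
    exact ⟨hx.2.trans hx.1, sdiff_subset_sdiff hx.1 subset_rfl⟩
  · rintro ⟨B, C⟩ hx
    simp only [mem_sigma, mem_powerset] at hx ⊢
    exact ⟨union_subset hx.1 (hx.2.trans sdiff_subset), subset_union_left⟩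
  · rintro ⟨B, C⟩ hx
    simp only [mem_sigma, mem_powerset] at hx
    simp [union_sdiff_of_subset hx.2]
  · rintro ⟨B, C⟩ hx
    simp only [mem_sigma, mem_powerset] at hx
    have : Disjoint C B := (disjoint_sdiff.mono_right hx.2).symm
    simp [union_sdiff_left, this.sdiff_eq_left]
  · rintro ⟨B, C⟩ hx
    simp only [mem_sigma, mem_powerset] at hx
    have : (S \ C) \ (B \ C) = S \ B := by
      ext a
      have := @hx.2 a
      simp only [mem_sdiff]
      tauto
    simp only [this, mul_assoc]

instance : CommRing (SetAlg α) where
  __ := (inferInstance : AddCommGroup (SetAlg α))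
  left_distrib f g h := by
    refine DFunLike.ext _ _ fun S => ?_
    simp [mul_apply, mul_add, sum_add_distrib]
  right_distrib f g h := by
    refine DFunLike.ext _ _ fun S => ?_
    simp [mul_apply, add_mul, sum_add_distrib]
  zero_mul f := by refine DFunLike.ext _ _ fun S => ?_; simp [mul_apply]
  mul_zero f := by refine DFunLike.ext _ _ fun S => ?_; simp [mul_apply]
  mul_assoc := SetAlg.mul_assoc
  one_mul := SetAlg.one_mul
  mul_one f := by rw [SetAlg.mul_comm, SetAlg.one_mul]
  mul_comm := SetAlg.mul_comm

instance : Algebra ℂ (SetAlg α) :=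
  Algebra.ofModule
    (fun z f g => by refine DFunLike.ext _ _ fun S => ?_; simp [mul_apply, mul_sum, mul_assoc])
    (fun z f g => by refine DFunLike.ext _ _ fun S => ?_; simp [mul_apply, mul_sum, mul_left_comm])

@[simp] theorem algebraMap_mul_apply (z : ℂ) (f : SetAlg α) (S : Finset α) :
    (algebraMap ℂ (SetAlg α) z * f) S = z * f S := by
  rw [← Algebra.smul_def]; rfl

/-- Convolution is local: only subsets of `S` enter. This permits arguments about one sector where
Wilson-line denominators are known to be nonzero only inside that sector. -/
theorem mul_congr {f f' g g' : SetAlg α} {S : Finset α} (hf : ∀ B ⊆ S, f B = f' B)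
    (hg : ∀ B ⊆ S, g B = g' B) : (f * g) S = (f' * g') S := by
  rw [mul_apply, mul_apply]
  refine sum_congr rfl fun B hB => ?_
  rw [hf B (mem_powerset.1 hB), hg _ sdiff_subset]

/-- The derivation which multiplies the value at `S` by the additive weight `∑ a ∈ S, w a`. -/
def wder (w : α → ℂ) : Derivation ℂ (SetAlg α) (SetAlg α) :=
  Derivation.mk'
    { toFun := fun f => ⟨fun S => (∑ a ∈ S, w a) * f S⟩
      map_add' := fun f g => DFunLike.ext _ _ fun S => mul_add _ _ _
      map_smul' := fun z f => DFunLike.ext _ _ fun S => mul_left_comm _ _ _ }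
    (fun f g => by
      refine DFunLike.ext _ _ fun S => ?_
      rw [smul_eq_mul, smul_eq_mul, SetAlg.mul_comm g, add_apply, mul_apply, mul_apply,
        ← sum_add_distrib]
      change _ * (f * g) S = _
      rw [mul_apply, mul_sum]
      refine sum_congr rfl fun B hB => ?_
      change _ = f B * ((∑ a ∈ S \ B, w a) * g (S \ B)) + (∑ a ∈ B, w a) * f B * g (S \ B)
      rw [← sum_sdiff (mem_powerset.1 hB)]
      ring)

theorem wder_apply (w : α → ℂ) (f : SetAlg α) (S : Finset α) :
    wder w f S = (∑ a ∈ S, w a) * f S := rfl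

/-- A linear differential equation has at most one solution with given value at `∅`. -/
theorem eq_of_wder_eq {f g h : SetAlg α} (hf : wder 1 f = h * f) (hg : wder 1 g = h * g)
    (h0 : h ∅ = 0) (he : f ∅ = g ∅) : f = g := by
  refine DFunLike.ext _ _ fun S => ?_
  induction S using Finset.strongInduction with
  | H S ih =>
    rcases S.eq_empty_or_nonempty with rfl | hS
    · exact he
    have e1 := DFunLike.congr_fun hf S
    have e2 := DFunLike.congr_fun hg S
    have e3 : (h * f) S = (h * g) S := by
      rw [mul_apply, mul_apply]
      refine sum_congr rfl fun B hB => ?_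
      -- `h ∅ = 0` removes the term containing the unknown value at `S`; all others involve proper
      -- subsets.
      rcases B.eq_empty_or_nonempty with rfl | hB'
      · simp [h0]
      · rw [ih _ (sdiff_ssubset (mem_powerset.1 hB) hB')]
    rw [← e1, ← e2, wder_apply, wder_apply] at e3
    -- With weight 1 the derivation multiplies by the number of elements of `S`, which is invertible
    -- here.
    refine mul_left_cancel₀ ?_ e3
    simpa using hS.ne_empty

/-! ### The exponential -/

/-- The exponential of a set function, a sum over set partitions. -/
def exp (χ : SetAlg α) : SetAlg α := ⟨fun S => ∑ π : Finpartition S, ∏ B ∈ π.parts, χ B⟩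

theorem exp_apply (χ : SetAlg α) (S : Finset α) :
    exp χ S = ∑ π : Finpartition S, ∏ B ∈ π.parts, χ B := rfl

@[simp] theorem exp_empty (χ : SetAlg α) : exp χ ∅ = 1 := by
  rw [exp_apply]
  have : ∀ π : Finpartition (∅ : Finset α), π.parts = ∅ := fun π => by
    simp
  have h1 : Fintype.card (Finpartition (∅ : Finset α)) = 1 :=
    Fintype.card_eq_one_iff.2 ⟨Finpartition.empty _, fun π => by ext1; rw [this, this]⟩
  rw [sum_congr rfl fun π _ => (by rw [this π]; exact prod_empty : ∏ B ∈ π.parts, χ B = 1)]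
  rw [sum_const, card_univ, h1, one_smul]

theorem exp_congr {χ χ' : SetAlg α} {S : Finset α} (h : ∀ B ⊆ S, B.Nonempty → χ B = χ' B) :
    exp χ S = exp χ' S := by
  rw [exp_apply, exp_apply]
  refine sum_congr rfl fun π _ => prod_congr rfl fun B hB => h B (π.le hB) ?_
  exact π.nonempty_of_mem_parts hB

/-- Removal of a block from a partition. -/
theorem sum_finpartition_sum_parts (S : Finset α) (F : Finset α → Finset (Finset α) → ℂ) :
    ∑ π : Finpartition S, ∑ B ∈ π.parts, F B (π.parts.erase B) =
      ∑ B ∈ S.powerset.erase ∅, ∑ π : Finpartition (S \ B), F B π.parts := by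
  have key : ∀ (π : Finpartition S) (B : Finset α), B ∈ π.parts →
      (π.parts.erase B).sup id = S \ B := by
    intro π B hB
    have h1 : B ⊔ (π.parts.erase B).sup id = S := by
      conv_rhs => rw [← π.sup_parts, ← insert_erase hB, sup_insert]
      rfl
    have h2 : Disjoint B ((π.parts.erase B).sup id) :=
      π.supIndep (erase_subset _ _) hB (notMem_erase _ _)
    have h3 := sup_sdiff_left_self.trans h2.symm.sdiff_eq_left
    rw [h1] at h3
    exact h3.symm
  rw [sum_sigma', sum_sigma']
  refine sum_bij (fun x hx => ⟨x.2, x.1.ofSubset (erase_subset x.2 _)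
    (key x.1 x.2 (mem_sigma.1 hx).2)⟩) ?_ ?_ ?_ ?_
  · rintro ⟨π, B⟩ hx
    simp only [mem_sigma, mem_univ, true_and, and_true, mem_erase, mem_powerset] at hx ⊢
    exact ⟨(π.nonempty_of_mem_parts hx).ne_empty, π.le hx⟩
  · rintro ⟨π, B⟩ hx ⟨π', B'⟩ hx' h
    simp only [mem_sigma, mem_univ, true_and] at hx hx'
    obtain ⟨rfl, h⟩ := Sigma.mk.inj_iff.1 h
    have h' := congrArg Finpartition.parts (eq_of_heq h)
    simp only [Finpartition.ofSubset_parts] at h'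
    have : π = π' := by
      ext1
      rw [← insert_erase hx, h', insert_erase hx']
    rw [this]
  · rintro ⟨B, π⟩ hx
    simp only [mem_sigma, mem_univ, and_true, mem_erase, mem_powerset] at hx
    have hB : B ∉ π.parts := fun h =>
      hx.1 (disjoint_self.1 (sdiff_disjoint.mono_left (π.le h) : Disjoint B B))
    refine ⟨⟨π.extend hx.1 sdiff_disjoint (sdiff_union_of_subset hx.2), B⟩, ?_, ?_⟩
    · simp
    · refine Sigma.mk.inj_iff.2 ⟨rfl, heq_of_eq ?_⟩
      ext1
      simp [hB]
  · rintro ⟨π, B⟩ hx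
    rfl

/-- The additive weight of `S` is the sum of the weights of its blocks, so differentiating marks one
block; what remains after its removal is a partition of the complement. -/
theorem wder_exp (w : α → ℂ) (χ : SetAlg α) : wder w (exp χ) = wder w χ * exp χ := by
  refine DFunLike.ext _ _ fun S => ?_
  have h := sum_finpartition_sum_parts S fun B P => ((∑ a ∈ B, w a) * χ B) * ∏ C ∈ P, χ C
  have e : (wder w χ * exp χ) S = ∑ B ∈ S.powerset.erase ∅, ∑ π : Finpartition (S \ B),
      ((∑ a ∈ B, w a) * χ B) * ∏ C ∈ π.parts, χ C := by
    rw [mul_apply, ← add_sum_erase _ _ (empty_mem_powerset S), wder_apply w χ ∅, sum_empty,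
      zero_mul, zero_mul, zero_add]
    refine sum_congr rfl fun B _ => ?_
    rw [wder_apply, exp_apply, mul_sum]
  rw [e, ← h, wder_apply, exp_apply, mul_sum]
  refine sum_congr rfl fun π _ => ?_
  have hS : ∑ a ∈ S, w a = ∑ B ∈ π.parts, ∑ a ∈ B, w a := by
    conv_lhs => rw [← π.biUnion_parts]
    exact sum_biUnion π.disjoint
  rw [hS, sum_mul]
  refine sum_congr rfl fun B hB => ?_
  rw [mul_assoc, mul_prod_erase _ _ hB]

/-- Both sides solve the same first-order linear equation with value 1 at `∅`, so no combinatorics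
of partitions is needed. -/
theorem exp_add (χ χ' : SetAlg α) : exp (χ + χ') = exp χ * exp χ' := by
  refine eq_of_wder_eq (h := wder 1 (χ + χ')) (wder_exp _ _) ?_ (by simp [wder_apply])
    (by simp [mul_apply_empty])
  rw [Derivation.leibniz, wder_exp, wder_exp, map_add]
  simp only [smul_eq_mul]
  ring

theorem exp_zero : exp (0 : SetAlg α) = 1 :=
  eq_of_wder_eq (h := wder 1 0) (wder_exp _ _) (by simp) (by simp) (by simp [one_apply])

theorem exp_mul_exp_neg (χ : SetAlg α) : exp χ * exp (-χ) = 1 := by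
  rw [← exp_add, add_neg_cancel, exp_zero]

end SetAlg

/-! ### The field equations in the convolution algebra and their gauge covariance -/

section FieldEquations

variable {α : Type*}

/-- The total momentum of the particles in `S`. -/
def totalMom (p : α → Fin 4 → ℝ) (S : Finset α) : Fin 4 → ℂ := fun μ => ∑ a ∈ S, (p a μ : ℂ)

theorem OutState.total_eq {sp : α → Species} (X : OutState sp) (S : Finset α) :
    X.total S = totalMom X.mom S := rfl

@[simp] theorem totalMom_empty (p : α → Fin 4 → ℝ) : totalMom p ∅ = 0 := by
  funext μ; simp [totalMom]

@[simp] theorem totalMom_singleton (p : α → Fin 4 → ℝ) (a : α) :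
    totalMom p {a} = toC (p a) := by
  funext μ; simp [totalMom, toC]

variable [DecidableEq α]

/-- Differentiation along `μ`, which multiplies by the total momentum. -/
def del (p : α → Fin 4 → ℝ) (μ : Fin 4) : Derivation ℂ (SetAlg α) (SetAlg α) :=
  SetAlg.wder fun a => (p a μ : ℂ)

theorem del_apply (p : α → Fin 4 → ℝ) (μ : Fin 4) (f : SetAlg α) (S : Finset α) :
    del p μ f S = totalMom p S μ * f S := rfl

/-- Constants in the convolution algebra. -/
abbrev const (k : ℂ) : SetAlg α := algebraMap ℂ (SetAlg α) k

theorem del_mul (p : α → Fin 4 → ℝ) (μ : Fin 4) (f h : SetAlg α) :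
    del p μ (f * h) = f * del p μ h + h * del p μ f := by
  simp [Derivation.leibniz]

@[simp] theorem del_const (p : α → Fin 4 → ℝ) (μ : Fin 4) (k : ℂ) :
    del p μ (const k) = 0 := Derivation.map_algebraMap _ _

/-- The d'Alembertian, up to a sign. -/
def box (p : α → Fin 4 → ℝ) (f : SetAlg α) : SetAlg α :=
  del p 0 (del p 0 f) - del p 1 (del p 1 f) - del p 2 (del p 2 f) - del p 3 (del p 3 f)

theorem box_apply (p : α → Fin 4 → ℝ) (f : SetAlg α) (S : Finset α) :
    box p f S = mdot (totalMom p S) (totalMom p S) * f S := by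
  simp only [box, SetAlg.sub_apply, del_apply, mdot]
  ring

/-- The covariant derivative with coupling `k`. -/
def cov (p : α → Fin 4 → ℝ) (k : ℂ) (A : Fin 4 → SetAlg α) (μ : Fin 4) (f : SetAlg α) : SetAlg α :=
  del p μ f + const k * A μ * f

/-- The covariant d'Alembertian, up to a sign. -/
def covBox (p : α → Fin 4 → ℝ) (k : ℂ) (A : Fin 4 → SetAlg α) (f : SetAlg α) : SetAlg α :=
  cov p k A 0 (cov p k A 0 f) - cov p k A 1 (cov p k A 1 f) - cov p k A 2 (cov p k A 2 f) -
    cov p k A 3 (cov p k A 3 f)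

/-- The electromagnetic current of the scalar field. -/
def current (p : α → Fin 4 → ℝ) (k : ℂ) (A : Fin 4 → SetAlg α) (Φ Ψ : SetAlg α) (μ : Fin 4) :
    SetAlg α :=
  cov p k A μ Φ * Ψ - Φ * cov p (-k) A μ Ψ

theorem const_neg (k : ℂ) : (const (-k) : SetAlg α) = -const k := map_neg _ _

/-- Current conservation. -/
theorem del_current (p : α → Fin 4 → ℝ) (k : ℂ) (A : Fin 4 → SetAlg α) (Φ Ψ : SetAlg α) :
    del p 0 (current p k A Φ Ψ 0) - del p 1 (current p k A Φ Ψ 1) -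
        del p 2 (current p k A Φ Ψ 2) - del p 3 (current p k A Φ Ψ 3) =
      covBox p k A Φ * Ψ - Φ * covBox p (-k) A Ψ := by
  simp only [current, covBox, cov, map_add, map_sub, map_neg, del_mul, del_const]
  ring

/-- A gauge transformation of a vector potential. -/
def gaugeA (p : α → Fin 4 → ℝ) (χ : SetAlg α) (A : Fin 4 → SetAlg α) : Fin 4 → SetAlg α :=
  fun μ => A μ + del p μ χ

/-- A gauge transformation of a field with coupling `k`. -/
def gaugeF (k : ℂ) (χ f : SetAlg α) : SetAlg α := SetAlg.exp (-(const k * χ)) * f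

/-- The derivative of the exponential produces `-k ∂χ`, which cancels the shift of `A`. -/
theorem cov_gauge (p : α → Fin 4 → ℝ) (k : ℂ) (χ : SetAlg α) (A : Fin 4 → SetAlg α) (μ : Fin 4)
    (f : SetAlg α) :
    cov p k (gaugeA p χ A) μ (gaugeF k χ f) = gaugeF k χ (cov p k A μ f) := by
  have h : del p μ (SetAlg.exp (-(const k * χ))) =
      -(const k * del p μ χ) * SetAlg.exp (-(const k * χ)) := by
    conv_lhs => rw [del, SetAlg.wder_exp, ← del]
    rw [map_neg, del_mul, del_const, mul_zero, add_zero]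
  simp only [cov, gaugeA, gaugeF, del_mul, h]
  ring

theorem covBox_gauge (p : α → Fin 4 → ℝ) (k : ℂ) (χ : SetAlg α) (A : Fin 4 → SetAlg α)
    (f : SetAlg α) :
    covBox p k (gaugeA p χ A) (gaugeF k χ f) = gaugeF k χ (covBox p k A f) := by
  simp only [covBox, cov_gauge]
  simp only [gaugeF]
  ring

/-- Opposite couplings give inverse exponentials. The gauge invariance of the current and of the
hard operator rests on this cancellation. -/
theorem gaugeF_mul_gaugeF (k : ℂ) (χ f h : SetAlg α) :
    gaugeF k χ f * gaugeF (-k) χ h = f * h := by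
  have h1 := SetAlg.exp_mul_exp_neg (-(const k * χ))
  have h2 : -(const (-k) * χ) = -(-(const k * χ)) := by rw [const_neg]; ring
  simp only [gaugeF, h2]
  linear_combination f * h * h1

theorem gaugeF_apply_empty (k : ℂ) (χ : SetAlg α) {f : SetAlg α} (hf : f ∅ = 0) :
    gaugeF k χ f ∅ = 0 := by
  rw [gaugeF, SetAlg.mul_apply_empty, hf, mul_zero]

/-- The exponential is 1 at `∅`, so external scalar wave functions survive every gauge
transformation. -/
theorem gaugeF_apply_singleton (k : ℂ) (χ : SetAlg α) {f : SetAlg α} (hf : f ∅ = 0) (a : α) :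
    gaugeF k χ f {a} = f {a} := by
  have : ({a} : Finset α).powerset = {∅, {a}} := by
    ext B
    simp [subset_singleton_iff]
  rw [gaugeF, SetAlg.mul_apply, this, sum_pair (singleton_ne_empty a).symm]
  simp [hf]

theorem current_gauge (p : α → Fin 4 → ℝ) (k : ℂ) (χ : SetAlg α) (A : Fin 4 → SetAlg α)
    (Φ Ψ : SetAlg α) :
    current p k (gaugeA p χ A) (gaugeF k χ Φ) (gaugeF (-k) χ Ψ) = current p k A Φ Ψ := by
  funext μ
  simp only [current, cov_gauge, gaugeF_mul_gaugeF]

/-! ### The Feynman rules as field equations -/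

/-- Diagrams require nonempty parts while convolution does not; fields vanish at `∅`, so the
difference is invisible. -/
theorem sum_splits₂ (S : Finset α) (h : Finset α → Finset α → ℂ) (h1 : ∀ C, h ∅ C = 0)
    (h2 : ∀ B, h B ∅ = 0) :
    ∑ x ∈ splits₂ S, h x.1 x.2 = ∑ B ∈ S.powerset, h B (S \ B) := by
  have e : ∑ B ∈ S.powerset, h B (S \ B) =
      ∑ B ∈ S.powerset with B.Nonempty ∧ (S \ B).Nonempty, h B (S \ B) := by
    refine (sum_filter_of_ne fun B _ hB => ?_).symm
    constructor
    · rw [nonempty_iff_ne_empty]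
      rintro rfl
      exact hB (h1 _)
    · rw [nonempty_iff_ne_empty]
      intro h'
      rw [h'] at hB
      exact hB (h2 _)
  rw [e]
  refine sum_nbij' (fun x => x.1) (fun B => (B, S \ B)) ?_ ?_ ?_ ?_ ?_
  · rintro ⟨B, C⟩ hx
    simp only [splits₂, mem_filter, mem_product, mem_powerset] at hx ⊢
    obtain ⟨⟨hB, -⟩, h1, h2, hd, rfl⟩ := hx
    refine ⟨hB, h1, ?_⟩
    rwa [union_sdiff_cancel_left hd]
  · intro B hB
    simp only [splits₂, mem_filter, mem_product, mem_powerset] at hB ⊢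
    exact ⟨⟨hB.1, sdiff_subset⟩, hB.2.1, hB.2.2, disjoint_sdiff, union_sdiff_of_subset hB.1⟩
  · rintro ⟨B, C⟩ hx
    simp only [splits₂, mem_filter] at hx
    obtain ⟨-, -, -, hd, rfl⟩ := hx
    simp [union_sdiff_cancel_left hd]
  · intro B _
    rfl
  · rintro ⟨B, C⟩ hx
    simp only [splits₂, mem_filter] at hx
    obtain ⟨-, -, -, hd, rfl⟩ := hx
    simp [union_sdiff_cancel_left hd]

theorem sum_splits₃ (S : Finset α) (h : Finset α → Finset α → Finset α → ℂ)
    (h1 : ∀ C D, h ∅ C D = 0) (h2 : ∀ B D, h B ∅ D = 0) (h3 : ∀ B C, h B C ∅ = 0) :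
    ∑ x ∈ splits₃ S, h x.1 x.2.1 x.2.2 =
      ∑ B ∈ S.powerset, ∑ C ∈ (S \ B).powerset, h B C ((S \ B) \ C) := by
  rw [← sum_splits₂ S (fun B T => ∑ C ∈ T.powerset, h B C (T \ C)) (by simp [h1]) (by simp [h2])]
  have e : ∀ x ∈ splits₂ S, ∑ C ∈ x.2.powerset, h x.1 C (x.2 \ C) =
      ∑ y ∈ splits₂ x.2, h x.1 y.1 y.2 :=
    fun x _ => (sum_splits₂ x.2 (fun C D => h x.1 C D) (h2 _) (h3 _)).symm
  rw [sum_congr rfl e, sum_sigma']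
  refine sum_nbij' (fun x => ⟨(x.1, x.2.1 ∪ x.2.2), x.2⟩) (fun x => (x.1.1, x.2)) ?_ ?_ ?_ ?_ ?_
  · rintro ⟨B, C, D⟩ hx
    simp only [splits₃, splits₂, mem_filter, mem_product, mem_powerset, mem_sigma] at hx ⊢
    obtain ⟨⟨hB, hC, hD⟩, h1, h2, h3, d1, d2, d3, hU⟩ := hx
    refine ⟨⟨⟨hB, union_subset hC hD⟩, h1, h2.mono subset_union_left,
      disjoint_union_right.2 ⟨d1, d2⟩, by rw [← union_assoc, hU]⟩,
      ⟨subset_union_left, subset_union_right⟩, h2, h3, d3, trivial⟩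
  · rintro ⟨⟨B, T⟩, C, D⟩ hx
    simp only [splits₃, splits₂, mem_filter, mem_product, mem_powerset, mem_sigma] at hx ⊢
    obtain ⟨⟨⟨hB, hT⟩, h1, -, hd, hU⟩, ⟨hC, hD⟩, h2, h3, d3, rfl⟩ := hx
    refine ⟨⟨hB, hC.trans hT, hD.trans hT⟩, h1, h2, h3, hd.mono_right hC, hd.mono_right hD, d3, ?_⟩
    rw [union_assoc, hU]
  · rintro ⟨B, C, D⟩ _
    rfl
  · rintro ⟨⟨B, T⟩, C, D⟩ hx
    simp only [splits₂, mem_filter, mem_sigma] at hx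
    obtain ⟨-, -, -, -, -, rfl⟩ := hx
    rfl
  · rintro ⟨B, C, D⟩ _
    rfl

/-- The cubic vertex comes from `∂·(A f) + A·∂f`, whence the sum of the momentum of `S` and that of
the outgoing scalar part; the quartic vertex is `A² f`. -/
theorem covBox_apply (p : α → Fin 4 → ℝ) (k : ℂ) (A : Fin 4 → SetAlg α) (f : SetAlg α)
    (hA : ∀ μ, A μ ∅ = 0) (hf : f ∅ = 0) (S : Finset α) :
    covBox p k A f S = mdot (totalMom p S) (totalMom p S) * f S +
      (k * ∑ x ∈ splits₂ S, mdot (totalMom p S + totalMom p x.2) (fun μ => A μ x.1) * f x.2 +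
        k ^ 2 * ∑ x ∈ splits₃ S, mdot (fun μ => A μ x.1) (fun μ => A μ x.2.1) * f x.2.2) := by
  have e : covBox p k A f = box p f +
      (const k * ((del p 0 (A 0 * f) + A 0 * del p 0 f) - (del p 1 (A 1 * f) + A 1 * del p 1 f) -
        (del p 2 (A 2 * f) + A 2 * del p 2 f) - (del p 3 (A 3 * f) + A 3 * del p 3 f)) +
      const k * (const k *
        (A 0 * (A 0 * f) - A 1 * (A 1 * f) - A 2 * (A 2 * f) - A 3 * (A 3 * f)))) := by
    simp only [covBox, cov, box, map_add, del_mul, del_const]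
    ring
  rw [sum_splits₂ S (fun B C => mdot (totalMom p S + totalMom p C) (fun μ => A μ B) * f C)
      (by simp [mdot, hA]) (by simp [hf]),
    sum_splits₃ S (fun B C D => mdot (fun μ => A μ B) (fun μ => A μ C) * f D)
      (by simp [mdot, hA]) (by simp [mdot, hA]) (by simp [hf]), e]
  simp only [SetAlg.add_apply, box_apply, const, SetAlg.algebraMap_mul_apply, SetAlg.sub_apply]
  simp only [SetAlg.mul_apply, del_apply]
  congr 2
  · congr 1
    simp only [mul_sum, ← sum_add_distrib, ← sum_sub_distrib]
    refine sum_congr rfl fun B _ => ?_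
    simp only [mdot, Pi.add_apply]
    ring
  · rw [← mul_assoc, ← pow_two]
    congr 1
    simp only [mul_sum, ← sum_sub_distrib]
    refine sum_congr rfl fun B _ => sum_congr rfl fun C _ => ?_
    simp only [mdot]
    ring

theorem current_apply (p : α → Fin 4 → ℝ) (k : ℂ) (A : Fin 4 → SetAlg α) (Φ Ψ : SetAlg α)
    (hA : ∀ μ, A μ ∅ = 0) (hΦ : Φ ∅ = 0) (hΨ : Ψ ∅ = 0) (μ : Fin 4) (S : Finset α) :
    current p k A Φ Ψ μ S =
      ∑ x ∈ splits₂ S, (totalMom p x.1 μ - totalMom p x.2 μ) * Φ x.1 * Ψ x.2 +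
        2 * k * ∑ x ∈ splits₃ S, A μ x.1 * Φ x.2.1 * Ψ x.2.2 := by
  have e : current p k A Φ Ψ μ = (del p μ Φ * Ψ - Φ * del p μ Ψ) +
      const (2 * k) * (A μ * (Φ * Ψ)) := by
    rw [const, map_mul, map_ofNat, current, cov, cov, const_neg]
    ring
  rw [sum_splits₂ S (fun B C => (totalMom p B μ - totalMom p C μ) * Φ B * Ψ C)
      (by simp [hΦ]) (by simp [hΨ]),
    sum_splits₃ S (fun B C D => A μ B * Φ C * Ψ D)
      (by simp [hA]) (by simp [hΦ]) (by simp [hΨ]), e]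
  simp only [SetAlg.add_apply, const, SetAlg.algebraMap_mul_apply, SetAlg.sub_apply]
  simp only [SetAlg.mul_apply, del_apply]
  congr 1
  · rw [← sum_sub_distrib]
    refine sum_congr rfl fun B _ => ?_
    ring
  · congr 1
    refine sum_congr rfl fun B _ => ?_
    rw [mul_sum]
    refine sum_congr rfl fun C _ => ?_
    ring

theorem splits₂_eq_empty {S : Finset α} (hS : S.card ≤ 1) : splits₂ S = ∅ := by
  refine eq_empty_of_forall_notMem fun x hx => ?_
  simp only [splits₂, mem_filter] at hx
  obtain ⟨-, h1, h2, hd, rfl⟩ := hx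
  rw [card_union_of_disjoint hd] at hS
  have := h1.card_pos
  have := h2.card_pos
  omega

theorem splits₃_eq_empty {S : Finset α} (hS : S.card ≤ 1) : splits₃ S = ∅ := by
  refine eq_empty_of_forall_notMem fun x hx => ?_
  have h := card_lt_of_mem_splits₃ hx
  simp only [splits₃, mem_filter] at hx
  have := hx.2.1.card_pos
  omega

/-- Only single particles are on shell. -/
structure IsOnShell (p : α → Fin 4 → ℝ) : Prop where
  singleton : ∀ a, mdot (totalMom p {a}) (totalMom p {a}) = 0
  ne_zero : ∀ S : Finset α, 2 ≤ S.card → mdot (totalMom p S) (totalMom p S) ≠ 0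

theorem covBox_apply_of_card_le_one {p : α → Fin 4 → ℝ} (hp : IsOnShell p) (k : ℂ)
    {A : Fin 4 → SetAlg α} {f : SetAlg α} (hA : ∀ μ, A μ ∅ = 0) (hf : f ∅ = 0) {S : Finset α}
    (hS : S.card ≤ 1) : covBox p k A f S = 0 := by
  rw [covBox_apply p k A f hA hf, splits₂_eq_empty hS, splits₃_eq_empty hS]
  rcases Nat.le_one_iff_eq_zero_or_eq_one.1 hS with h | h
  · rw [card_eq_zero.1 h]; simp [hf]
  · obtain ⟨a, rfl⟩ := card_eq_one.1 h
    rw [hp.singleton]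
    simp

theorem current_apply_of_card_le_one {p : α → Fin 4 → ℝ} (k : ℂ)
    {A : Fin 4 → SetAlg α} {Φ Ψ : SetAlg α} (hA : ∀ μ, A μ ∅ = 0) (hΦ : Φ ∅ = 0) (hΨ : Ψ ∅ = 0)
    (μ : Fin 4) {S : Finset α} (hS : S.card ≤ 1) : current p k A Φ Ψ μ S = 0 := by
  rw [current_apply p k A Φ Ψ hA hΦ hΨ, splits₂_eq_empty hS, splits₃_eq_empty hS]
  simp

/-- The classical field equations with coupling `g`. -/
structure IsSolution (p : α → Fin 4 → ℝ) (g : ℂ) (A : Fin 4 → SetAlg α) (Φ Ψ : SetAlg α) :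
    Prop where
  photon_empty : ∀ μ, A μ ∅ = 0
  phiStar_empty : Φ ∅ = 0
  phi_empty : Ψ ∅ = 0
  phiStar : covBox p g A Φ = 0
  phi : covBox p (-g) A Ψ = 0
  photon : ∀ μ, box p (A μ) = const g * current p g A Φ Ψ μ

end FieldEquations

theorem FieldME.ext_iff' {α : Type*} {F G : FieldME α} : F = G ↔
    ∀ S, F.phiStar S = G.phiStar S ∧ F.phi S = G.phi S ∧ F.photon S = G.photon S := by
  refine ⟨by rintro rfl S; simp, fun h => ?_⟩
  cases F; cases G
  congr
  · exact funext fun S => (h S).1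
  · exact funext fun S => (h S).2.1
  · exact funext fun S => (h S).2.2

/-! ### Tree-level matrix elements as the unique solution of the field equations -/

section TreeLevel

variable {α : Type*} [Fintype α] [DecidableEq α] {sp : α → Species}

/-- The matrix elements of `φ*` as an element of the convolution algebra. -/
def FieldME.phiStarAlg (F : FieldME α) : SetAlg α := ⟨F.phiStar⟩

/-- The matrix elements of `φ` as an element of the convolution algebra. -/
def FieldME.phiAlg (F : FieldME α) : SetAlg α := ⟨F.phi⟩

/-- The matrix elements of `A^μ` as elements of the convolution algebra. -/
def FieldME.photonAlg (F : FieldME α) (μ : Fin 4) : SetAlg α := ⟨fun S => F.photon S μ⟩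

theorem feynmanStep_phiStar (X : OutState sp) (g : ℝ) {F : FieldME α}
    (hA : ∀ μ, F.photonAlg μ ∅ = 0) (hf : F.phiStarAlg ∅ = 0) (S : Finset α) :
    (feynmanStep X g F).phiStar S = (∑ a, if S = {a} ∧ sp a = .scalar then 1 else 0) +
      (mdot (X.total S) (X.total S))⁻¹ * (mdot (X.total S) (X.total S) * F.phiStar S -
        covBox X.mom g F.photonAlg F.phiStarAlg S) := by
  rw [covBox_apply _ _ _ _ hA hf]
  simp only [feynmanStep, X.total_eq, FieldME.phiStarAlg, FieldME.photonAlg, SetAlg.mk_apply]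
  ring

theorem feynmanStep_phi (X : OutState sp) (g : ℝ) {F : FieldME α}
    (hA : ∀ μ, F.photonAlg μ ∅ = 0) (hf : F.phiAlg ∅ = 0) (S : Finset α) :
    (feynmanStep X g F).phi S = (∑ a, if S = {a} ∧ sp a = .antiscalar then 1 else 0) +
      (mdot (X.total S) (X.total S))⁻¹ * (mdot (X.total S) (X.total S) * F.phi S -
        covBox X.mom (-g) F.photonAlg F.phiAlg S) := by
  rw [covBox_apply _ _ _ _ hA hf]
  simp only [feynmanStep, X.total_eq, FieldME.phiAlg, FieldME.photonAlg, SetAlg.mk_apply]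
  ring

theorem feynmanStep_photon (X : OutState sp) (g : ℝ) {F : FieldME α}
    (hA : ∀ μ, F.photonAlg μ ∅ = 0) (hΦ : F.phiStarAlg ∅ = 0) (hΨ : F.phiAlg ∅ = 0)
    (S : Finset α) (μ : Fin 4) :
    (feynmanStep X g F).photon S μ =
      (∑ a, if S = {a} ∧ sp a = .photon then star (X.pol a μ) else 0) +
      (mdot (X.total S) (X.total S))⁻¹ *
        (g * current X.mom g F.photonAlg F.phiStarAlg F.phiAlg μ S) := by
  rw [current_apply _ _ _ _ _ hA hΦ hΨ]
  simp only [feynmanStep, X.total_eq, FieldME.phiAlg, FieldME.phiStarAlg, FieldME.photonAlg,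
    SetAlg.mk_apply]
  ring

theorem sum_source_eq_zero {S : Finset α} (hS : S.card ≠ 1) (q : α → Prop) [DecidablePred q]
    (v : α → ℂ) : (∑ a, if S = {a} ∧ q a then v a else 0) = 0 := by
  refine sum_eq_zero fun a _ => if_neg fun h => hS ?_
  rw [h.1, card_singleton]

theorem sum_source_singleton (b : α) (q : α → Prop) [DecidablePred q] (v : α → ℂ) :
    (∑ a, if ({b} : Finset α) = {a} ∧ q a then v a else 0) = if q b then v b else 0 := by
  rw [sum_eq_single b]
  · simp
  · intro a _ hab
    rw [if_neg]
    rintro ⟨h, -⟩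
    exact hab (singleton_injective h).symm
  · simp

/-- External wave functions. -/
structure HasSources (X : OutState sp) (A : Fin 4 → SetAlg α) (Φ Ψ : SetAlg α) : Prop where
  phiStar : ∀ a, Φ {a} = if sp a = .scalar then 1 else 0
  phi : ∀ a, Ψ {a} = if sp a = .antiscalar then 1 else 0
  photon : ∀ a μ, A μ {a} = if sp a = .photon then star (X.pol a μ) else 0

/-- A fixed point of the Feynman rules is determined by the external particles. -/
theorem feynmanStep_fixed_unique (X : OutState sp) (g : ℝ) {F G : FieldME α}
    (hF : feynmanStep X g F = F) (hG : feynmanStep X g G = G) : F = G := by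
  have key : ∀ (k : ℕ) (S : Finset α), S.card < k →
      F.phiStar S = G.phiStar S ∧ F.phi S = G.phi S ∧ F.photon S = G.photon S := by
    intro k
    induction k with
    | zero => intro S hS; exact absurd hS (Nat.not_lt_zero _)
    | succ k ih =>
      intro S hS
      have := feynmanStep_congr X g ih S hS
      rwa [hF, hG] at this
  exact FieldME.ext_iff'.2 fun S => key _ S (Nat.lt_succ_self _)

/-- For at least two particles `P²` is invertible, and the rule is the wave equation divided by
`P²`. For a single particle `P² = 0`, whose inverse is 0 by convention, so the rule reduces to the
source term while the wave equation is vacuous. -/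
theorem feynmanStep_eq_self_iff (X : OutState sp) (g : ℝ) (hp : IsOnShell X.mom)
    {F : FieldME α} :
    feynmanStep X g F = F ↔ IsSolution X.mom g F.photonAlg F.phiStarAlg F.phiAlg ∧
      HasSources X F.photonAlg F.phiStarAlg F.phiAlg := by
  constructor
  · intro h
    have e : ∀ S : Finset α, S.card = 0 → (F.phiStarAlg S = 0 ∧ F.phiAlg S = 0) ∧
        ∀ μ, F.photonAlg μ S = 0 := by
      intro S hS
      have hS1 : S.card ≤ 1 := by omega
      have hS2 : S.card ≠ 1 := by omega
      have h' := FieldME.ext_iff'.1 h S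
      simp only [funext_iff] at h'
      simp only [feynmanStep, splits₂_eq_empty hS1, splits₃_eq_empty hS1,
        sum_source_eq_zero hS2, sum_empty, mul_zero, sub_zero, add_zero] at h'
      exact ⟨⟨h'.1.symm, h'.2.1.symm⟩, fun μ => (h'.2.2 μ).symm⟩
    have hA : ∀ μ, F.photonAlg μ ∅ = 0 := (e ∅ rfl).2
    have hΦ : F.phiStarAlg ∅ = 0 := (e ∅ rfl).1.1
    have hΨ : F.phiAlg ∅ = 0 := (e ∅ rfl).1.2
    have h' := fun S => FieldME.ext_iff'.1 h S
    simp only [funext_iff, feynmanStep_photon X g hA hΦ hΨ, feynmanStep_phi X g hA hΨ,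
      feynmanStep_phiStar X g hA hΦ] at h'
    refine ⟨⟨hA, hΦ, hΨ, ?_, ?_, ?_⟩, ⟨?_, ?_, ?_⟩⟩
    · refine DFunLike.ext _ _ fun S => ?_
      rcases le_or_gt S.card 1 with hS | hS
      · exact covBox_apply_of_card_le_one hp _ hA hΦ hS
      have h1 := (h' S).1
      rw [sum_source_eq_zero (by omega), zero_add, X.total_eq, inv_mul_eq_iff_eq_mul₀ (hp.ne_zero S hS)] at h1
      rw [SetAlg.zero_apply]
      linear_combination -h1
    · refine DFunLike.ext _ _ fun S => ?_
      rcases le_or_gt S.card 1 with hS | hS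
      · exact covBox_apply_of_card_le_one hp _ hA hΨ hS
      have h1 := (h' S).2.1
      rw [sum_source_eq_zero (by omega), zero_add, X.total_eq, inv_mul_eq_iff_eq_mul₀ (hp.ne_zero S hS)] at h1
      rw [SetAlg.zero_apply]
      linear_combination -h1
    · intro μ
      refine DFunLike.ext _ _ fun S => ?_
      rw [box_apply, const, SetAlg.algebraMap_mul_apply]
      rcases le_or_gt S.card 1 with hS | hS
      · rw [current_apply_of_card_le_one _ hA hΦ hΨ μ hS, mul_zero]
        rcases Nat.le_one_iff_eq_zero_or_eq_one.1 hS with h0 | h0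
        · rw [card_eq_zero.1 h0]; simp [hA]
        · obtain ⟨a, rfl⟩ := card_eq_one.1 h0
          rw [hp.singleton, zero_mul]
      have h1 := (h' S).2.2 μ
      rw [sum_source_eq_zero (by omega), zero_add, X.total_eq, inv_mul_eq_iff_eq_mul₀ (hp.ne_zero S hS)] at h1
      exact h1.symm
    · intro a
      have h1 := (h' {a}).1
      rw [X.total_eq, hp.singleton, inv_zero, zero_mul, add_zero, sum_source_singleton] at h1
      exact h1.symm
    · intro a
      have h1 := (h' {a}).2.1
      rw [X.total_eq, hp.singleton, inv_zero, zero_mul, add_zero, sum_source_singleton] at h1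
      exact h1.symm
    · intro a μ
      have h1 := (h' {a}).2.2 μ
      rw [X.total_eq, hp.singleton, inv_zero, zero_mul, add_zero, sum_source_singleton] at h1
      exact h1.symm
  · rintro ⟨h, s⟩
    have tri : ∀ S : Finset α, S = ∅ ∨ (∃ a, S = {a}) ∨ 2 ≤ S.card := by
      intro S
      rcases Nat.lt_or_ge S.card 2 with h | h
      · rcases Nat.le_one_iff_eq_zero_or_eq_one.1 (Nat.lt_succ_iff.1 h) with h | h
        · exact Or.inl (card_eq_zero.1 h)
        · exact Or.inr (Or.inl (card_eq_one.1 h))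
      · exact Or.inr (Or.inr h)
    refine FieldME.ext_iff'.2 fun S => ⟨?_, ?_, funext fun μ => ?_⟩
    · rw [feynmanStep_phiStar X g h.photon_empty h.phiStar_empty, h.phiStar, X.total_eq,
        SetAlg.zero_apply, sub_zero]
      rcases tri S with rfl | ⟨a, rfl⟩ | hS
      · rw [sum_source_eq_zero (by simp)]
        simpa [mdot, FieldME.phiStarAlg] using h.phiStar_empty.symm
      · rw [hp.singleton, inv_zero, zero_mul, add_zero, sum_source_singleton]
        exact (s.phiStar a).symm
      · rw [sum_source_eq_zero (by omega), inv_mul_cancel_left₀ (hp.ne_zero S hS), zero_add]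
    · rw [feynmanStep_phi X g h.photon_empty h.phi_empty, h.phi, X.total_eq,
        SetAlg.zero_apply, sub_zero]
      rcases tri S with rfl | ⟨a, rfl⟩ | hS
      · rw [sum_source_eq_zero (by simp)]
        simpa [mdot, FieldME.phiAlg] using h.phi_empty.symm
      · rw [hp.singleton, inv_zero, zero_mul, add_zero, sum_source_singleton]
        exact (s.phi a).symm
      · rw [sum_source_eq_zero (by omega), inv_mul_cancel_left₀ (hp.ne_zero S hS), zero_add]
    · have h1 := DFunLike.congr_fun (h.photon μ) S
      rw [box_apply, const, SetAlg.algebraMap_mul_apply] at h1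
      rw [feynmanStep_photon X g h.photon_empty h.phiStar_empty h.phi_empty, X.total_eq, ← h1]
      rcases tri S with rfl | ⟨a, rfl⟩ | hS
      · rw [sum_source_eq_zero (by simp)]
        simpa [mdot, FieldME.photonAlg] using (h.photon_empty μ).symm
      · rw [hp.singleton, inv_zero, zero_mul, add_zero, sum_source_singleton]
        exact (s.photon a μ).symm
      · rw [sum_source_eq_zero (by omega), inv_mul_cancel_left₀ (hp.ne_zero S hS), zero_add]
        rfl

end TreeLevel

/-! ### Products over all distributions of the particles -/

/-- For the induction on `s`, distributions of a subset `S` are represented by functions on all of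
`α` that take the dummy value `i₀` outside `S`; this makes the representation unique. -/
theorem SetAlg.prod_apply_aux {α ι : Type*} [Fintype α] [DecidableEq α] [DecidableEq ι]
    (F : ι → SetAlg α) (i₀ : ι) (s : Finset ι) (S : Finset α) :
    (∏ i ∈ s, F i) S = ∑ f ∈ Fintype.piFinset (fun a => if a ∈ S then s else {i₀}),
      ∏ i ∈ s, F i (S.filter fun a => f a = i) := by
  induction s using Finset.induction_on generalizing S with
  | empty =>
    rw [prod_empty, SetAlg.one_apply]
    split_ifs with hS
    · subst hS
      simp
    · obtain ⟨a, ha⟩ := nonempty_iff_ne_empty.2 hS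
      rw [sum_eq_zero]
      intro f hf
      have := Fintype.mem_piFinset.1 hf a
      simp [ha] at this
  | insert k s hk ih =>
    rw [prod_insert hk, SetAlg.mul_apply]
    simp only [ih, mul_sum]
    rw [sum_sigma']
    -- The block of the new index `k` is split off. In the inverse map its elements are reset to
    -- `i₀`, since they lie outside the remaining set.
    refine sum_nbij' (fun x a => if a ∈ x.1 then k else x.2 a)
      (fun f => ⟨S.filter fun a => f a = k, fun a => if a ∈ S ∧ f a = k then i₀ else f a⟩)
      ?_ ?_ ?_ ?_ ?_
    · rintro ⟨B, f⟩ hx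
      simp only [mem_sigma, mem_powerset, Fintype.mem_piFinset] at hx ⊢
      intro a
      have h1 := hx.2 a
      have h2 := @hx.1 a
      by_cases haB : a ∈ B
      · simp [haB, h2 haB]
      · by_cases haS : a ∈ S
        · simp only [mem_sdiff, haS, haB, not_false_eq_true, and_self, if_true] at h1
          simp [haB, haS, h1]
        · simp only [mem_sdiff, haS, false_and, if_false] at h1
          simpa [haB, haS] using h1
    · intro f hf
      simp only [mem_sigma, mem_powerset, Fintype.mem_piFinset] at hf ⊢
      refine ⟨filter_subset _ _, fun a => ?_⟩
      have h1 := hf a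
      by_cases haS : a ∈ S
      · simp only [haS, if_true, mem_insert] at h1
        by_cases hfa : f a = k
        · simp [haS, hfa]
        · simpa [haS, hfa] using h1
      · simpa [haS] using h1
    · rintro ⟨B, f⟩ hx
      simp only [mem_sigma, mem_powerset, Fintype.mem_piFinset] at hx
      have hB : S.filter (fun a => (if a ∈ B then k else f a) = k) = B := by
        ext a
        have h1 := hx.2 a
        have h2 := @hx.1 a
        by_cases haB : a ∈ B
        · simp [haB, h2 haB]
        · by_cases haS : a ∈ S
          · simp only [mem_sdiff, haS, haB, not_false_eq_true, and_self, if_true] at h1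
            simp only [mem_filter, haS, haB, if_false, true_and, iff_false]
            rintro rfl
            exact hk h1
          · simp [haB, haS]
      refine Sigma.mk.inj_iff.2 ⟨hB, heq_of_eq (funext fun a => ?_)⟩
      have h1 := hx.2 a
      have h2 := @hx.1 a
      by_cases haB : a ∈ B
      · simp only [mem_sdiff, haB, not_true_eq_false, and_false, if_false, mem_singleton] at h1
        simp [haB, h2 haB, h1]
      · simp only [haB, if_false]
        rw [if_neg]
        rintro ⟨haS, hfa⟩
        simp only [mem_sdiff, haS, haB, not_false_eq_true, and_self, if_true] at h1
        exact hk (hfa ▸ h1)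
    · intro f hf
      simp only [Fintype.mem_piFinset] at hf
      funext a
      by_cases h : a ∈ S ∧ f a = k
      · simp [h]
      · simp only [mem_filter, h, if_false]
    · rintro ⟨B, f⟩ hx
      simp only [mem_sigma, mem_powerset, Fintype.mem_piFinset] at hx
      rw [prod_insert hk]
      congr 1
      · congr 1
        ext a
        have h1 := hx.2 a
        have h2 := @hx.1 a
        by_cases haB : a ∈ B
        · simp [haB, h2 haB]
        · by_cases haS : a ∈ S
          · simp only [mem_sdiff, haS, haB, not_false_eq_true, and_self, if_true] at h1
            simp only [mem_filter, haS, haB, if_false, true_and, false_iff]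
            rintro rfl
            exact hk h1
          · simp [haB, haS]
      · refine prod_congr rfl fun i hi => ?_
        congr 1
        ext a
        by_cases haB : a ∈ B
        · have : k ≠ i := by rintro rfl; exact hk hi
          simp [haB, this]
        · simp [haB]

theorem SetAlg.prod_apply_univ {α ι : Type*} [Fintype α] [DecidableEq α] [Fintype ι] [DecidableEq ι]
    (F : ι → SetAlg α) :
    (∏ i, F i) univ = ∑ f : α → ι, ∏ i, F i {a | f a = i} := by
  -- Without an index there is no dummy value; this is the empty product.
  rcases isEmpty_or_nonempty ι with hι | hι
  · rcases isEmpty_or_nonempty α with hα | hα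
    · simp [SetAlg.one_apply, univ_eq_empty]
    · simp [SetAlg.one_apply, univ_nonempty.ne_empty]
  · rw [SetAlg.prod_apply_aux F (Classical.arbitrary ι)]
    simp

/-! ### Charge conservation -/

section Charge

variable {α : Type*} [DecidableEq α] {sp : α → Species}

/-- The total charge of the particles in `S`. -/
def totalCharge (sp : α → Species) (S : Finset α) : ℤ := ∑ a ∈ S, (sp a).charge

theorem totalCharge_of_mem_splits₂ {S : Finset α} {x : Finset α × Finset α}
    (hx : x ∈ splits₂ S) :
    totalCharge sp S = totalCharge sp x.1 + totalCharge sp x.2 := by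
  simp only [splits₂, mem_filter] at hx
  obtain ⟨-, -, -, hd, rfl⟩ := hx
  exact sum_union hd

theorem totalCharge_of_mem_splits₃ {S : Finset α} {x : Finset α × Finset α × Finset α}
    (hx : x ∈ splits₃ S) :
    totalCharge sp S = totalCharge sp x.1 + totalCharge sp x.2.1 + totalCharge sp x.2.2 := by
  simp only [splits₃, mem_filter] at hx
  obtain ⟨-, -, -, -, h1, h2, h3, rfl⟩ := hx
  rw [totalCharge, sum_union (disjoint_union_left.2 ⟨h2, h3⟩), sum_union h1]
  rfl

/-- Charge conservation for the matrix elements of the fundamental fields. -/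
structure IsCharged (sp : α → Species) (F : FieldME α) : Prop where
  phiStar : ∀ S, totalCharge sp S ≠ 1 → F.phiStar S = 0
  phi : ∀ S, totalCharge sp S ≠ -1 → F.phi S = 0
  photon : ∀ S, totalCharge sp S ≠ 0 → F.photon S = 0

theorem IsCharged.feynmanStep [Fintype α] {F : FieldME α} (hF : IsCharged sp F) (X : OutState sp) (g : ℝ) :
    IsCharged sp (feynmanStep X g F) := by
  have src : ∀ (S : Finset α) (s : Species) (v : α → ℂ), totalCharge sp S ≠ s.charge →
      (∑ a, if S = {a} ∧ sp a = s then v a else 0) = 0 := by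
    intro S s v hS
    refine sum_eq_zero fun a _ => if_neg ?_
    rintro ⟨rfl, rfl⟩
    simp [totalCharge] at hS
  have m0 : ∀ x : Fin 4 → ℂ, mdot x 0 = 0 := fun x => by simp [mdot]
  have m0' : ∀ x : Fin 4 → ℂ, mdot 0 x = 0 := fun x => by simp [mdot]
  refine ⟨fun S hS => ?_, fun S hS => ?_, fun S hS => funext fun μ => ?_⟩
  · simp only [ScalarQED.feynmanStep]
    rw [src S .scalar (fun _ => 1) hS,
      sum_eq_zero (s := splits₂ S) fun x hx => ?_, sum_eq_zero (s := splits₃ S) fun x hx => ?_]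
    · simp
    · rw [totalCharge_of_mem_splits₃ hx] at hS
      by_cases h1 : totalCharge sp x.1 = 0
      · by_cases h2 : totalCharge sp x.2.1 = 0
        · rw [hF.phiStar x.2.2 (by omega), mul_zero]
        · rw [hF.photon x.2.1 h2, m0, zero_mul]
      · rw [hF.photon x.1 h1, m0', zero_mul]
    · rw [totalCharge_of_mem_splits₂ hx] at hS
      by_cases h1 : totalCharge sp x.1 = 0
      · rw [hF.phiStar x.2 (by omega), mul_zero]
      · rw [hF.photon x.1 h1, m0, zero_mul]
  · simp only [ScalarQED.feynmanStep]
    rw [src S .antiscalar (fun _ => 1) hS,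
      sum_eq_zero (s := splits₂ S) fun x hx => ?_, sum_eq_zero (s := splits₃ S) fun x hx => ?_]
    · simp
    · rw [totalCharge_of_mem_splits₃ hx] at hS
      by_cases h1 : totalCharge sp x.1 = 0
      · by_cases h2 : totalCharge sp x.2.1 = 0
        · rw [hF.phi x.2.2 (by omega), mul_zero]
        · rw [hF.photon x.2.1 h2, m0, zero_mul]
      · rw [hF.photon x.1 h1, m0', zero_mul]
    · rw [totalCharge_of_mem_splits₂ hx] at hS
      by_cases h1 : totalCharge sp x.1 = 0
      · rw [hF.phi x.2 (by omega), mul_zero]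
      · rw [hF.photon x.1 h1, m0, zero_mul]
  · simp only [ScalarQED.feynmanStep]
    rw [src S .photon (fun a => star (X.pol a μ)) hS,
      sum_eq_zero (s := splits₂ S) fun x hx => ?_, sum_eq_zero (s := splits₃ S) fun x hx => ?_]
    · simp
    · rw [totalCharge_of_mem_splits₃ hx] at hS
      by_cases h1 : totalCharge sp x.1 = 0
      · by_cases h2 : totalCharge sp x.2.1 = 1
        · rw [hF.phi x.2.2 (by omega), mul_zero]
        · rw [hF.phiStar x.2.1 h2, mul_zero, zero_mul]
      · rw [hF.photon x.1 h1, Pi.zero_apply, zero_mul, zero_mul]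
    · rw [totalCharge_of_mem_splits₂ hx] at hS
      by_cases h1 : totalCharge sp x.1 = 1
      · rw [hF.phi x.2 (by omega), mul_zero]
      · rw [hF.phiStar x.1 h1, mul_zero, zero_mul]

theorem isCharged_treeME [Fintype α] (X : OutState sp) (g : ℝ) : IsCharged sp (treeME X g) := by
  rw [treeME]
  generalize Fintype.card α = k
  induction k with
  | zero => exact ⟨fun _ _ => rfl, fun _ _ => rfl, fun _ _ => rfl⟩
  | succ k ih =>
    rw [Function.iterate_succ_apply']
    exact ih.feynmanStep X g

/-- The derivation which multiplies by the charge. -/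
def chargeDer (sp : α → Species) : Derivation ℂ (SetAlg α) (SetAlg α) :=
  SetAlg.wder fun a => ((sp a).charge : ℂ)

theorem chargeDer_apply (f : SetAlg α) (S : Finset α) :
    chargeDer sp f S = (totalCharge sp S : ℂ) * f S := by
  simp [chargeDer, SetAlg.wder_apply, totalCharge]

/-- Neutral gauge transformations preserve the charge. -/
theorem gaugeF_apply_eq_zero {k : ℂ} {χ f : SetAlg α} {q : ℤ}
    (hχ : ∀ S, totalCharge sp S ≠ 0 → χ S = 0) (hf : ∀ S, totalCharge sp S ≠ q → f S = 0)
    {S : Finset α} (hS : totalCharge sp S ≠ q) : gaugeF k χ f S = 0 := by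
  have h1 : chargeDer sp χ = 0 := by
    refine DFunLike.ext _ _ fun T => ?_
    rw [chargeDer_apply, SetAlg.zero_apply]
    by_cases h : totalCharge sp T = 0
    · rw [h]; simp
    · rw [hχ T h, mul_zero]
  have h2 : chargeDer sp f = const q * f := by
    refine DFunLike.ext _ _ fun T => ?_
    rw [chargeDer_apply, const, SetAlg.algebraMap_mul_apply]
    by_cases h : totalCharge sp T = q
    · rw [h]
    · rw [hf T h, mul_zero, mul_zero]
  have h3 : chargeDer sp (gaugeF k χ f) = const q * gaugeF k χ f := by
    have h4 : chargeDer sp (SetAlg.exp (-(const k * χ))) = 0 := by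
      rw [chargeDer, SetAlg.wder_exp, ← chargeDer, map_neg, Derivation.leibniz, h1, const,
        Derivation.map_algebraMap]
      simp
    rw [gaugeF, Derivation.leibniz, h2, h4, smul_zero, add_zero, smul_eq_mul]
    ring
  have h5 := DFunLike.congr_fun h3 S
  rw [chargeDer_apply, const, SetAlg.algebraMap_mul_apply] at h5
  have h6 : ((totalCharge sp S : ℂ) - q) ≠ 0 := by
    rw [sub_ne_zero]
    exact_mod_cast hS
  exact (mul_eq_zero.1 (by linear_combination h5 :
    ((totalCharge sp S : ℂ) - q) * gaugeF k χ f S = 0)).resolve_left h6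

end Charge

/-! ### Wilson lines -/

section Wilson

variable {α : Type*} [DecidableEq α]

theorem mdot_add_right {R : Type*} [CommRing R] (x y z : Fin 4 → R) :
    mdot x (y + z) = mdot x y + mdot x z := by
  simp only [mdot, Pi.add_apply]; ring

theorem mdot_smul_right {R : Type*} [CommRing R] (r : R) (x y : Fin 4 → R) :
    mdot x (r • y) = r * mdot x y := by
  simp only [mdot, Pi.smul_apply, smul_eq_mul]; ring

theorem mdot_comm {R : Type*} [CommRing R] (x y : Fin 4 → R) : mdot x y = mdot y x := by
  simp only [mdot]; ring

/-- The exponent of a Wilson line along `t` of charge `k`. -/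
def wilsonExponent (p : α → Fin 4 → ℝ) (k : ℂ) (t : Fin 4 → ℝ) (A : Fin 4 → SetAlg α) : SetAlg α :=
  ⟨fun B => k * mdot (toC t) (fun μ => A μ B) / mdot (toC t) (totalMom p B)⟩

/-- A field of charge `k` dressed with a Wilson line. -/
def dressed (p : α → Fin 4 → ℝ) (k : ℂ) (t : Fin 4 → ℝ) (A : Fin 4 → SetAlg α) (f : SetAlg α) :
    SetAlg α :=
  f * SetAlg.exp (wilsonExponent p k t A)

/-- Dressed fields are gauge invariant. -/
theorem dressed_gauge {p : α → Fin 4 → ℝ} {t : Fin 4 → ℝ} {S : Finset α}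
    (h : ∀ B ⊆ S, B.Nonempty → mdot (toC t) (totalMom p B) ≠ 0) (k : ℂ) (A : Fin 4 → SetAlg α)
    (χ f : SetAlg α) :
    dressed p k t (gaugeA p χ A) (gaugeF k χ f) S = dressed p k t A f S := by
  -- The shift of `A(C)` is `χ(C)` times the momentum of `C`; the denominator cancels it, leaving `k
  -- χ` in the exponent, which compensates the factor `exp(-kχ)` of the field.
  have e : ∀ B ⊆ S, SetAlg.exp (wilsonExponent p k t (gaugeA p χ A)) B =
      (SetAlg.exp (const k * χ) * SetAlg.exp (wilsonExponent p k t A) : SetAlg α) B := by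
    intro B hB
    rw [← SetAlg.exp_add]
    refine SetAlg.exp_congr fun C hC hC' => ?_
    have e1 : (fun μ => gaugeA p χ A μ C) = (fun μ => A μ C) + χ C • totalMom p C := by
      funext μ
      simp [gaugeA, del_apply, mul_comm]
    have := h C (hC.trans hB) hC'
    simp only [wilsonExponent, SetAlg.mk_apply, SetAlg.add_apply, const,
      SetAlg.algebraMap_mul_apply, e1, mdot_add_right, mdot_smul_right]
    field_simp
    ring
  have e2 : gaugeF k χ f * (SetAlg.exp (const k * χ) * SetAlg.exp (wilsonExponent p k t A)) =
      f * SetAlg.exp (wilsonExponent p k t A) := by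
    rw [gaugeF]
    linear_combination f * SetAlg.exp (wilsonExponent p k t A) *
      SetAlg.exp_mul_exp_neg (const k * χ)
  rw [dressed, dressed, ← e2]
  exact SetAlg.mul_congr (fun _ _ => rfl) e

variable [Fintype α] {sp : α → Species}

theorem wilsonME_eq (X : OutState sp) (g : ℝ) (σ : ℤ) (t : Fin 4 → ℝ) (S : Finset α) :
    wilsonME X g σ t S =
      SetAlg.exp (wilsonExponent X.mom (σ * g) t (treeME X g).photonAlg) S := by
  refine sum_congr rfl fun π _ => prod_congr rfl fun B _ => ?_
  simp only [wilsonExponentME, wilsonExponent, SetAlg.mk_apply, X.total_eq, FieldME.photonAlg]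
  rw [div_eq_mul_inv, div_eq_mul_inv]
  -- The factor `-i` of the exponent and the `i` of the line integral multiply to 1.
  linear_combination -(σ * g * mdot (toC t) ((treeME X g).photon B) *
    (mdot (toC t) (totalMom X.mom B))⁻¹) * Complex.I_mul_I

theorem phiStarWilsonME_eq (X : OutState sp) (g : ℝ) (t : Fin 4 → ℝ) (S : Finset α) :
    phiStarWilsonME X g t S =
      dressed X.mom g t (treeME X g).photonAlg (treeME X g).phiStarAlg S := by
  rw [phiStarWilsonME, dressed, SetAlg.mul_apply]
  refine sum_congr rfl fun B _ => ?_
  rw [wilsonME_eq, Int.cast_one, one_mul]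
  rfl

theorem wilsonDagPhiME_eq (X : OutState sp) (g : ℝ) (t : Fin 4 → ℝ) (S : Finset α) :
    wilsonDagPhiME X g t S =
      dressed X.mom (-g) t (treeME X g).photonAlg (treeME X g).phiAlg S := by
  rw [wilsonDagPhiME, dressed, SetAlg.mul_apply]
  refine sum_congr rfl fun B _ => ?_
  rw [wilsonME_eq, Int.cast_neg, Int.cast_one, neg_one_mul]
  rfl

/-- Ward identity for the tree-level fields in Feynman gauge. -/
theorem treeME_shift_pol (X X' : OutState sp) (g : ℝ) (hp : IsOnShell X.mom)
    (hmom : X'.mom = X.mom) (z : α → ℂ)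
    (hz : ∀ a, sp a = .photon → X'.pol a = X.pol a + z a • toC (X.mom a)) :
    ∃ χ : SetAlg α,
      (treeME X' g).photonAlg = gaugeA X.mom χ (treeME X g).photonAlg ∧
      (treeME X' g).phiStarAlg = gaugeF g χ (treeME X g).phiStarAlg ∧
      (treeME X' g).phiAlg = gaugeF (-g) χ (treeME X g).phiAlg := by
  -- `z` is conjugated because outgoing photons carry the conjugate polarization. Supported on
  -- on-shell momenta, `χ` is annihilated by the d'Alembertian, so the Feynman-gauge photon equation
  -- is preserved.
  set χ : SetAlg α := ⟨fun S => ∑ a, if S = {a} ∧ sp a = .photon then star (z a) else 0⟩ with hχ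
  obtain ⟨h, s⟩ := (feynmanStep_eq_self_iff X g hp).1 (treeME_fixed X g)
  set A := (treeME X g).photonAlg
  set Φ := (treeME X g).phiStarAlg
  set Ψ := (treeME X g).phiAlg
  have hbox : box X.mom χ = 0 := by
    refine DFunLike.ext _ _ fun S => ?_
    rw [box_apply, SetAlg.zero_apply]
    by_cases hS : S.card = 1
    · obtain ⟨a, rfl⟩ := card_eq_one.1 hS
      rw [hp.singleton, zero_mul]
    · rw [hχ, SetAlg.mk_apply, sum_source_eq_zero hS, mul_zero]
  -- The transformed fields solve the same equations with the shifted sources; uniqueness of fixed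
  -- points identifies them with the tree-level fields of `X'`.
  let G : FieldME α := ⟨gaugeF g χ Φ, gaugeF (-g) χ Ψ, fun S μ => gaugeA X.mom χ A μ S⟩
  have hG : feynmanStep X' g G = G := by
    rw [feynmanStep_eq_self_iff X' g (by rwa [hmom]), hmom]
    change IsSolution X.mom g (gaugeA X.mom χ A) (gaugeF g χ Φ) (gaugeF (-g) χ Ψ) ∧
      HasSources X' (gaugeA X.mom χ A) (gaugeF g χ Φ) (gaugeF (-g) χ Ψ)
    refine ⟨⟨fun μ => ?_, gaugeF_apply_empty _ _ h.phiStar_empty, gaugeF_apply_empty _ _ h.phi_empty, ?_, ?_, fun μ => ?_⟩,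
      ⟨fun a => ?_, fun a => ?_, fun a μ => ?_⟩⟩
    · simp [gaugeA, h.photon_empty, del_apply]
    · rw [covBox_gauge, h.phiStar, gaugeF, mul_zero]
    · rw [covBox_gauge, h.phi, gaugeF, mul_zero]
    · rw [current_gauge, ← h.photon]
      refine DFunLike.ext _ _ fun S => ?_
      have h1 := DFunLike.congr_fun hbox S
      rw [box_apply, SetAlg.zero_apply] at h1
      rw [box_apply, box_apply, gaugeA, SetAlg.add_apply, del_apply]
      linear_combination totalMom X.mom S μ * h1
    · rw [gaugeF_apply_singleton _ _ h.phiStar_empty, s.phiStar]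
    · rw [gaugeF_apply_singleton _ _ h.phi_empty, s.phi]
    · rw [gaugeA, SetAlg.add_apply, del_apply, s.photon, hχ, SetAlg.mk_apply,
        sum_source_singleton, totalMom_singleton]
      split_ifs with ha
      · rw [hz a ha]
        simp [toC, mul_comm]
      · simp
  have hT : treeME X' g = G := feynmanStep_fixed_unique X' g (treeME_fixed X' g) hG
  refine ⟨χ, ?_, ?_, ?_⟩ <;> rw [hT] <;> rfl

end Wilson

/-! ### Temporal gauge -/

section Temporal

variable {α : Type*} [DecidableEq α]

/-- The gauge function which leads to the temporal gauge. -/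
def temporalGauge (p : α → Fin 4 → ℝ) (A : Fin 4 → SetAlg α) : SetAlg α :=
  ⟨fun S => -(A 0 S) / totalMom p S 0⟩

/-- Solutions of the field equations in temporal gauge with normalized external particles. -/
structure IsTemporalSolution (p : α → Fin 4 → ℝ) (g : ℂ) (A : Fin 4 → SetAlg α)
    (Φ Ψ : SetAlg α) : Prop where
  photon_empty : ∀ μ, A μ ∅ = 0
  phiStar_empty : Φ ∅ = 0
  phi_empty : Ψ ∅ = 0
  temporal : ∀ S, A 0 S = 0
  phiStar : covBox p g A Φ = 0
  phi : covBox p (-g) A Ψ = 0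
  photon : ∀ S : Finset α, S.Nonempty → ∀ μ,
    mdot (totalMom p S) (totalMom p S) * A μ S * totalMom p S 0 =
      g * (current p g A Φ Ψ μ S * totalMom p S 0 - totalMom p S μ * current p g A Φ Ψ 0 S)
  longitudinal : ∀ S : Finset α, 2 ≤ S.card →
    mdot (totalMom p S) (fun μ => A μ S) * totalMom p S 0 = -g * current p g A Φ Ψ 0 S
  phiStar_singleton : ∀ a, ‖Φ {a}‖ ≤ 1
  phi_singleton : ∀ a, ‖Ψ {a}‖ ≤ 1
  photon_singleton : ∀ a μ, ‖A μ {a}‖ ≤ 1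
  longitudinal_singleton : ∀ a, mdot (totalMom p {a}) (fun μ => A μ {a}) = 0

/-- A transverse polarization vector of unit norm is bounded in temporal gauge. -/
theorem norm_temporal_pol_le {q : Fin 4 → ℝ} {ε : Fin 4 → ℂ} (hq : q 0 ≠ 0) (hqq : mdot q q = 0)
    (h1 : mdot (star ε) ε = -1) (h2 : mdot (toC q) ε = 0) (μ : Fin 4) :
    ‖star (ε μ) - q μ * star (ε 0) / q 0‖ ≤ 1 := by
  have hq' : (q 0 : ℂ) ≠ 0 := by exact_mod_cast hq
  have hqq' : (q 0 : ℂ) * q 0 - q 1 * q 1 - q 2 * q 2 - q 3 * q 3 = 0 := by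
    simp only [mdot] at hqq
    exact_mod_cast hqq
  have h3 : mdot (toC q) (star ε) = 0 := by
    have := congrArg star h2
    simpa [mdot, toC] using this
  simp only [mdot, toC, Pi.star_apply] at h1 h2 h3
  set η : Fin 4 → ℂ := fun μ => star (ε μ) - q μ * star (ε 0) / q 0 with hη
  have hη0 : η 0 = 0 := by
    simp only [hη]
    field_simp
    ring
  have hs : ∀ μ, star (η μ) = ε μ - q μ * ε 0 / q 0 := fun μ => by
    simp [hη]
  -- Adding a multiple of the null vector `q`, orthogonal to `ε`, preserves the norm `-1`; since `η
  -- 0 = 0` this norm is minus the Euclidean one.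
  have key : η 1 * star (η 1) + η 2 * star (η 2) + η 3 * star (η 3) = 1 := by
    simp only [hs]
    simp only [hη]
    field_simp
    linear_combination (-(q 0 : ℂ) ^ 2) * h1 + q 0 * star (ε 0) * h2 + q 0 * ε 0 * h3
      - star (ε 0) * ε 0 * hqq'
  have hn : ∀ z : ℂ, z * star z = ((‖z‖ ^ 2 : ℝ) : ℂ) := fun z => by
    rw [Complex.star_def, Complex.mul_conj, Complex.normSq_eq_norm_sq]
  have key' : ‖η 1‖ ^ 2 + ‖η 2‖ ^ 2 + ‖η 3‖ ^ 2 = 1 := by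
    rw [hn, hn, hn] at key
    exact_mod_cast key
  change ‖η μ‖ ≤ 1
  have h := sq_nonneg ‖η 1‖
  have h' := sq_nonneg ‖η 2‖
  have h'' := sq_nonneg ‖η 3‖
  fin_cases μ
  · simp [hη0]
  all_goals
    refine abs_le_of_sq_le_sq' (a := _) (b := (1 : ℝ)) ?_ zero_le_one |>.2
    simp only [Fin.mk_one, Fin.reduceFinMk]
    linarith

variable {sp : α → Species}

/-- Current conservation gives `P² (P·A) = 0`, hence the Lorenz condition on composite states.
Subtracting `P A⁰/P⁰` then leaves the longitudinal part `-P² A⁰/P⁰ = -g J⁰/P⁰`: the propagator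
cancels, which is what makes this component small in a collinear sector. -/
theorem isTemporalSolution_gauge (X : OutState sp) (g : ℝ) (hp : IsOnShell X.mom)
    (hE : ∀ S : Finset α, S.Nonempty → totalMom X.mom S 0 ≠ 0)
    (hpol : ∀ a, sp a = .photon → mdot (star (X.pol a)) (X.pol a) = -1 ∧
      mdot (toC (X.mom a)) (X.pol a) = 0)
    {A : Fin 4 → SetAlg α} {Φ Ψ : SetAlg α} (h : IsSolution X.mom g A Φ Ψ)
    (s : HasSources X A Φ Ψ) :
    IsTemporalSolution X.mom g (gaugeA X.mom (temporalGauge X.mom A) A)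
      (gaugeF g (temporalGauge X.mom A) Φ) (gaugeF (-g) (temporalGauge X.mom A) Ψ) := by
  set χ := temporalGauge X.mom A with hχ
  have hA' : ∀ μ S, gaugeA X.mom χ A μ S =
      A μ S - totalMom X.mom S μ * A 0 S / totalMom X.mom S 0 := by
    intro μ S
    change A μ S + totalMom X.mom S μ * (-(A 0 S) / totalMom X.mom S 0) = _
    ring
  have hbox : ∀ μ S, mdot (totalMom X.mom S) (totalMom X.mom S) * A μ S =
      g * current X.mom g A Φ Ψ μ S := by
    intro μ S
    have := DFunLike.congr_fun (h.photon μ) S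
    rwa [box_apply, const, SetAlg.algebraMap_mul_apply] at this
  refine ⟨fun μ => ?_, gaugeF_apply_empty _ _ h.phiStar_empty, gaugeF_apply_empty _ _ h.phi_empty,
    fun S => ?_, ?_, ?_, fun S hS μ => ?_, fun S hS => ?_, fun a => ?_, fun a => ?_, fun a μ => ?_,
    fun a => ?_⟩
  · simp [hA', h.photon_empty]
  · rw [hA']
    rcases S.eq_empty_or_nonempty with rfl | hS
    · simp [h.photon_empty]
    · have := hE S hS
      field_simp
      ring
  · rw [covBox_gauge, h.phiStar, gaugeF, mul_zero]
  · rw [covBox_gauge, h.phi, gaugeF, mul_zero]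
  · rw [current_gauge, hA']
    have := hE S hS
    have h1 := hbox μ S
    have h2 := hbox 0 S
    field_simp
    linear_combination totalMom X.mom S 0 * h1 - totalMom X.mom S μ * h2
  · rw [current_gauge]
    have hS' := hE S (card_pos.1 (by omega))
    have h0 := hp.ne_zero S hS
    have hc : mdot (totalMom X.mom S) (fun μ => current X.mom g A Φ Ψ μ S) = 0 := by
      have := DFunLike.congr_fun (del_current X.mom g A Φ Ψ) S
      rw [h.phiStar, h.phi, zero_mul, mul_zero, sub_zero, SetAlg.zero_apply] at this
      simpa only [SetAlg.sub_apply, del_apply, mdot] using this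
    have hl : mdot (totalMom X.mom S) (fun μ => A μ S) = 0 := by
      refine (mul_eq_zero.1 (?_ : mdot (totalMom X.mom S) (totalMom X.mom S) * _ = 0)).resolve_left h0
      have e0 := hbox 0 S
      have e1 := hbox 1 S
      have e2 := hbox 2 S
      have e3 := hbox 3 S
      simp only [mdot] at hc e0 e1 e2 e3 ⊢
      linear_combination g * hc + totalMom X.mom S 0 * e0 - totalMom X.mom S 1 * e1 -
        totalMom X.mom S 2 * e2 - totalMom X.mom S 3 * e3
    rw [neg_mul, ← hbox 0 S]
    simp only [mdot, hA'] at hl ⊢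
    field_simp
    linear_combination (totalMom X.mom S 0) * hl
  · rw [gaugeF_apply_singleton _ _ h.phiStar_empty, s.phiStar]
    split_ifs <;> simp
  · rw [gaugeF_apply_singleton _ _ h.phi_empty, s.phi]
    split_ifs <;> simp
  · rw [hA', s.photon, s.photon, totalMom_singleton]
    split_ifs with ha
    · refine norm_temporal_pol_le ?_ ?_ (hpol a ha).1 (hpol a ha).2 μ
      · have := hE {a} (singleton_nonempty a)
        rw [totalMom_singleton, toC] at this
        exact_mod_cast this
      · have := hp.singleton a
        rw [totalMom_singleton] at this
        simp only [mdot, toC] at this ⊢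
        exact_mod_cast this
    · simp
  · have h0 := hE {a} (singleton_nonempty a)
    have hs := hp.singleton a
    simp only [mdot, hA', s.photon] at hs ⊢
    split_ifs with ha
    · have h2 := congrArg star (hpol a ha).2
      simp only [mdot, star_sub, star_mul', star_zero] at h2
      rw [totalMom_singleton] at h0 hs ⊢
      simp only [toC, Complex.star_def, Complex.conj_ofReal] at h0 h2 hs ⊢
      field_simp
      linear_combination (X.mom a 0 : ℂ) * h2 - (starRingEnd ℂ) (X.pol a 0) * hs
    · simp

end Temporal

/-! ### Power counting -/

section PowerCounting

variable {α ι : Type*}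

/-- All particles of `S` belong to the same sector. -/
def IsPure (sector : α → ι) (S : Finset α) : Prop := ∀ a ∈ S, ∀ b ∈ S, sector a = sector b

theorem IsPure.mono {sector : α → ι} {S T : Finset α} (h : IsPure sector S) (hT : T ⊆ S) :
    IsPure sector T :=
  fun a ha b hb => h a (hT ha) b (hT hb)

/-- The scaling of total momenta in well-separated collinear sectors. -/
structure MomentumScaling (sector : α → ι) (K lam : ℝ) (p : α → Fin 4 → ℝ) : Prop where
  one_le : 1 ≤ K
  pos : 0 < lam
  le_one : lam ≤ 1
  norm_le : ∀ S μ, ‖totalMom p S μ‖ ≤ K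
  energy : ∀ S : Finset α, S.Nonempty → 1 ≤ K * ‖totalMom p S 0‖
  collinear : ∀ S : Finset α, IsPure sector S → 2 ≤ S.card →
    lam ^ 2 ≤ K * ‖mdot (totalMom p S) (totalMom p S)‖
  hard : ∀ S : Finset α, ¬IsPure sector S → 1 ≤ K * ‖mdot (totalMom p S) (totalMom p S)‖
  aligned : ∀ S : Finset α, IsPure sector S → ∀ B ⊆ S, ∀ C ⊆ S, ∀ μ,
    ‖totalMom p B μ * totalMom p C 0 - totalMom p B 0 * totalMom p C μ‖ ≤ K * lam

/-- The size of a field in power counting: each additional collinear particle costs `1 / lam`, and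
particles of different sectors cost a power of `lam`. -/
structure FieldBound (sector : α → ι) (lam c : ℝ) (f : SetAlg α) (S : Finset α) : Prop where
  pure : lam ^ S.card * ‖f S‖ ≤ c * lam
  mixed : ¬IsPure sector S → lam ^ S.card * ‖f S‖ ≤ c * lam ^ 2

/-- The size of all fields in temporal gauge. -/
structure AllBounds (sector : α → ι) (p : α → Fin 4 → ℝ) (lam c : ℝ) (A : Fin 4 → SetAlg α)
    (Φ Ψ : SetAlg α) (S : Finset α) : Prop where
  phiStar : FieldBound sector lam c Φ S
  phi : FieldBound sector lam c Ψ S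
  photon : ∀ μ, FieldBound sector lam c (A μ) S
  longitudinal : IsPure sector S →
    lam ^ S.card * ‖mdot (totalMom p S) (fun μ => A μ S)‖ ≤ c * lam ^ 2

theorem FieldBound.mono {sector : α → ι} {lam c c' : ℝ} {f : SetAlg α} {S : Finset α}
    (h : FieldBound sector lam c f S) (hlam : 0 < lam) (hc : c ≤ c') :
    FieldBound sector lam c' f S :=
  ⟨h.pure.trans (by gcongr), fun hS => (h.mixed hS).trans (by gcongr)⟩

/-- From the wave equation to the field: `P²` is of order `lam²` or `1`. -/
theorem FieldBound.of_box {sector : α → ι} {K lam D : ℝ} {p : α → Fin 4 → ℝ}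
    (hp : MomentumScaling sector K lam p) {f : SetAlg α} {S : Finset α} (hS : 2 ≤ S.card)
    (hpure : IsPure sector S →
      lam ^ S.card * ‖mdot (totalMom p S) (totalMom p S) * f S‖ ≤ D * lam ^ 3)
    (hmixed : ¬IsPure sector S →
      lam ^ S.card * ‖mdot (totalMom p S) (totalMom p S) * f S‖ ≤ D * lam ^ 2) :
    FieldBound sector lam (K * D) f S := by
  have hlam := hp.pos
  have hK := hp.one_le
  have hf : 0 ≤ lam ^ S.card * ‖f S‖ := by positivity
  by_cases h : IsPure sector S
  · refine ⟨?_, fun h' => absurd h h'⟩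
    have h1 := hpure h
    have h2 := hp.collinear S h hS
    rw [norm_mul] at h1
    refine le_of_mul_le_mul_right ?_ (pow_pos hlam 2)
    calc lam ^ S.card * ‖f S‖ * lam ^ 2
        ≤ lam ^ S.card * ‖f S‖ * (K * ‖mdot (totalMom p S) (totalMom p S)‖) := by gcongr
      _ = K * (lam ^ S.card * (‖mdot (totalMom p S) (totalMom p S)‖ * ‖f S‖)) := by ring
      _ ≤ K * (D * lam ^ 3) := by gcongr
      _ = K * D * lam * lam ^ 2 := by ring
  · have h1 := hmixed h
    have h2 := hp.hard S h
    rw [norm_mul] at h1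
    have h3 : lam ^ S.card * ‖f S‖ ≤ K * D * lam ^ 2 := by
      calc lam ^ S.card * ‖f S‖
          = lam ^ S.card * ‖f S‖ * 1 := by ring
        _ ≤ lam ^ S.card * ‖f S‖ * (K * ‖mdot (totalMom p S) (totalMom p S)‖) := by gcongr
        _ = K * (lam ^ S.card * (‖mdot (totalMom p S) (totalMom p S)‖ * ‖f S‖)) := by ring
        _ ≤ K * (D * lam ^ 2) := by gcongr
        _ = K * D * lam ^ 2 := by ring
    refine ⟨h3.trans ?_, fun _ => h3⟩
    -- `D` carries no sign hypothesis; the estimate just proved forces the sign.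
    have hKD : 0 ≤ K * D := by
      by_contra hneg
      push Not at hneg
      have := mul_neg_of_neg_of_pos hneg (pow_pos hlam 2)
      linarith
    have : lam ^ 2 ≤ lam := by
      rw [sq]
      exact mul_le_of_le_one_left hlam.le hp.le_one
    gcongr

theorem AllBounds.mono {sector : α → ι} {p : α → Fin 4 → ℝ} {lam c c' : ℝ}
    {A : Fin 4 → SetAlg α} {Φ Ψ : SetAlg α} {S : Finset α}
    (h : AllBounds sector p lam c A Φ Ψ S) (hlam : 0 < lam) (hc : c ≤ c') :
    AllBounds sector p lam c' A Φ Ψ S :=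
  ⟨h.phiStar.mono hlam hc, h.phi.mono hlam hc, fun μ => (h.photon μ).mono hlam hc,
    fun hS => (h.longitudinal hS).trans (by gcongr)⟩

theorem norm_mdot_le {x y : Fin 4 → ℂ} {a b : ℝ} (hx : ∀ μ, ‖x μ‖ ≤ a) (hy : ∀ μ, ‖y μ‖ ≤ b) :
    ‖mdot x y‖ ≤ 4 * (a * b) := by
  have h : ∀ μ, ‖x μ * y μ‖ ≤ a * b := fun μ => by
    rw [norm_mul]
    exact mul_le_mul (hx μ) (hy μ) (norm_nonneg _) ((norm_nonneg _).trans (hx 0))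
  have h1 := norm_sub_le (x 0 * y 0 - x 1 * y 1 - x 2 * y 2) (x 3 * y 3)
  have h2 := norm_sub_le (x 0 * y 0 - x 1 * y 1) (x 2 * y 2)
  have h3 := norm_sub_le (x 0 * y 0) (x 1 * y 1)
  rw [mdot]
  linarith [h 0, h 1, h 2, h 3]

theorem mdot_smul_vec_norm (w : ℝ) (hw : 0 ≤ w) (x y : Fin 4 → ℂ) :
    w * ‖mdot x y‖ = ‖mdot x ((w : ℂ) • y)‖ := by
  rw [mdot_smul_right, norm_mul, Complex.norm_real, Real.norm_of_nonneg hw]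

/-- A weighted form of `norm_mdot_le`. -/
theorem mul_norm_mdot_le {w : ℝ} (hw : 0 ≤ w) {x y : Fin 4 → ℂ} {a b : ℝ} (hx : ∀ μ, ‖x μ‖ ≤ a)
    (hy : ∀ μ, w * ‖y μ‖ ≤ b) : w * ‖mdot x y‖ ≤ 4 * (a * b) := by
  rw [mdot_smul_vec_norm w hw]
  refine norm_mdot_le hx fun μ => ?_
  rw [Pi.smul_apply, smul_eq_mul, norm_mul, Complex.norm_real, Real.norm_of_nonneg hw]
  exact hy μ

/-- Collinear momenta contract with a collinear photon field to a power-suppressed quantity. -/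
theorem collinear_contraction_le {sector : α → ι} {K lam c : ℝ} {p : α → Fin 4 → ℝ}
    (hp : MomentumScaling sector K lam p) {A : Fin 4 → SetAlg α} {Φ Ψ : SetAlg α}
    {S B Q : Finset α} (hS : IsPure sector S) (hB : B ⊆ S) (hQ : Q ⊆ S)
    (hB' : B.Nonempty) (h : AllBounds sector p lam c A Φ Ψ B) :
    lam ^ B.card * ‖mdot (totalMom p Q) (fun μ => A μ B)‖ ≤ 5 * K ^ 2 * c * lam ^ 2 := by
  have hlam := hp.pos
  have hK := hp.one_le
  have hw : 0 ≤ lam ^ B.card := by positivity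
  set PB := totalMom p B
  set PQ := totalMom p Q
  set a : Fin 4 → ℂ := fun μ => A μ B
  -- Up to the energies, `PQ` is `PB` plus a misalignment. The first part contracts to the
  -- longitudinal component; the second is of order `lam` and meets a field carrying another `lam`.
  have e : PB 0 * mdot PQ a = PQ 0 * mdot PB a +
      mdot (fun μ => PQ μ * PB 0 - PQ 0 * PB μ) a := by
    simp only [mdot]; ring
  have h1 : lam ^ B.card * ‖mdot (fun μ => PQ μ * PB 0 - PQ 0 * PB μ) a‖ ≤
      4 * ((K * lam) * (c * lam)) :=
    mul_norm_mdot_le hw (hp.aligned S hS Q hQ B hB) fun μ => (h.photon μ).pure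
  have h2 := h.longitudinal (hS.mono hB)
  have h3 : lam ^ B.card * ‖PB 0 * mdot PQ a‖ ≤ 5 * K * c * lam ^ 2 := by
    rw [e]
    calc lam ^ B.card * ‖PQ 0 * mdot PB a + mdot (fun μ => PQ μ * PB 0 - PQ 0 * PB μ) a‖
        ≤ lam ^ B.card * (‖PQ 0‖ * ‖mdot PB a‖ + ‖mdot (fun μ => PQ μ * PB 0 - PQ 0 * PB μ) a‖) := by
          gcongr
          exact (norm_add_le _ _).trans (by rw [norm_mul])
      _ = ‖PQ 0‖ * (lam ^ B.card * ‖mdot PB a‖) +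
          lam ^ B.card * ‖mdot (fun μ => PQ μ * PB 0 - PQ 0 * PB μ) a‖ := by ring
      _ ≤ K * (c * lam ^ 2) + 4 * ((K * lam) * (c * lam)) := by
          gcongr
          exact hp.norm_le Q 0
      _ = 5 * K * c * lam ^ 2 := by ring
  rw [norm_mul] at h3
  calc lam ^ B.card * ‖mdot PQ a‖ = 1 * (lam ^ B.card * ‖mdot PQ a‖) := by ring
    _ ≤ K * ‖PB 0‖ * (lam ^ B.card * ‖mdot PQ a‖) := by
        gcongr
        exact hp.energy B hB'
    _ = K * (lam ^ B.card * (‖PB 0‖ * ‖mdot PQ a‖)) := by ring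
    _ ≤ K * (5 * K * c * lam ^ 2) := by gcongr
    _ = 5 * K ^ 2 * c * lam ^ 2 := by ring

variable [DecidableEq α]

theorem card_of_mem_splits₂ {S : Finset α} {x : Finset α × Finset α} (hx : x ∈ splits₂ S) :
    S.card = x.1.card + x.2.card := by
  simp only [splits₂, mem_filter] at hx
  obtain ⟨-, -, -, hd, rfl⟩ := hx
  exact card_union_of_disjoint hd

theorem card_of_mem_splits₃ {S : Finset α} {x : Finset α × Finset α × Finset α}
    (hx : x ∈ splits₃ S) : S.card = x.1.card + x.2.1.card + x.2.2.card := by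
  simp only [splits₃, mem_filter] at hx
  obtain ⟨-, -, -, -, h1, h2, h3, rfl⟩ := hx
  rw [card_union_of_disjoint (disjoint_union_left.2 ⟨h2, h3⟩), card_union_of_disjoint h1]

theorem subset_of_mem_splits₂ {S : Finset α} {x : Finset α × Finset α} (hx : x ∈ splits₂ S) :
    x.1 ⊆ S ∧ x.2 ⊆ S := by
  simp only [splits₂, mem_filter, mem_product, mem_powerset] at hx
  exact hx.1

variable [Fintype α]

/-- A bound for the numbers of decompositions. -/
def splitBound (α : Type*) [Fintype α] [DecidableEq α] : ℝ := (Fintype.card (Finset α) : ℝ) ^ 3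

theorem one_le_splitBound : 1 ≤ splitBound α := by
  have : 1 ≤ Fintype.card (Finset α) := Fintype.card_pos
  exact one_le_pow₀ (by exact_mod_cast this)

theorem weighted_sum_splits₂_le {lam b : ℝ} (hlam : 0 ≤ lam) (hb : 0 ≤ b) (S : Finset α)
    (h : Finset α → Finset α → ℂ)
    (hh : ∀ x ∈ splits₂ S, lam ^ x.1.card * lam ^ x.2.card * ‖h x.1 x.2‖ ≤ b) :
    lam ^ S.card * ‖∑ x ∈ splits₂ S, h x.1 x.2‖ ≤ splitBound α * b := by
  have h1 : ((splits₂ S).card : ℝ) ≤ splitBound α := by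
    have h2 : (splits₂ S).card ≤ Fintype.card (Finset α) ^ 2 := by
      refine (card_le_univ _).trans (le_of_eq ?_)
      rw [Fintype.card_prod, sq]
    have h3 : Fintype.card (Finset α) ^ 2 ≤ Fintype.card (Finset α) ^ 3 :=
      Nat.pow_le_pow_right Fintype.card_pos (by norm_num)
    rw [splitBound]
    exact_mod_cast h2.trans h3
  calc lam ^ S.card * ‖∑ x ∈ splits₂ S, h x.1 x.2‖
      ≤ lam ^ S.card * ∑ x ∈ splits₂ S, ‖h x.1 x.2‖ := by
        gcongr
        exact norm_sum_le _ _
    _ = ∑ x ∈ splits₂ S, lam ^ x.1.card * lam ^ x.2.card * ‖h x.1 x.2‖ := by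
        rw [mul_sum]
        refine sum_congr rfl fun x hx => ?_
        rw [← pow_add, card_of_mem_splits₂ hx]
    _ ≤ (splits₂ S).card • b := sum_le_card_nsmul _ _ _ hh
    _ ≤ splitBound α * b := by
        rw [nsmul_eq_mul]
        gcongr

theorem weighted_sum_splits₃_le {lam b : ℝ} (hlam : 0 ≤ lam) (hb : 0 ≤ b) (S : Finset α)
    (h : Finset α → Finset α → Finset α → ℂ)
    (hh : ∀ x ∈ splits₃ S, lam ^ x.1.card * lam ^ x.2.1.card * lam ^ x.2.2.card *
      ‖h x.1 x.2.1 x.2.2‖ ≤ b) :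
    lam ^ S.card * ‖∑ x ∈ splits₃ S, h x.1 x.2.1 x.2.2‖ ≤ splitBound α * b := by
  have h1 : ((splits₃ S).card : ℝ) ≤ splitBound α := by
    have h2 : (splits₃ S).card ≤ Fintype.card (Finset α) ^ 3 := by
      refine (card_le_univ _).trans (le_of_eq ?_)
      rw [Fintype.card_prod, Fintype.card_prod]
      ring
    rw [splitBound]
    exact_mod_cast h2
  calc lam ^ S.card * ‖∑ x ∈ splits₃ S, h x.1 x.2.1 x.2.2‖
      ≤ lam ^ S.card * ∑ x ∈ splits₃ S, ‖h x.1 x.2.1 x.2.2‖ := by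
        gcongr
        exact norm_sum_le _ _
    _ = ∑ x ∈ splits₃ S, lam ^ x.1.card * lam ^ x.2.1.card * lam ^ x.2.2.card *
          ‖h x.1 x.2.1 x.2.2‖ := by
        rw [mul_sum]
        refine sum_congr rfl fun x hx => ?_
        rw [← pow_add, ← pow_add, card_of_mem_splits₃ hx]
    _ ≤ (splits₃ S).card • b := sum_le_card_nsmul _ _ _ hh
    _ ≤ splitBound α * b := by
        rw [nsmul_eq_mul]
        gcongr

theorem mdot_add_left {R : Type*} [CommRing R] (x y z : Fin 4 → R) :
    mdot (x + y) z = mdot x z + mdot y z := by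
  simp only [mdot, Pi.add_apply]; ring

/-- The induction step for the scalar fields. -/
theorem fieldBound_of_covBox {sector : α → ι} {K lam c : ℝ} {p : α → Fin 4 → ℝ}
    (hp : MomentumScaling sector K lam p) {A : Fin 4 → SetAlg α} {Φ Ψ f : SetAlg α} (k : ℂ)
    (hA : ∀ μ, A μ ∅ = 0) (hf : f ∅ = 0) (hbox : covBox p k A f = 0) (hc : 0 ≤ c)
    {S : Finset α} (hS : 2 ≤ S.card)
    (h : ∀ T : Finset α, T.card < S.card → AllBounds sector p lam c A Φ Ψ T)
    (h' : ∀ T : Finset α, T.card < S.card → FieldBound sector lam c f T) :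
    FieldBound sector lam
      (K * (splitBound α * (10 * ‖k‖ * K ^ 2 * c ^ 2 + 4 * ‖k‖ ^ 2 * c ^ 3))) f S := by
  have hlam := hp.pos
  have hK := hp.one_le
  have hN : 0 ≤ splitBound α := zero_le_one.trans one_le_splitBound
  have eq : mdot (totalMom p S) (totalMom p S) * f S =
      -(k * ∑ x ∈ splits₂ S, mdot (totalMom p S + totalMom p x.2) (fun μ => A μ x.1) * f x.2 +
        k ^ 2 * ∑ x ∈ splits₃ S, mdot (fun μ => A μ x.1) (fun μ => A μ x.2.1) * f x.2.2) := by
    have := DFunLike.congr_fun hbox S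
    rw [covBox_apply p k A f hA hf, SetAlg.zero_apply] at this
    linear_combination this
  have h3 : lam ^ S.card *
      ‖∑ x ∈ splits₃ S, mdot (fun μ => A μ x.1) (fun μ => A μ x.2.1) * f x.2.2‖ ≤
        splitBound α * (4 * c ^ 3 * lam ^ 3) := by
    refine weighted_sum_splits₃_le hlam.le (by positivity) S
      (fun B C D => mdot (fun μ => A μ B) (fun μ => A μ C) * f D) fun x hx => ?_
    obtain ⟨l1, l2, l3⟩ := card_lt_of_mem_splits₃ hx
    have b1 : lam ^ x.2.1.card * ‖mdot (fun μ => (lam : ℂ) ^ x.1.card * A μ x.1)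
        (fun μ => A μ x.2.1)‖ ≤ 4 * ((c * lam) * (c * lam)) := by
      refine mul_norm_mdot_le (by positivity) (fun μ => ?_) fun μ => ((h _ l2).photon μ).pure
      rw [norm_mul, norm_pow, Complex.norm_real, Real.norm_of_nonneg hlam.le]
      exact ((h _ l1).photon μ).pure
    have b2 : ‖mdot (fun μ => (lam : ℂ) ^ x.1.card * A μ x.1) (fun μ => A μ x.2.1)‖ =
        lam ^ x.1.card * ‖mdot (fun μ => A μ x.1) (fun μ => A μ x.2.1)‖ := by
      have : mdot (fun μ => (lam : ℂ) ^ x.1.card * A μ x.1) (fun μ => A μ x.2.1) =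
          (lam : ℂ) ^ x.1.card * mdot (fun μ => A μ x.1) (fun μ => A μ x.2.1) := by
        simp only [mdot]; ring
      rw [this, norm_mul, norm_pow, Complex.norm_real, Real.norm_of_nonneg hlam.le]
    rw [b2] at b1
    have b3 := (h' _ l3).pure
    rw [norm_mul]
    calc _ = (lam ^ x.2.1.card * (lam ^ x.1.card * ‖mdot (fun μ => A μ x.1) (fun μ => A μ x.2.1)‖))
          * (lam ^ x.2.2.card * ‖f x.2.2‖) := by ring
      _ ≤ (4 * ((c * lam) * (c * lam))) * (c * lam) := by gcongr
      _ = 4 * c ^ 3 * lam ^ 3 := by ring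
  have main : ∀ b : ℝ, 0 ≤ b → (∀ x ∈ splits₂ S, lam ^ x.1.card * lam ^ x.2.card *
      ‖mdot (totalMom p S + totalMom p x.2) (fun μ => A μ x.1) * f x.2‖ ≤ b) →
      lam ^ S.card * ‖mdot (totalMom p S) (totalMom p S) * f S‖ ≤
        splitBound α * (‖k‖ * b + ‖k‖ ^ 2 * (4 * c ^ 3 * lam ^ 3)) := by
    intro b hb hx
    have h2 := weighted_sum_splits₂_le hlam.le hb S
      (fun B C => mdot (totalMom p S + totalMom p C) (fun μ => A μ B) * f C) hx
    rw [eq, norm_neg]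
    set s₂ := ∑ x ∈ splits₂ S, mdot (totalMom p S + totalMom p x.2) (fun μ => A μ x.1) * f x.2
    set s₃ := ∑ x ∈ splits₃ S, mdot (fun μ => A μ x.1) (fun μ => A μ x.2.1) * f x.2.2
    calc lam ^ S.card * ‖k * s₂ + k ^ 2 * s₃‖
        ≤ lam ^ S.card * (‖k‖ * ‖s₂‖ + ‖k‖ ^ 2 * ‖s₃‖) := by
          gcongr
          exact (norm_add_le _ _).trans (by rw [norm_mul, norm_mul, norm_pow])
      _ = ‖k‖ * (lam ^ S.card * ‖s₂‖) + ‖k‖ ^ 2 * (lam ^ S.card * ‖s₃‖) := by ring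
      _ ≤ ‖k‖ * (splitBound α * b) + ‖k‖ ^ 2 * (splitBound α * (4 * c ^ 3 * lam ^ 3)) := by
          gcongr
      _ = _ := by ring
  refine FieldBound.of_box hp hS (fun hpure => ?_) fun hmixed => ?_
  -- Pure case: the contraction supplies `lam ^ 2` instead of the naive `lam`; with the `lam` of the
  -- scalar this compensates the propagator `lam ^ (-2)`.
  · refine (main (10 * K ^ 2 * c ^ 2 * lam ^ 3) (by positivity) fun x hx => ?_).trans
      (le_of_eq (by ring))
    obtain ⟨l1, l2⟩ := card_lt_of_mem_splits₂ hx
    obtain ⟨s1, s2⟩ := subset_of_mem_splits₂ hx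
    have hne : x.1.Nonempty := by
      simp only [splits₂, mem_filter] at hx
      exact hx.2.1
    have b1 := collinear_contraction_le hp hpure s1 subset_rfl hne (h _ l1)
    have b2 := collinear_contraction_le hp hpure s1 s2 hne (h _ l1)
    have b3 := (h' _ l2).pure
    rw [norm_mul, mdot_add_left]
    calc _ = (lam ^ x.1.card * ‖mdot (totalMom p S) (fun μ => A μ x.1) +
            mdot (totalMom p x.2) (fun μ => A μ x.1)‖) * (lam ^ x.2.card * ‖f x.2‖) := by ring
      _ ≤ (lam ^ x.1.card * (‖mdot (totalMom p S) (fun μ => A μ x.1)‖ +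
            ‖mdot (totalMom p x.2) (fun μ => A μ x.1)‖)) * (c * lam) := by
          gcongr
          exact norm_add_le _ _
      _ ≤ (5 * K ^ 2 * c * lam ^ 2 + 5 * K ^ 2 * c * lam ^ 2) * (c * lam) := by
          rw [mul_add]
          gcongr
      _ = 10 * K ^ 2 * c ^ 2 * lam ^ 3 := by ring
  -- Mixed case: the propagator is of order 1, so the two factors `lam` of the fields at the vertex
  -- suffice.
  · have hl3 : lam ^ 3 ≤ lam ^ 2 := pow_le_pow_of_le_one hlam.le hp.le_one (by norm_num)
    have hKK : 8 * K ≤ 10 * K ^ 2 := by nlinarith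
    refine (main (8 * K * c ^ 2 * lam ^ 2) (by positivity) fun x hx => ?_).trans ?_
    · obtain ⟨l1, l2⟩ := card_lt_of_mem_splits₂ hx
      have b1 : lam ^ x.1.card * ‖mdot (totalMom p S + totalMom p x.2) (fun μ => A μ x.1)‖ ≤
          4 * ((K + K) * (c * lam)) :=
        mul_norm_mdot_le (by positivity) (fun μ => (norm_add_le _ _).trans
          (add_le_add (hp.norm_le _ _) (hp.norm_le _ _))) fun μ => ((h _ l1).photon μ).pure
      have b3 := (h' _ l2).pure
      rw [norm_mul]
      calc _ = (lam ^ x.1.card * ‖mdot (totalMom p S + totalMom p x.2) (fun μ => A μ x.1)‖) *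
            (lam ^ x.2.card * ‖f x.2‖) := by ring
        _ ≤ (4 * ((K + K) * (c * lam))) * (c * lam) := by gcongr
        _ = _ := by ring
    · calc splitBound α * (‖k‖ * (8 * K * c ^ 2 * lam ^ 2) + ‖k‖ ^ 2 * (4 * c ^ 3 * lam ^ 3))
          ≤ splitBound α * (‖k‖ * (10 * K ^ 2 * c ^ 2 * lam ^ 2) +
              ‖k‖ ^ 2 * (4 * c ^ 3 * lam ^ 2)) := by gcongr
        _ = _ := by ring

end PowerCounting

/-! ### Power counting for the photon field, and the complete induction -/

section PowerCounting

variable {α ι : Type*} [Fintype α] [DecidableEq α]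

/-- The induction step for the photon field. -/
theorem fieldBound_photon {sector : α → ι} {K lam c : ℝ} {p : α → Fin 4 → ℝ}
    (hp : MomentumScaling sector K lam p) {k : ℂ} {A : Fin 4 → SetAlg α} {Φ Ψ : SetAlg α}
    (hs : IsTemporalSolution p k A Φ Ψ) (hc : 0 ≤ c)
    {S : Finset α} (hS : 2 ≤ S.card)
    (h : ∀ T : Finset α, T.card < S.card → AllBounds sector p lam c A Φ Ψ T) (μ : Fin 4) :
    FieldBound sector lam
      (K * (K * (‖k‖ * (splitBound α * (4 * K ^ 2 * c ^ 2 + 2 * ‖k‖ * K * c ^ 3))))) (A μ) S := by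
  have hlam := hp.pos
  have hK := hp.one_le
  have hN : 0 ≤ splitBound α := zero_le_one.trans one_le_splitBound
  have hne : S.Nonempty := card_pos.1 (by omega)
  set P := totalMom p S with hP
  -- The quartic part of `J⁰` contains `A⁰ = 0` and drops out. The cubic weights form antisymmetric
  -- combinations of momenta, of order `lam` when all of them are aligned.
  have eq : mdot P P * A μ S * P 0 =
      k * (∑ x ∈ splits₂ S, ((totalMom p x.1 μ - totalMom p x.2 μ) * P 0 -
          P μ * (totalMom p x.1 0 - totalMom p x.2 0)) * (Φ x.1 * Ψ x.2) +
        2 * k * ∑ x ∈ splits₃ S, (A μ x.1 * P 0) * (Φ x.2.1 * Ψ x.2.2)) := by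
    rw [hs.photon S hne μ, current_apply _ _ _ _ _ hs.photon_empty hs.phiStar_empty hs.phi_empty,
      current_apply _ _ _ _ _ hs.photon_empty hs.phiStar_empty hs.phi_empty]
    simp only [hs.temporal, zero_mul, sum_const_zero, mul_zero, add_zero]
    rw [add_mul, mul_assoc (2 * k), sum_mul, sum_mul,
      mul_sum (splits₂ S) _ (totalMom p S μ), add_sub_right_comm,
      ← sum_sub_distrib]
    congr 2
    · exact sum_congr rfl fun x _ => by ring
    · congr 1
      exact sum_congr rfl fun x _ => by ring
  have h3 : lam ^ S.card * ‖∑ x ∈ splits₃ S, (A μ x.1 * P 0) * (Φ x.2.1 * Ψ x.2.2)‖ ≤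
      splitBound α * (K * c ^ 3 * lam ^ 3) := by
    refine weighted_sum_splits₃_le hlam.le (by positivity) S
      (fun B C D => (A μ B * P 0) * (Φ C * Ψ D)) fun x hx => ?_
    obtain ⟨l1, l2, l3⟩ := card_lt_of_mem_splits₃ hx
    have b1 := ((h _ l1).photon μ).pure
    have b2 := (h _ l2).phiStar.pure
    have b3 := (h _ l3).phi.pure
    simp only [norm_mul]
    calc _ = (lam ^ x.1.card * ‖A μ x.1‖) * ‖P 0‖ * (lam ^ x.2.1.card * ‖Φ x.2.1‖) *
          (lam ^ x.2.2.card * ‖Ψ x.2.2‖) := by ring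
      _ ≤ (c * lam) * K * (c * lam) * (c * lam) := by
          gcongr
          exact hp.norm_le S 0
      _ = K * c ^ 3 * lam ^ 3 := by ring
  have main : ∀ b : ℝ, 0 ≤ b → (∀ x ∈ splits₂ S,
      ‖(totalMom p x.1 μ - totalMom p x.2 μ) * P 0 -
          P μ * (totalMom p x.1 0 - totalMom p x.2 0)‖ ≤ b) →
      lam ^ S.card * ‖mdot P P * A μ S‖ ≤
        K * (‖k‖ * (splitBound α * (b * c ^ 2 * lam ^ 2 + 2 * ‖k‖ * (K * c ^ 3 * lam ^ 3)))) := by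
    intro b hb hx
    have h2 := weighted_sum_splits₂_le hlam.le (b := b * c ^ 2 * lam ^ 2) (by positivity) S
      (fun B C => ((totalMom p B μ - totalMom p C μ) * P 0 -
          P μ * (totalMom p B 0 - totalMom p C 0)) * (Φ B * Ψ C)) (fun x hx' => by
        obtain ⟨l1, l2⟩ := card_lt_of_mem_splits₂ hx'
        have b1 := (h _ l1).phiStar.pure
        have b2 := (h _ l2).phi.pure
        have b3 := hx x hx'
        simp only [norm_mul]
        set y := ‖(totalMom p x.1 μ - totalMom p x.2 μ) * P 0 -
          P μ * (totalMom p x.1 0 - totalMom p x.2 0)‖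
        calc _ = y * (lam ^ x.1.card * ‖Φ x.1‖) * (lam ^ x.2.card * ‖Ψ x.2‖) := by ring
          _ ≤ b * (c * lam) * (c * lam) := by gcongr
          _ = _ := by ring)
    set s₂ := ∑ x ∈ splits₂ S, ((totalMom p x.1 μ - totalMom p x.2 μ) * P 0 -
      P μ * (totalMom p x.1 0 - totalMom p x.2 0)) * (Φ x.1 * Ψ x.2)
    set s₃ := ∑ x ∈ splits₃ S, (A μ x.1 * P 0) * (Φ x.2.1 * Ψ x.2.2)
    calc lam ^ S.card * ‖mdot P P * A μ S‖ = 1 * (lam ^ S.card * ‖mdot P P * A μ S‖) := by ring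
      _ ≤ K * ‖P 0‖ * (lam ^ S.card * ‖mdot P P * A μ S‖) := by
          gcongr
          exact hp.energy S hne
      _ = K * (lam ^ S.card * ‖k * (s₂ + 2 * k * s₃)‖) := by
          rw [← eq, norm_mul (mdot P P * A μ S)]
          ring
      _ ≤ K * (lam ^ S.card * (‖k‖ * (‖s₂‖ + 2 * ‖k‖ * ‖s₃‖))) := by
          rw [norm_mul k]
          gcongr
          refine (norm_add_le _ _).trans (le_of_eq ?_)
          rw [norm_mul, norm_mul, Complex.norm_ofNat]
      _ = K * (‖k‖ * (lam ^ S.card * ‖s₂‖ + 2 * ‖k‖ * (lam ^ S.card * ‖s₃‖))) := by ring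
      _ ≤ K * (‖k‖ * (splitBound α * (b * c ^ 2 * lam ^ 2) +
            2 * ‖k‖ * (splitBound α * (K * c ^ 3 * lam ^ 3)))) := by gcongr
      _ = _ := by ring
  refine FieldBound.of_box hp hS (fun hpure => ?_) fun hmixed => ?_
  · refine (main (2 * K * lam) (by positivity) fun x hx => ?_).trans ?_
    · obtain ⟨s1, s2⟩ := subset_of_mem_splits₂ hx
      have b1 := hp.aligned S hpure x.1 s1 S subset_rfl μ
      have b2 := hp.aligned S hpure x.2 s2 S subset_rfl μ
      rw [← hP] at b1 b2
      have e : (totalMom p x.1 μ - totalMom p x.2 μ) * P 0 -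
          P μ * (totalMom p x.1 0 - totalMom p x.2 0) =
          (totalMom p x.1 μ * P 0 - totalMom p x.1 0 * P μ) -
            (totalMom p x.2 μ * P 0 - totalMom p x.2 0 * P μ) := by ring
      rw [e]
      refine (norm_sub_le _ _).trans ?_
      linarith
    · have hKK : 2 * K ≤ 4 * K ^ 2 := by nlinarith
      calc K * (‖k‖ * (splitBound α *
            (2 * K * lam * c ^ 2 * lam ^ 2 + 2 * ‖k‖ * (K * c ^ 3 * lam ^ 3))))
          ≤ K * (‖k‖ * (splitBound α *
            (4 * K ^ 2 * lam * c ^ 2 * lam ^ 2 + 2 * ‖k‖ * (K * c ^ 3 * lam ^ 3)))) := by gcongr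
        _ = _ := by ring
  · refine (main (4 * K ^ 2) (by positivity) fun x hx => ?_).trans ?_
    · have n1 : ∀ ν, ‖totalMom p x.1 ν - totalMom p x.2 ν‖ ≤ K + K := fun ν =>
        (norm_sub_le _ _).trans (add_le_add (hp.norm_le _ _) (hp.norm_le _ _))
      calc _ ≤ ‖(totalMom p x.1 μ - totalMom p x.2 μ) * P 0‖ +
            ‖P μ * (totalMom p x.1 0 - totalMom p x.2 0)‖ := norm_sub_le _ _
        _ ≤ (K + K) * K + K * (K + K) := by
            rw [norm_mul, norm_mul]
            gcongr
            · exact n1 μ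
            · exact hp.norm_le S 0
            · exact hp.norm_le S μ
            · exact n1 0
        _ = 4 * K ^ 2 := by ring
    · have hl3 : lam ^ 3 ≤ lam ^ 2 := pow_le_pow_of_le_one hlam.le hp.le_one (by norm_num)
      calc K * (‖k‖ * (splitBound α *
            (4 * K ^ 2 * c ^ 2 * lam ^ 2 + 2 * ‖k‖ * (K * c ^ 3 * lam ^ 3))))
          ≤ K * (‖k‖ * (splitBound α *
            (4 * K ^ 2 * c ^ 2 * lam ^ 2 + 2 * ‖k‖ * (K * c ^ 3 * lam ^ 2)))) := by gcongr
        _ = _ := by ring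

/-- The induction step for the longitudinal component of the photon field. -/
theorem longitudinal_le {sector : α → ι} {K lam c : ℝ} {p : α → Fin 4 → ℝ}
    (hp : MomentumScaling sector K lam p) {k : ℂ} {A : Fin 4 → SetAlg α} {Φ Ψ : SetAlg α}
    (hs : IsTemporalSolution p k A Φ Ψ) (hc : 0 ≤ c)
    {S : Finset α} (hS : 2 ≤ S.card)
    (h : ∀ T : Finset α, T.card < S.card → AllBounds sector p lam c A Φ Ψ T) :
    lam ^ S.card * ‖mdot (totalMom p S) (fun μ => A μ S)‖ ≤
      K * (‖k‖ * (splitBound α * (2 * K * c ^ 2))) * lam ^ 2 := by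
  have hlam := hp.pos
  have hK := hp.one_le
  have hne : S.Nonempty := card_pos.1 (by omega)
  have eq := hs.longitudinal S hS
  rw [current_apply _ _ _ _ _ hs.photon_empty hs.phiStar_empty hs.phi_empty] at eq
  simp only [hs.temporal, zero_mul, sum_const_zero, mul_zero, add_zero] at eq
  have h2 := weighted_sum_splits₂_le hlam.le (b := 2 * K * c ^ 2 * lam ^ 2) (by positivity) S
    (fun B C => (totalMom p B 0 - totalMom p C 0) * Φ B * Ψ C) (fun x hx' => by
      obtain ⟨l1, l2⟩ := card_lt_of_mem_splits₂ hx'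
      have b1 := (h _ l1).phiStar.pure
      have b2 := (h _ l2).phi.pure
      have b3 : ‖totalMom p x.1 0 - totalMom p x.2 0‖ ≤ K + K :=
        (norm_sub_le _ _).trans (add_le_add (hp.norm_le _ _) (hp.norm_le _ _))
      simp only [norm_mul]
      calc _ = ‖totalMom p x.1 0 - totalMom p x.2 0‖ * (lam ^ x.1.card * ‖Φ x.1‖) *
            (lam ^ x.2.card * ‖Ψ x.2‖) := by ring
        _ ≤ (K + K) * (c * lam) * (c * lam) := by gcongr
        _ = _ := by ring)
  set s₂ := ∑ x ∈ splits₂ S, (totalMom p x.1 0 - totalMom p x.2 0) * Φ x.1 * Ψ x.2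
  set m := mdot (totalMom p S) (fun μ => A μ S)
  calc lam ^ S.card * ‖m‖ = 1 * (lam ^ S.card * ‖m‖) := by ring
    _ ≤ K * ‖totalMom p S 0‖ * (lam ^ S.card * ‖m‖) := by
        gcongr
        exact hp.energy S hne
    _ = K * (lam ^ S.card * ‖m * totalMom p S 0‖) := by rw [norm_mul]; ring
    _ = K * (‖k‖ * (lam ^ S.card * ‖s₂‖)) := by rw [eq, norm_mul, norm_neg]; ring
    _ ≤ K * (‖k‖ * (splitBound α * (2 * K * c ^ 2 * lam ^ 2))) := by gcongr
    _ = _ := by ring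

/-- Power counting for all tree-level matrix elements in temporal gauge, uniformly in the
momenta and polarizations. -/
theorem exists_allBounds (sector : α → ι) (k : ℂ) {K : ℝ} (hK : 1 ≤ K) :
    ∃ c : ℝ, 1 ≤ c ∧ ∀ (lam : ℝ) (p : α → Fin 4 → ℝ) (A : Fin 4 → SetAlg α) (Φ Ψ : SetAlg α),
      MomentumScaling sector K lam p → IsTemporalSolution p k A Φ Ψ →
        ∀ S, AllBounds sector p lam c A Φ Ψ S := by
  have key : ∀ n : ℕ, ∃ c : ℝ, 1 ≤ c ∧ ∀ (lam : ℝ) (p : α → Fin 4 → ℝ) (A : Fin 4 → SetAlg α)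
      (Φ Ψ : SetAlg α), MomentumScaling sector K lam p → IsTemporalSolution p k A Φ Ψ →
        ∀ S : Finset α, S.card < n → AllBounds sector p lam c A Φ Ψ S := by
    intro n
    induction n with
    | zero => exact ⟨1, le_rfl, fun _ _ _ _ _ _ _ S hS => absurd hS (Nat.not_lt_zero _)⟩
    | succ n ih =>
      obtain ⟨c, hc, ih⟩ := ih
      have hc0 : 0 ≤ c := zero_le_one.trans hc
      have hK0 : 0 ≤ K := zero_le_one.trans hK
      have hN : 0 ≤ splitBound α := zero_le_one.trans one_le_splitBound
      set c₁ := K * (splitBound α * (10 * ‖k‖ * K ^ 2 * c ^ 2 + 4 * ‖k‖ ^ 2 * c ^ 3)) with h1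
      set c₂ := K * (K * (‖k‖ * (splitBound α * (4 * K ^ 2 * c ^ 2 + 2 * ‖k‖ * K * c ^ 3))))
        with h2
      set c₃ := K * (‖k‖ * (splitBound α * (2 * K * c ^ 2))) with h3
      have p1 : 0 ≤ c₁ := by positivity
      have p2 : 0 ≤ c₂ := by positivity
      have p3 : 0 ≤ c₃ := by positivity
      -- One constant serves old and new sizes of `S` and all components; it is fixed before `lam`
      -- and the momenta.
      refine ⟨c + c₁ + c₂ + c₃, by linarith, fun lam p A Φ Ψ hp hs S hS => ?_⟩
      have hlam := hp.pos
      rcases Nat.lt_succ_iff_lt_or_eq.1 hS with hS | hS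
      · exact (ih lam p A Φ Ψ hp hs S hS).mono hlam (by linarith)
      have ih' : ∀ T : Finset α, T.card < S.card → AllBounds sector p lam c A Φ Ψ T :=
        fun T hT => ih lam p A Φ Ψ hp hs T (by omega)
      rcases Nat.lt_or_ge S.card 2 with hS2 | hS2
      · have small : ∀ f : SetAlg α, f ∅ = 0 → (∀ a, ‖f {a}‖ ≤ 1) →
            FieldBound sector lam c f S := by
          intro f hf0 hf1
          rcases Nat.le_one_iff_eq_zero_or_eq_one.1 (Nat.lt_succ_iff.1 hS2) with h0 | h0
          · have hz : f S = 0 := by rw [card_eq_zero.1 h0, hf0]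
            exact ⟨by rw [hz, norm_zero, mul_zero]; positivity,
              fun _ => by rw [hz, norm_zero, mul_zero]; positivity⟩
          · obtain ⟨a, rfl⟩ := card_eq_one.1 h0
            refine ⟨?_, fun hm => absurd (by simp [IsPure]) hm⟩
            rw [card_singleton, pow_one]
            nlinarith [hf1 a, norm_nonneg (f {a})]
        have b : AllBounds sector p lam c A Φ Ψ S := by
          refine ⟨small _ hs.phiStar_empty hs.phiStar_singleton,
            small _ hs.phi_empty hs.phi_singleton,
            fun μ => small _ (hs.photon_empty μ) fun a => hs.photon_singleton a μ, fun _ => ?_⟩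
          have hz : mdot (totalMom p S) (fun μ => A μ S) = 0 := by
            rcases Nat.le_one_iff_eq_zero_or_eq_one.1 (Nat.lt_succ_iff.1 hS2) with h0 | h0
            · rw [card_eq_zero.1 h0]
              simp [mdot]
            · obtain ⟨a, rfl⟩ := card_eq_one.1 h0
              exact hs.longitudinal_singleton a
          rw [hz, norm_zero, mul_zero]
          positivity
        exact b.mono hlam (by linarith)
      · have bΦ := fieldBound_of_covBox hp k hs.photon_empty hs.phiStar_empty hs.phiStar hc0 hS2
          ih' fun T hT => (ih' T hT).phiStar
        have bΨ := fieldBound_of_covBox hp (-k) hs.photon_empty hs.phi_empty hs.phi hc0 hS2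
          ih' fun T hT => (ih' T hT).phi
        rw [norm_neg] at bΨ
        refine ⟨bΦ.mono hlam (by linarith), bΨ.mono hlam (by linarith), fun μ =>
          (fieldBound_photon hp hs hc0 hS2 ih' μ).mono hlam (by linarith), fun _ => ?_⟩
        refine (longitudinal_le hp hs hc0 hS2 ih').trans ?_
        gcongr
        linarith
  obtain ⟨c, hc, h⟩ := key (Fintype.card α + 1)
  exact ⟨c, hc, fun lam p A Φ Ψ hp hs S => h lam p A Φ Ψ hp hs S
    (Nat.lt_succ_of_le (card_le_univ S))⟩

end PowerCounting

/-! ### Consequences of collinear kinematics -/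

section Kinematics

theorem IsNull.sq_eq {x : Fin 4 → ℝ} (h : IsNull x) :
    x 1 ^ 2 + x 2 ^ 2 + x 3 ^ 2 = x 0 ^ 2 := by
  have := h.2
  simp only [mdot] at this
  linarith

theorem IsNull.abs_le {x : Fin 4 → ℝ} (h : IsNull x) (μ : Fin 4) : |x μ| ≤ x 0 := by
  have := h.sq_eq
  refine abs_le_of_sq_le_sq ?_ h.1.le
  have h1 := sq_nonneg (x 1)
  have h2 := sq_nonneg (x 2)
  have h3 := sq_nonneg (x 3)
  fin_cases μ <;> simp only [Fin.zero_eta, Fin.mk_one, Fin.reduceFinMk] <;> linarith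

/-- Cauchy–Schwarz for the spatial parts, by Lagrange's identity. This sign excludes cancellations
in the invariant mass of a set of particles, so one pair bounds it below. -/
theorem IsNull.mdot_nonneg {x y : Fin 4 → ℝ} (hx : IsNull x) (hy : IsNull y) : 0 ≤ mdot x y := by
  have h1 := hx.sq_eq
  have h2 := hy.sq_eq
  have h3 : (x 1 * y 1 + x 2 * y 2 + x 3 * y 3) ^ 2 ≤ (x 0 * y 0) ^ 2 := by
    rw [mul_pow, ← h1, ← h2]
    linarith [sq_nonneg (x 1 * y 2 - x 2 * y 1), sq_nonneg (x 1 * y 3 - x 3 * y 1),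
      sq_nonneg (x 2 * y 3 - x 3 * y 2)]
  have h4 := (abs_le_of_sq_le_sq' h3 (mul_pos hx.1 hy.1).le).2
  simp only [mdot]
  linarith

theorem abs_mdot_le {x y : Fin 4 → ℝ} {a b : ℝ} (hx : ∀ μ, |x μ| ≤ a) (hy : ∀ μ, |y μ| ≤ b) :
    |mdot x y| ≤ 4 * (a * b) := by
  have h : ∀ μ, |x μ * y μ| ≤ a * b := fun μ => by
    rw [abs_mul]
    exact mul_le_mul (hx μ) (hy μ) (abs_nonneg _) ((abs_nonneg _).trans (hx 0))
  have h0 := abs_le.1 (h 0)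
  have h1 := abs_le.1 (h 1)
  have h2 := abs_le.1 (h 2)
  have h3 := abs_le.1 (h 3)
  rw [mdot, abs_le]
  constructor <;> linarith

/-- A collinear momentum is proportional to the collinear direction up to corrections of order
`lam`. -/
theorem HasCollinearScaling.bounds {c lam : ℝ} {n p : Fin 4 → ℝ} (hc : 0 < c) (hlam : 0 < lam)
    (hlam1 : lam ≤ 1) (hn : n 0 = 1 ∧ mdot n n = 0) (hp : IsNull p)
    (h : HasCollinearScaling c lam n p) :
    (∃ β, c / 2 ≤ β ∧ β ≤ c⁻¹ / 2 ∧ ∀ μ, |p μ - β * n μ| ≤ 2 * c⁻¹ * lam) ∧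
      c / 2 ≤ p 0 ∧ p 0 ≤ c⁻¹ ∧ ∀ μ, |p μ - p 0 * n μ| ≤ 3 * c⁻¹ * lam := by
  obtain ⟨h1, h2, h3, h4⟩ := h
  have hnull : IsNull n := ⟨by rw [hn.1]; norm_num, hn.2⟩
  have h0 := hnull.mdot_nonneg hp
  have hci : 0 < c⁻¹ := inv_pos.2 hc
  have hl2 : lam ^ 2 ≤ lam := by nlinarith
  have hnp : mdot n p ≤ c⁻¹ * lam := h1.trans (by gcongr)
  have hn1 : ∀ μ, |n μ| ≤ 1 := fun μ => hn.1 ▸ hnull.abs_le μ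
  have hb1 : ∀ μ, |bar n μ| ≤ 1 := fun μ => by
    unfold bar
    split_ifs
    · exact hn1 μ
    · rw [abs_neg]; exact hn1 μ
  have hp0 : p 0 = mdot n p / 2 + mdot (bar n) p / 2 := by
    simp only [mdot, bar]
    simp [hn.1]
    ring
  have hβ : ∀ μ, |p μ - mdot (bar n) p / 2 * n μ| ≤ 3 / 2 * c⁻¹ * lam := by
    intro μ
    have e : p μ - mdot (bar n) p / 2 * n μ = perp n p μ + mdot n p / 2 * bar n μ := by
      rw [perp]; ring
    have e2 : |mdot n p / 2 * bar n μ| ≤ c⁻¹ * lam / 2 * 1 := by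
      rw [abs_mul, abs_of_nonneg (by positivity : 0 ≤ mdot n p / 2)]
      exact mul_le_mul (by linarith) (hb1 μ) (abs_nonneg _) (by positivity)
    rw [e]
    refine (abs_add_le _ _).trans ?_
    linarith [h4 μ]
  -- The light-cone coefficient `n̄·p / 2` is bounded below directly; exchanging it for `p 0` costs
  -- `n·p / 2`, at most of order `lam`.
  refine ⟨⟨mdot (bar n) p / 2, by linarith, by linarith, fun μ => (hβ μ).trans ?_⟩, by linarith,
    ?_, fun μ => ?_⟩
  · have := mul_pos hci hlam
    linarith
  · have : c⁻¹ * lam ≤ c⁻¹ := mul_le_of_le_one_right hci.le hlam1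
    linarith
  · have e : p μ - p 0 * n μ = (p μ - mdot (bar n) p / 2 * n μ) - mdot n p / 2 * n μ := by
      rw [hp0]; ring
    have e2 : |mdot n p / 2 * n μ| ≤ c⁻¹ * lam / 2 * 1 := by
      rw [abs_mul, abs_of_nonneg (by positivity : 0 ≤ mdot n p / 2)]
      exact mul_le_mul (by linarith) (hn1 μ) (abs_nonneg _) (by positivity)
    rw [e]
    refine (abs_sub _ _).trans ?_
    have := mul_pos hci hlam
    linarith [hβ μ]

variable {α ι : Type*}

theorem totalMom_eq_toC (p : α → Fin 4 → ℝ) (S : Finset α) :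
    totalMom p S = toC (fun μ => ∑ a ∈ S, p a μ) := by
  funext μ
  simp [totalMom, toC]

theorem mdot_toC (x y : Fin 4 → ℝ) : mdot (toC x) (toC y) = (mdot x y : ℝ) := by
  simp [mdot, toC]

theorem mdot_sum_right (t : Fin 4 → ℝ) (p : α → Fin 4 → ℝ) (S : Finset α) :
    mdot t (fun μ => ∑ a ∈ S, p a μ) = ∑ a ∈ S, mdot t (p a) := by
  simp only [mdot, mul_sum, sum_sub_distrib]

/-- The constants in the scaling of total momenta. -/
def scalingConst (α : Type*) [Fintype α] (c : ℝ) : ℝ :=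
  1 + Fintype.card α * c⁻¹ + 2 * c⁻¹ + 8 * (c⁻¹) ^ 3 + 6 * (Fintype.card α) ^ 2 * (c⁻¹) ^ 2

/-- The range of the power-counting parameter. -/
def lamMax (c : ℝ) : ℝ := min 1 (min (c ^ 5 / 96) (c ^ 3 / 32))

theorem lamMax_pos {c : ℝ} (hc : 0 < c) : 0 < lamMax c :=
  lt_min one_pos (lt_min (by positivity) (by positivity))

variable {sector : α → ι} {c lam : ℝ} {n : ι → Fin 4 → ℝ} {p : α → Fin 4 → ℝ}

theorem CollinearKinematics.bounds (h : CollinearKinematics sector c lam n p) (hc : 0 < c)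
    (hlam : 0 < lam) (hlam1 : lam ≤ 1) (a : α) :
    (∃ β, c / 2 ≤ β ∧ β ≤ c⁻¹ / 2 ∧ ∀ μ, |p a μ - β * n (sector a) μ| ≤ 2 * c⁻¹ * lam) ∧
      c / 2 ≤ p a 0 ∧ p a 0 ≤ c⁻¹ ∧ ∀ μ, |p a μ - p a 0 * n (sector a) μ| ≤ 3 * c⁻¹ * lam :=
  (h.collinear a).bounds hc hlam hlam1 (h.direction _) (h.massless a)

theorem CollinearKinematics.isNull (h : CollinearKinematics sector c lam n p) (j : ι) :
    IsNull (n j) :=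
  ⟨by rw [(h.direction j).1]; norm_num, (h.direction j).2⟩

/-- Momenta of different sectors have a large invariant mass. -/
theorem CollinearKinematics.mdot_ge (h : CollinearKinematics sector c lam n p) (hc : 0 < c)
    (hlam : 0 < lam) (hmax : lam ≤ lamMax c) {a b : α} (hab : sector a ≠ sector b) :
    c ^ 3 / 8 ≤ mdot (p a) (p b) := by
  have hlam1 : lam ≤ 1 := hmax.trans (min_le_left _ _)
  have hl5 : lam ≤ c ^ 5 / 96 := hmax.trans ((min_le_right _ _).trans (min_le_left _ _))
  obtain ⟨⟨β, b1, b2, b3⟩, -, -, -⟩ := h.bounds hc hlam hlam1 a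
  obtain ⟨⟨β', b1', b2', b3'⟩, -, b5, -⟩ := h.bounds hc hlam hlam1 b
  have hci : 0 < c⁻¹ := inv_pos.2 hc
  have hβ : 0 ≤ β := by linarith
  have hβ' : 0 ≤ β' := by linarith
  have hn1 : ∀ μ, |n (sector a) μ| ≤ 1 := fun μ =>
    (h.direction (sector a)).1 ▸ (h.isNull (sector a)).abs_le μ
  have e : mdot (p a) (p b) = β * β' * mdot (n (sector a)) (n (sector b)) +
      β * mdot (n (sector a)) (fun μ => p b μ - β' * n (sector b) μ) +
      mdot (fun μ => p a μ - β * n (sector a) μ) (p b) := by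
    simp only [mdot]; ring
  have e1 := abs_le.1 (abs_mdot_le hn1 b3')
  have e2 := abs_le.1 (abs_mdot_le b3 fun μ => ((h.massless b).abs_le μ).trans b5)
  have e3 : c / 2 * (c / 2) * c ≤ β * β' * mdot (n (sector a)) (n (sector b)) := by
    have := h.separated _ _ hab
    gcongr
  have e4 : -(c⁻¹ / 2 * (4 * (1 * (2 * c⁻¹ * lam)))) ≤
      β * mdot (n (sector a)) (fun μ => p b μ - β' * n (sector b) μ) := by
    have : β * -(4 * (1 * (2 * c⁻¹ * lam))) ≤
      β * mdot (n (sector a)) (fun μ => p b μ - β' * n (sector b) μ) :=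
      mul_le_mul_of_nonneg_left e1.1 (by linarith)
    refine le_trans ?_ this
    rw [mul_neg]
    gcongr
  -- The errors `4 c⁻² lam` and `8 c⁻² lam` must not exceed half of the main term `c³ / 4`; hence `c
  -- ^ 5 / 96` in `lamMax`.
  have e5 : 12 * (c⁻¹ ^ 2 * lam) ≤ c ^ 3 / 8 := by
    calc 12 * (c⁻¹ ^ 2 * lam) ≤ 12 * (c⁻¹ ^ 2 * (c ^ 5 / 96)) := by gcongr
      _ = c ^ 3 / 8 := by field_simp; norm_num
  have e6 := e2.1
  rw [e]
  nlinarith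

/-- The contraction of a collinear momentum with the direction of a Wilson line. -/
theorem CollinearKinematics.wilson_ge (h : CollinearKinematics sector c lam n p) (hc : 0 < c)
    (hlam : 0 < lam) (hmax : lam ≤ lamMax c) {t : Fin 4 → ℝ} {a : α}
    (ht : IsWilsonDirection c (n (sector a)) t) :
    c ^ 2 / 4 * t 0 ≤ mdot t (p a) := by
  have hlam1 : lam ≤ 1 := hmax.trans (min_le_left _ _)
  have hl3 : lam ≤ c ^ 3 / 32 := hmax.trans ((min_le_right _ _).trans (min_le_right _ _))
  obtain ⟨⟨β, b1, b2, b3⟩, -, -, -⟩ := h.bounds hc hlam hlam1 a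
  have ht0 := ht.1.1
  have hβ : 0 ≤ β := by linarith
  have e : mdot t (p a) = β * mdot t (n (sector a)) +
      mdot t (fun μ => p a μ - β * n (sector a) μ) := by
    simp only [mdot]; ring
  have e1 := abs_le.1 (abs_mdot_le ht.1.abs_le b3)
  have e2 : c / 2 * (c * t 0) ≤ β * mdot t (n (sector a)) := by
    have := ht.2
    gcongr
  -- Half of the main coefficient `c² / 2`; hence `c ^ 3 / 32` in `lamMax`.
  have e3 : 8 * (c⁻¹ * lam) ≤ c ^ 2 / 4 := by
    calc 8 * (c⁻¹ * lam) ≤ 8 * (c⁻¹ * (c ^ 3 / 32)) := by gcongr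
      _ = c ^ 2 / 4 := by field_simp; norm_num
  have e4 : 8 * (c⁻¹ * lam) * t 0 ≤ c ^ 2 / 4 * t 0 := by gcongr
  rw [e]
  linarith [e1.1]

/-- Every particle contributes positively to `t·P`, so a single one suffices. The bound scales with
`t 0`, as does the numerator of the Wilson exponent. -/
theorem CollinearKinematics.wilson_total_ge (h : CollinearKinematics sector c lam n p) (hc : 0 < c)
    (hlam : 0 < lam) (hmax : lam ≤ lamMax c) {t : Fin 4 → ℝ} {j : ι}
    (ht : IsWilsonDirection c (n j) t) {B : Finset α} (hB : B.Nonempty)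
    (hBj : ∀ a ∈ B, sector a = j) :
    t 0 ≤ 4 * c⁻¹ ^ 2 * ‖mdot (toC t) (totalMom p B)‖ := by
  obtain ⟨a, ha⟩ := hB
  have hge : ∀ b ∈ B, c ^ 2 / 4 * t 0 ≤ mdot t (p b) := fun b hb =>
    h.wilson_ge hc hlam hmax (by rw [hBj b hb]; exact ht)
  have ht0 : 0 ≤ c ^ 2 / 4 * t 0 := mul_nonneg (by positivity) ht.1.1.le
  have h1 : c ^ 2 / 4 * t 0 ≤ ∑ b ∈ B, mdot t (p b) :=
    (hge a ha).trans (single_le_sum (fun b hb => ht0.trans (hge b hb)) ha)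
  rw [totalMom_eq_toC, mdot_toC, mdot_sum_right, Complex.norm_real,
    Real.norm_of_nonneg (ht0.trans h1)]
  calc t 0 = 4 * c⁻¹ ^ 2 * (c ^ 2 / 4 * t 0) := by field_simp
    _ ≤ _ := by gcongr

variable [Fintype α]

theorem CollinearKinematics.momentumScaling (h : CollinearKinematics sector c lam n p) (hc : 0 < c)
    (hlam : 0 < lam) (hmax : lam ≤ lamMax c) :
    MomentumScaling sector (scalingConst α c) lam p := by
  have hlam1 : lam ≤ 1 := hmax.trans (min_le_left _ _)
  have hci : 0 < c⁻¹ := inv_pos.2 hc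
  set N : ℝ := (Fintype.card α : ℝ) with hN
  have hN0 : 0 ≤ N := Nat.cast_nonneg _
  -- The summands serve, in order, `1 ≤ K`, the size of momenta, the energy together with the
  -- collinear invariant mass, the hard invariant mass, and the alignment.
  have hK : scalingConst α c = 1 + N * c⁻¹ + 2 * c⁻¹ + 8 * c⁻¹ ^ 3 + 6 * N ^ 2 * c⁻¹ ^ 2 := rfl
  have k1 : 0 ≤ N * c⁻¹ := by positivity
  have k2 : 0 ≤ 8 * c⁻¹ ^ 3 := by positivity
  have k3 : 0 ≤ 6 * N ^ 2 * c⁻¹ ^ 2 := by positivity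
  have hK0 : 0 ≤ scalingConst α c := by rw [hK]; positivity
  have hcard : ∀ S : Finset α, (S.card : ℝ) ≤ N := fun S => by
    rw [hN]
    exact_mod_cast card_le_univ S
  have hsum : ∀ (S : Finset α) (f : α → ℝ) (b : ℝ), 0 ≤ b → (∀ a ∈ S, |f a| ≤ b) →
      |∑ a ∈ S, f a| ≤ N * b := by
    intro S f b hb hf
    calc |∑ a ∈ S, f a| ≤ ∑ a ∈ S, |f a| := abs_sum_le_sum_abs _ _
      _ ≤ S.card • b := sum_le_card_nsmul _ _ _ hf
      _ ≤ N * b := by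
          rw [nsmul_eq_mul]
          exact mul_le_mul_of_nonneg_right (hcard S) hb
  have hb := h.bounds hc hlam hlam1
  have hle : ∀ S μ, |∑ a ∈ S, p a μ| ≤ N * c⁻¹ := fun S μ =>
    hsum S _ _ hci.le fun a _ => ((h.massless a).abs_le μ).trans (hb a).2.2.1
  have hnorm : ∀ S μ, ‖totalMom p S μ‖ = |∑ a ∈ S, p a μ| := fun S μ => by
    rw [totalMom_eq_toC, toC, Complex.norm_real, Real.norm_eq_abs]
  have hsq : ∀ S : Finset α, ‖mdot (totalMom p S) (totalMom p S)‖ =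
      |∑ a ∈ S, ∑ b ∈ S, mdot (p a) (p b)| := fun S => by
    rw [totalMom_eq_toC, mdot_toC, Complex.norm_real, Real.norm_eq_abs, mdot_sum_right]
    congr 1
    refine sum_congr rfl fun a _ => ?_
    rw [mdot_comm, mdot_sum_right]
  have hpair : ∀ (S : Finset α) (a b : α), a ∈ S → b ∈ S →
      mdot (p a) (p b) ≤ ‖mdot (totalMom p S) (totalMom p S)‖ := by
    intro S a b ha hb
    rw [hsq]
    refine le_trans ?_ (le_abs_self _)
    have nn : ∀ a b, 0 ≤ mdot (p a) (p b) := fun a b => (h.massless a).mdot_nonneg (h.massless b)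
    exact (single_le_sum (fun b _ => nn a b) hb).trans
      (single_le_sum (f := fun a => ∑ b ∈ S, mdot (p a) (p b))
        (fun a _ => sum_nonneg fun b _ => nn a b) ha)
  refine ⟨by rw [hK]; linarith, hlam, hlam1, fun S μ => ?_, fun S hS => ?_, fun S hS hS2 => ?_,
    fun S hS => ?_, fun S hS B hB C hC μ => ?_⟩
  · rw [hnorm, hK]
    linarith [hle S μ]
  · obtain ⟨a, ha⟩ := hS
    have h1 : c / 2 ≤ ‖totalMom p S 0‖ := by
      rw [hnorm]
      refine le_trans ?_ (le_abs_self _)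
      exact (hb a).2.1.trans (single_le_sum (f := fun a => p a 0)
        (fun b _ => (h.massless b).1.le) ha)
    calc (1 : ℝ) = 2 * c⁻¹ * (c / 2) := by field_simp
      _ ≤ scalingConst α c * ‖totalMom p S 0‖ := by
          gcongr
          rw [hK]
          linarith
  · obtain ⟨a, ha, b, hb', hab⟩ := one_lt_card.1 hS2
    have h1 := (h.resolved a b hab (hS a ha b hb')).trans (hpair S a b ha hb')
    calc lam ^ 2 = c⁻¹ * (c * lam ^ 2) := by field_simp
      _ ≤ scalingConst α c * ‖mdot (totalMom p S) (totalMom p S)‖ := by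
          gcongr
          rw [hK]
          linarith
  · simp only [IsPure] at hS
    push Not at hS
    obtain ⟨a, ha, b, hb', hab⟩ := hS
    have h1 := (h.mdot_ge hc hlam hmax hab).trans (hpair S a b ha hb')
    calc (1 : ℝ) = 8 * c⁻¹ ^ 3 * (c ^ 3 / 8) := by field_simp
      _ ≤ scalingConst α c * ‖mdot (totalMom p S) (totalMom p S)‖ := by
          gcongr
          rw [hK]
          linarith
  · rcases S.eq_empty_or_nonempty with rfl | ⟨a₀, ha₀⟩
    · have : 0 ≤ scalingConst α c * lam := by
        rw [hK]
        positivity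
      simpa [subset_empty.1 hB, subset_empty.1 hC] using this
    set ν := n (sector a₀) with hν
    have dev : ∀ T ⊆ S, |∑ a ∈ T, p a μ - (∑ a ∈ T, p a 0) * ν μ| ≤ N * (3 * c⁻¹ * lam) := by
      intro T hT
      rw [sum_mul, ← sum_sub_distrib]
      refine hsum T _ _ (by positivity) fun a ha => ?_
      rw [hν, ← hS a (hT ha) a₀ ha₀]
      exact (hb a).2.2.2 μ
    have e : totalMom p B μ * totalMom p C 0 - totalMom p B 0 * totalMom p C μ =
        (((∑ a ∈ B, p a μ - (∑ a ∈ B, p a 0) * ν μ) * (∑ a ∈ C, p a 0) -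
          (∑ a ∈ B, p a 0) * (∑ a ∈ C, p a μ - (∑ a ∈ C, p a 0) * ν μ) : ℝ) : ℂ) := by
      rw [totalMom_eq_toC, totalMom_eq_toC]
      simp only [toC]
      push_cast
      ring
    rw [e, Complex.norm_real, Real.norm_eq_abs]
    refine (abs_sub _ _).trans ?_
    rw [abs_mul, abs_mul]
    calc _ ≤ N * (3 * c⁻¹ * lam) * (N * c⁻¹) + N * c⁻¹ * (N * (3 * c⁻¹ * lam)) := by
          gcongr
          · exact dev B hB
          · exact hle C 0
          · exact hle B 0
          · exact dev C hC
      _ = 6 * N ^ 2 * c⁻¹ ^ 2 * lam := by ring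
      _ ≤ scalingConst α c * lam := by
          gcongr
          rw [hK]
          linarith

theorem CollinearKinematics.isOnShell (h : CollinearKinematics sector c lam n p) (hc : 0 < c)
    (hlam : 0 < lam) (hmax : lam ≤ lamMax c) : IsOnShell p := by
  have hs := h.momentumScaling hc hlam hmax
  refine ⟨fun a => ?_, fun S hS h0 => ?_⟩
  · rw [totalMom_singleton, mdot_toC, (h.massless a).2, Complex.ofReal_zero]
  · by_cases hS' : IsPure sector S
    · have := hs.collinear S hS' hS
      rw [h0, norm_zero, mul_zero] at this
      exact absurd this (not_le.2 (pow_pos hlam 2))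
    · have := hs.hard S hS'
      rw [h0, norm_zero, mul_zero] at this
      exact absurd this (by norm_num)

end Kinematics

/-! ### Wilson lines at leading power -/

section Factorization

variable {α ι : Type*}

theorem wilsonExponent_le {lam c κ : ℝ} {k : ℂ} {p : α → Fin 4 → ℝ} {t : Fin 4 → ℝ}
    {A : Fin 4 → SetAlg α} {B : Finset α} (hlam : 0 < lam) (ht : IsNull t)
    (hκ : t 0 ≤ κ * ‖mdot (toC t) (totalMom p B)‖)
    (hA : ∀ μ, lam ^ B.card * ‖A μ B‖ ≤ c * lam) (hc : 0 ≤ c) :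
    lam ^ B.card * ‖wilsonExponent p k t A B‖ ≤ 4 * ‖k‖ * c * κ * lam := by
  have ht0 := ht.1
  have hm : 0 < ‖mdot (toC t) (totalMom p B)‖ := by
    refine (norm_nonneg _).lt_of_ne fun h => ?_
    rw [← h, mul_zero] at hκ
    linarith
  have h1 : lam ^ B.card * ‖mdot (toC t) (fun μ => A μ B)‖ ≤ 4 * (t 0 * (c * lam)) :=
    mul_norm_mdot_le (by positivity) (fun μ => by
      rw [toC, Complex.norm_real, Real.norm_eq_abs]
      exact ht.abs_le μ) hA
  rw [wilsonExponent, SetAlg.mk_apply, norm_div, norm_mul, ← mul_div_assoc, div_le_iff₀ hm]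
  calc _ = ‖k‖ * (lam ^ B.card * ‖mdot (toC t) (fun μ => A μ B)‖) := by ring
    _ ≤ ‖k‖ * (4 * (t 0 * (c * lam))) := by gcongr
    _ = 4 * ‖k‖ * c * lam * t 0 := by ring
    _ ≤ 4 * ‖k‖ * c * lam * (κ * ‖mdot (toC t) (totalMom p B)‖) := by gcongr
    _ = _ := by ring

/-- The distribution of the particles in which each field creates a sector, up to permutations of
equal fields. -/
theorem exists_perm_of_preimage {m : ℕ} {sector f : α → Fin m ⊕ Fin m}
    (hsurj : Function.Surjective sector) (τ : Fin m ⊕ Fin m → Fin m ⊕ Fin m)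
    (hτ : ∀ a, sector a = τ (f a)) (hq : ∀ k, sectorCharge (τ k) = sectorCharge k) :
    ∃ σ : Equiv.Perm (Fin m) × Equiv.Perm (Fin m), f = Equiv.sumCongr σ.1 σ.2 ∘ sector := by
  have hτs : Function.Surjective τ := fun j => by
    obtain ⟨a, rfl⟩ := hsurj j
    exact ⟨f a, (hτ a).symm⟩
  let e : Equiv.Perm (Fin m ⊕ Fin m) :=
    Equiv.ofBijective τ ⟨Finite.injective_iff_surjective.2 hτs, hτs⟩
  have he : Set.MapsTo e.symm (Set.range Sum.inl) (Set.range Sum.inl) := by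
    rintro _ ⟨i, rfl⟩
    have h1 := hq (e.symm (.inl i))
    have h2 : τ (e.symm (.inl i)) = .inl i := e.apply_symm_apply _
    rw [h2] at h1
    rcases h3 : e.symm (.inl i) with j | j
    · exact ⟨j, rfl⟩
    · rw [h3] at h1
      simp [sectorCharge] at h1
  obtain ⟨σ, hσ⟩ := Equiv.Perm.mem_sumCongrHom_range_of_perm_mapsTo_inl he
  refine ⟨σ, funext fun a => ?_⟩
  have h4 : Equiv.sumCongr σ.1 σ.2 = e.symm := hσ
  rw [Function.comp_apply, h4, hτ a]
  exact (e.symm_apply_apply (f a)).symm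

theorem sum_sectorSet_card [Fintype α] [Fintype ι] [DecidableEq ι] (f : α → ι) :
    ∑ k, ({a | f a = k} : Finset α).card = Fintype.card α :=
  (card_eq_sum_card_fiberwise (s := univ) (t := univ) (f := f) fun _ _ => by simp).symm

variable [Fintype α] [DecidableEq α]

/-- A bound for the exponential of a set function. -/
def expBound (α : Type*) [Fintype α] [DecidableEq α] (d : ℝ) : ℝ :=
  (∑ T : Finset α, Fintype.card (Finpartition T)) * (1 + d) ^ Fintype.card α

/-- The powers of `lam` distribute over the blocks, each of which yields `d * lam`; a nonempty set
has at least one block, so one `lam` remains. -/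
theorem exp_le {lam d : ℝ} (hlam : 0 < lam) (hlam1 : lam ≤ 1) (hd : 0 ≤ d) {χ : SetAlg α}
    {T : Finset α} (hT : T.Nonempty)
    (h : ∀ B ⊆ T, B.Nonempty → lam ^ B.card * ‖χ B‖ ≤ d * lam) :
    lam ^ T.card * ‖SetAlg.exp χ T‖ ≤ expBound α d * lam := by
  have hterm : ∀ π : Finpartition T, lam ^ T.card * ‖∏ B ∈ π.parts, χ B‖ ≤
      (1 + d) ^ Fintype.card α * lam := by
    intro π
    have hne : π.parts.Nonempty := by
      rw [nonempty_iff_ne_empty, Ne, π.parts_eq_empty_iff]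
      exact hT.ne_empty
    have hcard : π.parts.card ≤ Fintype.card α :=
      π.card_parts_le_card.trans (card_le_univ T)
    calc lam ^ T.card * ‖∏ B ∈ π.parts, χ B‖ = ∏ B ∈ π.parts, (lam ^ B.card * ‖χ B‖) := by
          rw [prod_mul_distrib, norm_prod, prod_pow_eq_pow_sum, π.sum_card_parts]
      _ ≤ ∏ _B ∈ π.parts, (d * lam) := by
          refine prod_le_prod (fun B _ => by positivity) fun B hB => ?_
          exact h B (π.le hB) (π.nonempty_of_mem_parts hB)
      _ = d ^ π.parts.card * lam ^ π.parts.card := by rw [prod_const, mul_pow]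
      -- With base at least 1 the power can be raised to an exponent independent of the partition.
      _ ≤ (1 + d) ^ π.parts.card * lam := by
          gcongr
          · linarith
          · exact pow_le_of_le_one hlam.le hlam1 hne.card_pos.ne'
      _ ≤ (1 + d) ^ Fintype.card α * lam := by
          gcongr
          linarith
  have hcount : (Fintype.card (Finpartition T) : ℝ) ≤
      (∑ T : Finset α, Fintype.card (Finpartition T) : ℕ) := by
    exact_mod_cast single_le_sum (f := fun T : Finset α => Fintype.card (Finpartition T))
      (fun _ _ => Nat.zero_le _) (mem_univ T)
  calc lam ^ T.card * ‖SetAlg.exp χ T‖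
      ≤ lam ^ T.card * ∑ π : Finpartition T, ‖∏ B ∈ π.parts, χ B‖ := by
        gcongr
        rw [SetAlg.exp_apply]
        exact norm_sum_le _ _
    _ = ∑ π : Finpartition T, lam ^ T.card * ‖∏ B ∈ π.parts, χ B‖ := mul_sum _ _ _
    _ ≤ (univ : Finset (Finpartition T)).card • ((1 + d) ^ Fintype.card α * lam) :=
        sum_le_card_nsmul _ _ _ fun π _ => hterm π
    _ = Fintype.card (Finpartition T) * ((1 + d) ^ Fintype.card α * lam) := by
        rw [nsmul_eq_mul, card_univ]
    _ ≤ (∑ T : Finset α, Fintype.card (Finpartition T) : ℕ) *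
          ((1 + d) ^ Fintype.card α * lam) := by gcongr
    _ = expBound α d * lam := by
        rw [expBound]
        push_cast
        ring

/-- In temporal gauge a Wilson line is trivial at leading power. -/
theorem dressed_sub_le {lam c κ : ℝ} {k : ℂ} {p : α → Fin 4 → ℝ} {t : Fin 4 → ℝ}
    {A : Fin 4 → SetAlg α} {f : SetAlg α} {S : Finset α} (hlam : 0 < lam) (hlam1 : lam ≤ 1)
    (ht : IsNull t) (hc : 0 ≤ c) (hκ0 : 0 ≤ κ)
    (hκ : ∀ B ⊆ S, B.Nonempty → t 0 ≤ κ * ‖mdot (toC t) (totalMom p B)‖)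
    (hA : ∀ μ B, lam ^ B.card * ‖A μ B‖ ≤ c * lam) (hf : ∀ B, lam ^ B.card * ‖f B‖ ≤ c * lam) :
    lam ^ S.card * ‖dressed p k t A f S - f S‖ ≤
      Fintype.card (Finset α) * (c * expBound α (4 * ‖k‖ * c * κ)) * lam ^ 2 := by
  have hE : 0 ≤ expBound α (4 * ‖k‖ * c * κ) := by
    unfold expBound
    positivity
  -- The term `B = S` has no emission from the Wilson line and equals `f S`; every other term has at
  -- least one.
  have e : dressed p k t A f S - f S =
      ∑ B ∈ S.powerset.erase S, f B * SetAlg.exp (wilsonExponent p k t A) (S \ B) := by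
    rw [dressed, SetAlg.mul_apply, ← add_sum_erase _ _ (mem_powerset_self S), sdiff_self]
    simp
  have hterm : ∀ B ∈ S.powerset.erase S,
      lam ^ S.card * ‖f B * SetAlg.exp (wilsonExponent p k t A) (S \ B)‖ ≤
        c * expBound α (4 * ‖k‖ * c * κ) * lam ^ 2 := by
    intro B hB
    rw [mem_erase, mem_powerset] at hB
    have hne : (S \ B).Nonempty := by
      rw [sdiff_nonempty]
      exact fun h => hB.1 (hB.2.antisymm h)
    have h1 := exp_le hlam hlam1 (d := 4 * ‖k‖ * c * κ) (by positivity) hne fun C hC hC' =>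
      wilsonExponent_le (k := k) hlam ht (hκ C (hC.trans sdiff_subset) hC') (fun μ => hA μ C) hc
    have h2 := hf B
    have h3 : S.card = B.card + (S \ B).card := by
      rw [card_sdiff_of_subset hB.2]
      have := card_le_card hB.2
      omega
    rw [h3, pow_add, norm_mul]
    calc _ = (lam ^ B.card * ‖f B‖) *
          (lam ^ (S \ B).card * ‖SetAlg.exp (wilsonExponent p k t A) (S \ B)‖) := by ring
      _ ≤ (c * lam) * (expBound α (4 * ‖k‖ * c * κ) * lam) := by gcongr
      _ = _ := by ring
  rw [e]
  calc _ ≤ lam ^ S.card * ∑ B ∈ S.powerset.erase S,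
        ‖f B * SetAlg.exp (wilsonExponent p k t A) (S \ B)‖ := by
        gcongr
        exact norm_sum_le _ _
    _ = ∑ B ∈ S.powerset.erase S,
        lam ^ S.card * ‖f B * SetAlg.exp (wilsonExponent p k t A) (S \ B)‖ := mul_sum _ _ _
    _ ≤ (S.powerset.erase S).card • (c * expBound α (4 * ‖k‖ * c * κ) * lam ^ 2) :=
        sum_le_card_nsmul _ _ _ hterm
    _ ≤ Fintype.card (Finset α) * (c * expBound α (4 * ‖k‖ * c * κ) * lam ^ 2) := by
        rw [nsmul_eq_mul]
        gcongr
        exact card_le_univ _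
    _ = _ := by ring

/-- Telescoping, one factor at a time; `1 ≤ x` keeps the bound monotone in the number of factors. -/
theorem norm_prod_sub_prod_le {κ : Type*} (s : Finset κ) (a b : κ → ℂ) {x δ : ℝ}
    (hx : 1 ≤ x) (ha : ∀ i ∈ s, ‖a i‖ ≤ x) (hb : ∀ i ∈ s, ‖b i‖ ≤ x)
    (hδ : ∀ i ∈ s, ‖a i - b i‖ ≤ δ) :
    ‖∏ i ∈ s, a i - ∏ i ∈ s, b i‖ ≤ s.card * x ^ s.card * δ := by
  classical
  induction s using Finset.induction_on with
  | empty => simp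
  | insert i s hi ih =>
    have ih' := ih (fun j hj => ha j (mem_insert_of_mem hj))
      (fun j hj => hb j (mem_insert_of_mem hj)) fun j hj => hδ j (mem_insert_of_mem hj)
    have h1 := hδ i (mem_insert_self _ _)
    have hδ0 : 0 ≤ δ := (norm_nonneg _).trans h1
    have h2 : ‖∏ j ∈ s, a j‖ ≤ x ^ s.card := by
      rw [norm_prod]
      refine (prod_le_prod (fun j _ => norm_nonneg _)
        fun j hj => ha j (mem_insert_of_mem hj)).trans (le_of_eq ?_)
      rw [prod_const]
    have e : a i * ∏ j ∈ s, a j - b i * ∏ j ∈ s, b j =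
        (a i - b i) * ∏ j ∈ s, a j + b i * (∏ j ∈ s, a j - ∏ j ∈ s, b j) := by ring
    rw [prod_insert hi, prod_insert hi, card_insert_of_notMem hi, e]
    refine (norm_add_le _ _).trans ?_
    rw [norm_mul, norm_mul]
    calc _ ≤ δ * x ^ s.card + x * (s.card * x ^ s.card * δ) := by
          gcongr
          exact hb i (mem_insert_self _ _)
      _ ≤ δ * x ^ (s.card + 1) + x * (s.card * x ^ s.card * δ) := by
          gcongr
          omega
      _ = _ := by push_cast; ring

/-! ### The hard vertex -/

/-- The fields which create the sectors. -/
def sectorField {m : ℕ} (Φ Ψ : SetAlg α) : Fin m ⊕ Fin m → SetAlg α :=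
  Sum.elim (fun _ => Φ) fun _ => Ψ

/-- The matrix element of the hard vertex is invariant under gauge transformations. -/
theorem hardME_eq {sp : α → Species} (X : OutState sp) (g : ℝ) (m : ℕ) (χ : SetAlg α) :
    hardME X g m = ((m.factorial : ℂ) ^ 2)⁻¹ * ∑ f : α → Fin m ⊕ Fin m,
      ∏ k, sectorField (gaugeF g χ (treeME X g).phiStarAlg) (gaugeF (-g) χ (treeME X g).phiAlg) k
        {a | f a = k} := by
  -- Pairing the `i`-th `φ*` with the `i`-th `φ` cancels the exponentials pair by pair.
  have e : ∏ k : Fin m ⊕ Fin m,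
      sectorField (gaugeF g χ (treeME X g).phiStarAlg) (gaugeF (-g) χ (treeME X g).phiAlg) k =
      ∏ k : Fin m ⊕ Fin m, sectorField (treeME X g).phiStarAlg (treeME X g).phiAlg k := by
    simp only [Fintype.prod_sum_type, sectorField, Sum.elim_inl, Sum.elim_inr, ← prod_mul_distrib,
      gaugeF_mul_gaugeF]
  rw [← SetAlg.prod_apply_univ, e, SetAlg.prod_apply_univ, hardME]
  congr 1
  refine sum_congr rfl fun f _ => ?_
  rw [Fintype.prod_sum_type]
  rfl

/-- Only the distributions in which each field creates one sector contribute at leading power. -/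
theorem hard_sum_sub_le {m : ℕ} {sp : α → Species} {sector : α → Fin m ⊕ Fin m}
    (hcharge : ∀ j, totalCharge sp (sectorSet sector j) = sectorCharge j) {Φ Ψ : SetAlg α}
    {lam c : ℝ} (hlam : 0 < lam) (hc : 0 ≤ c)
    (h0 : ∀ k, sectorField (m := m) Φ Ψ k ∅ = 0)
    (hq : ∀ k S, totalCharge sp S ≠ sectorCharge k → sectorField (m := m) Φ Ψ k S = 0)
    (hb : ∀ k S, FieldBound sector lam c (sectorField (m := m) Φ Ψ k) S) :
    lam ^ Fintype.card α * ‖((m.factorial : ℂ) ^ 2)⁻¹ *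
        ∑ f : α → Fin m ⊕ Fin m, ∏ k, sectorField Φ Ψ k {a | f a = k} -
          ∏ j, sectorField Φ Ψ j (sectorSet sector j)‖ ≤
      Fintype.card (α → Fin m ⊕ Fin m) * c ^ (m + m) * lam ^ (m + m) * lam := by
  set F := sectorField (m := m) Φ Ψ with hF
  -- A sector of charge ±1 cannot be empty.
  have hsurj : Function.Surjective sector := fun j => by
    by_contra hne
    push Not at hne
    have h1 := hcharge j
    have h2 : sectorSet sector j = ∅ := by
      simp [sectorSet, hne]
    rw [h2] at h1
    rcases j with j | j <;> simp [totalCharge, sectorCharge] at h1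
  set G : Equiv.Perm (Fin m) × Equiv.Perm (Fin m) → α → Fin m ⊕ Fin m :=
    fun σ => Equiv.sumCongr σ.1 σ.2 ∘ sector with hG
  have hGinj : Function.Injective G := by
    intro σ σ' h
    have h1 : Equiv.sumCongr σ.1 σ.2 = Equiv.sumCongr σ'.1 σ'.2 := by
      refine Equiv.ext fun j => ?_
      obtain ⟨a, rfl⟩ := hsurj j
      exact congrFun h a
    exact Equiv.Perm.sumCongrHom_injective h1
  have hgood : ∀ σ, ∏ k, F k {a | G σ a = k} = ∏ j, F j (sectorSet sector j) := by
    intro σ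
    rw [← Equiv.prod_comp (Equiv.sumCongr σ.1 σ.2)]
    refine prod_congr rfl fun j _ => ?_
    have h1 : F (Equiv.sumCongr σ.1 σ.2 j) = F j := by
      rcases j with j | j <;> rfl
    rw [h1]
    congr 1
    ext a
    simp only [hG, sectorSet, mem_filter, mem_univ, true_and, Function.comp_apply,
      EmbeddingLike.apply_eq_iff_eq]
  -- By injectivity of `G` there are exactly `(m!)²` good distributions, with equal contributions;
  -- this is the normalization of the operator.
  set good := univ.image G with hgood'
  have hsum : ∑ f : α → Fin m ⊕ Fin m, ∏ k, F k {a | f a = k} =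
      (m.factorial : ℂ) ^ 2 * ∏ j, F j (sectorSet sector j) +
        ∑ f ∈ goodᶜ, ∏ k, F k {a | f a = k} := by
    rw [← sum_add_sum_compl good]
    congr 1
    rw [hgood', sum_image fun _ _ _ _ h => hGinj h, sum_congr rfl fun σ _ => hgood σ, sum_const,
      card_univ, Fintype.card_prod, Fintype.card_perm, Fintype.card_fin, nsmul_eq_mul]
    push_cast
    ring
  have hbad : ∀ f ∈ goodᶜ, lam ^ Fintype.card α * ‖∏ k, F k {a | f a = k}‖ ≤
      c ^ (m + m) * lam ^ (m + m) * lam := by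
    intro f hf
    have hpos : 0 ≤ c ^ (m + m) * lam ^ (m + m) * lam := by positivity
    -- A bad distribution with only pure blocks contributes 0: otherwise all blocks are nonempty, `k
    -- ↦` (sector of block `k`) is a charge-preserving surjection of a finite set to itself, and `f`
    -- would be good.
    by_cases hpure : ∀ k, IsPure sector ({a | f a = k} : Finset α)
    · suffices h : ∏ k, F k {a | f a = k} = 0 by
        rw [h, norm_zero, mul_zero]
        exact hpos
      by_contra hne
      rw [← Ne, prod_ne_zero_iff] at hne
      have hne1 : ∀ k, ∃ a, f a = k := fun k => by
        by_contra hk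
        push Not at hk
        apply hne k (mem_univ k)
        have : ({a | f a = k} : Finset α) = ∅ := by simp [hk]
        rw [this, hF, h0]
      choose s hs using hne1
      have hτ : ∀ a, sector a = sector (s (f a)) := fun a =>
        hpure (f a) a (by simp) _ (by simp [hs])
      have hτs : Function.Surjective fun k => sector (s k) := fun j => by
        obtain ⟨a, rfl⟩ := hsurj j
        exact ⟨f a, (hτ a).symm⟩
      have hτi := Finite.injective_iff_surjective.2 hτs
      have hfib : ∀ k, ({a | f a = k} : Finset α) = sectorSet sector (sector (s k)) := by
        intro k
        ext a
        simp only [sectorSet, mem_filter, mem_univ, true_and]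
        rw [hτ a]
        exact ⟨fun h => by rw [h], fun h => hτi h⟩
      have hqk : ∀ k, sectorCharge (sector (s k)) = sectorCharge k := by
        intro k
        by_contra h
        apply hne k (mem_univ k)
        rw [hfib, hF, hq]
        rwa [hcharge]
      obtain ⟨σ, hσ⟩ := exists_perm_of_preimage hsurj (fun k => sector (s k)) hτ hqk
      rw [mem_compl, hgood', mem_image] at hf
      exact hf ⟨σ, mem_univ _, hσ.symm⟩
    · push Not at hpure
      obtain ⟨k₀, hk₀⟩ := hpure
      calc lam ^ Fintype.card α * ‖∏ k, F k {a | f a = k}‖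
          = ∏ k, (lam ^ ({a | f a = k} : Finset α).card * ‖F k {a | f a = k}‖) := by
            rw [prod_mul_distrib, norm_prod, prod_pow_eq_pow_sum, sum_sectorSet_card]
        _ ≤ ∏ k, (c * lam * if k = k₀ then lam else 1) := by
            refine prod_le_prod (fun k _ => by positivity) fun k _ => ?_
            split_ifs with hk
            · subst hk
              refine ((hb k _).mixed hk₀).trans (le_of_eq (by ring))
            · rw [mul_one]
              exact (hb k _).pure
        _ = c ^ (m + m) * lam ^ (m + m) * lam := by
            rw [prod_mul_distrib, prod_const, prod_ite_eq' univ k₀, if_pos (mem_univ _),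
              card_univ, Fintype.card_sum, Fintype.card_fin, mul_pow]
  have hfac : ((m.factorial : ℂ) ^ 2) ≠ 0 := by
    exact_mod_cast pow_ne_zero 2 m.factorial_ne_zero
  have hfac1 : ‖((m.factorial : ℂ) ^ 2)⁻¹‖ ≤ 1 := by
    rw [norm_inv, norm_pow, Complex.norm_natCast]
    refine inv_le_one_of_one_le₀ (one_le_pow₀ ?_)
    exact_mod_cast m.factorial_pos
  rw [hsum, mul_add, inv_mul_cancel_left₀ hfac, add_sub_cancel_left, norm_mul]
  calc _ ≤ lam ^ Fintype.card α * (1 * ∑ f ∈ goodᶜ, ‖∏ k, F k {a | f a = k}‖) := by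
        gcongr
        exact norm_sum_le _ _
    _ = ∑ f ∈ goodᶜ, lam ^ Fintype.card α * ‖∏ k, F k {a | f a = k}‖ := by
        rw [one_mul, mul_sum]
    _ ≤ goodᶜ.card • (c ^ (m + m) * lam ^ (m + m) * lam) := sum_le_card_nsmul _ _ _ hbad
    _ ≤ Fintype.card (α → Fin m ⊕ Fin m) * (c ^ (m + m) * lam ^ (m + m) * lam) := by
        rw [nsmul_eq_mul]
        gcongr
        exact card_le_univ _
    _ = _ := by ring

end Factorization

/-! ### Collinear matrix elements in an arbitrary gauge -/

section Collinear

theorem temporalGauge_neutral {α : Type*} {sp : α → Species} {p : α → Fin 4 → ℝ} {F : FieldME α} (hF : IsCharged sp F)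
    (S : Finset α) (hS : totalCharge sp S ≠ 0) : temporalGauge p F.photonAlg S = 0 := by
  have : F.photonAlg 0 S = 0 := congrFun (hF.photon S hS) 0
  rw [temporalGauge, SetAlg.mk_apply, this, neg_zero, zero_div]

variable {α : Type*} [Fintype α] [DecidableEq α] {sp : α → Species}

/-- The charge of the Wilson line of a sector times the coupling. -/
def sectorCoupling {m : ℕ} (g : ℝ) : Fin m ⊕ Fin m → ℂ :=
  Sum.elim (fun _ => (g : ℂ)) fun _ => -(g : ℂ)

theorem norm_sectorCoupling {m : ℕ} (g : ℝ) (j : Fin m ⊕ Fin m) :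
    ‖sectorCoupling g j‖ = ‖(g : ℂ)‖ := by
  rcases j with j | j
  · rfl
  · exact norm_neg _

/-- The collinear matrix elements, evaluated in an arbitrary gauge. -/
theorem collinearME_eq {m : ℕ} (X : OutState sp) (g : ℝ) (t : Fin m ⊕ Fin m → Fin 4 → ℝ)
    (sector : α → Fin m ⊕ Fin m) (j : Fin m ⊕ Fin m)
    (h : ∀ B ⊆ sectorSet sector j, B.Nonempty → mdot (toC (t j)) (totalMom X.mom B) ≠ 0)
    (χ : SetAlg α) :
    collinearME X g t sector j = dressed X.mom (sectorCoupling g j) (t j)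
      (gaugeA X.mom χ (treeME X g).photonAlg)
      (sectorField (gaugeF g χ (treeME X g).phiStarAlg) (gaugeF (-g) χ (treeME X g).phiAlg) j)
      (sectorSet sector j) := by
  rcases j with j | j
  · exact (phiStarWilsonME_eq X g _ _).trans (dressed_gauge h _ _ _ _).symm
  · exact (wilsonDagPhiME_eq X g _ _).trans (dressed_gauge h _ _ _ _).symm

end Collinear

end ScalarQED

end

/-! ### Assembly of the three claims -/

open ScalarQED in
theorem mainTheorem3 {α : Type*} [Fintype α] [DecidableEq α] (sp : α → ScalarQED.Species) (m : ℕ)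
    (sector : α → Fin m ⊕ Fin m)
    (hcharge : ∀ j, ∑ a ∈ ScalarQED.sectorSet sector j, (sp a).charge =
      ScalarQED.sectorCharge j)
    (g : ℝ) (c : ℝ) (hc : 0 < c) :
    ∃ C : ℝ, ∃ lam₀ > 0, ∀ lam : ℝ, 0 < lam → lam ≤ lam₀ →
      ∀ (n t : Fin m ⊕ Fin m → Fin 4 → ℝ) (X : ScalarQED.OutState sp) (r : α → Fin 4 → ℝ),
        ScalarQED.CollinearKinematics sector c lam n X.mom →
        (∀ j, ScalarQED.IsWilsonDirection c (n j) (t j)) →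
        (∀ a, sp a = .photon → ScalarQED.IsPolarization (X.mom a) (r a) (X.pol a)) →
          ‖ScalarQED.hardME X g m - ∏ j, ScalarQED.collinearME X g t sector j‖ ≤
              C * lam / lam ^ ScalarQED.leadingExponent sector ∧
            (∀ j, ‖ScalarQED.collinearME X g t sector j‖ ≤
              C / lam ^ ((ScalarQED.sectorSet sector j).card - 1)) ∧
            ∀ (pol' : α → Fin 4 → ℂ),
              (∀ a, sp a = .photon → ∃ z : ℂ, pol' a = X.pol a + z • ScalarQED.toC (X.mom a)) →
                ∀ j, ScalarQED.collinearME (sp := sp) ⟨X.mom, pol'⟩ g t sector j =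
                  ScalarQED.collinearME X g t sector j := by
  have hK : 1 ≤ scalingConst α c := by
    have : 0 ≤ (Fintype.card α : ℝ) * c⁻¹ + 2 * c⁻¹ + 8 * (c⁻¹) ^ 3 +
        6 * (Fintype.card α : ℝ) ^ 2 * (c⁻¹) ^ 2 := by positivity
    rw [scalingConst]
    linarith
  obtain ⟨cb, hcb, hbound⟩ := exists_allBounds sector (g : ℂ) hK
  have hcb0 : 0 ≤ cb := zero_le_one.trans hcb
  set E : ℝ := Fintype.card (Finset α) * (cb * expBound α (4 * ‖(g : ℂ)‖ * cb * (4 * c⁻¹ ^ 2)))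
    with hE
  have hE0 : 0 ≤ E := by
    have : 0 ≤ expBound α (4 * ‖(g : ℂ)‖ * cb * (4 * c⁻¹ ^ 2)) := by
      unfold expBound
      positivity
    positivity
  set C₁ : ℝ := Fintype.card (α → Fin m ⊕ Fin m) * cb ^ (m + m) with hC₁
  set C₂ : ℝ := (m + m : ℕ) * (cb + E) ^ (m + m) * E with hC₂
  have hC₁0 : 0 ≤ C₁ := by positivity
  have hC₂0 : 0 ≤ C₂ := by positivity
  -- `C₁` pays for the bad distributions, `C₂` for dropping the Wilson lines, and `cb + E` bounds
  -- each collinear matrix element.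
  refine ⟨C₁ + C₂ + (cb + E), lamMax c, lamMax_pos hc, fun lam hlam hmax n t X r hkin ht hpol => ?_⟩
  have hlam1 : lam ≤ 1 := hmax.trans (min_le_left _ _)
  have hshell := hkin.isOnShell hc hlam hmax
  have hscal := hkin.momentumScaling hc hlam hmax
  have hsector : ∀ {j} {B : Finset α}, B ⊆ sectorSet sector j → ∀ a ∈ B, sector a = j :=
    fun hB a ha => (mem_filter.1 (hB ha)).2
  have htge : ∀ j, ∀ B ⊆ sectorSet sector j, B.Nonempty →
      t j 0 ≤ 4 * c⁻¹ ^ 2 * ‖mdot (toC (t j)) (totalMom X.mom B)‖ := fun j B hB hB' =>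
    hkin.wilson_total_ge hc hlam hmax (ht j) hB' (hsector hB)
  have htne : ∀ j, ∀ B ⊆ sectorSet sector j, B.Nonempty →
      mdot (toC (t j)) (totalMom X.mom B) ≠ 0 := fun j B hB hB' h0 => by
    have := htge j B hB hB'
    rw [h0, norm_zero, mul_zero] at this
    exact absurd (ht j).1.1 (not_lt.2 this)
  obtain ⟨hsol, hsrc⟩ := (feynmanStep_eq_self_iff X g hshell).1 (treeME_fixed X g)
  have hch := isCharged_treeME X g
  set χ := temporalGauge X.mom (treeME X g).photonAlg with hχ
  have hts := isTemporalSolution_gauge X g hshell (fun S hS h0 => by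
    have := hscal.energy S hS
    rw [h0, norm_zero, mul_zero] at this
    exact absurd this (by norm_num))
    (fun a ha => ⟨(hpol a ha).2.2.2.1, (hpol a ha).2.2.2.2.1⟩) hsol hsrc
  rw [← hχ] at hts
  have hab := hbound lam X.mom _ _ _ hscal hts
  set A := gaugeA X.mom χ (treeME X g).photonAlg
  set Φ := gaugeF g χ (treeME X g).phiStarAlg with hΦ
  set Ψ := gaugeF (-g) χ (treeME X g).phiAlg with hΨ
  set F := sectorField (m := m) Φ Ψ with hF
  have hFb : ∀ k S, FieldBound sector lam cb (F k) S := fun k S => by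
    rcases k with k | k
    · exact (hab S).phiStar
    · exact (hab S).phi
  have hF0 : ∀ k, F k ∅ = 0 := fun k => by
    rcases k with k | k
    · exact hts.phiStar_empty
    · exact hts.phi_empty
  have hFq : ∀ k S, totalCharge sp S ≠ sectorCharge k → F k S = 0 := fun k S hS => by
    rcases k with k | k
    · exact gaugeF_apply_eq_zero (temporalGauge_neutral hch) hch.phiStar hS
    · exact gaugeF_apply_eq_zero (temporalGauge_neutral hch) hch.phi hS
  have hM : ∀ j, collinearME X g t sector j =
      dressed X.mom (sectorCoupling g j) (t j) A (F j) (sectorSet sector j) := fun j =>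
    collinearME_eq X g t sector j (htne j) χ
  have hdiff : ∀ j, lam ^ (sectorSet sector j).card *
      ‖collinearME X g t sector j - F j (sectorSet sector j)‖ ≤ E * lam ^ 2 := fun j => by
    have := dressed_sub_le (k := sectorCoupling g j) hlam hlam1 (ht j).1 hcb0
      (by positivity : 0 ≤ 4 * c⁻¹ ^ 2) (htge j) (fun μ B => ((hab B).photon μ).pure)
      fun B => (hFb j B).pure
    rwa [norm_sectorCoupling, ← hM] at this
  have hcard : ∀ j, (sectorSet sector j).card = (sectorSet sector j).card - 1 + 1 := fun j => by
    have : (sectorSet sector j).card ≠ 0 := fun h0 => by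
      have := hcharge j
      rw [card_eq_zero.1 h0, sum_empty] at this
      rcases j with j | j <;> simp [sectorCharge] at this
    omega
  -- Rescaling by the leading power makes all factors of order 1, so that the telescoping bound
  -- applies with constants independent of `lam`.
  set a : Fin m ⊕ Fin m → ℂ := fun j =>
    (lam : ℂ) ^ ((sectorSet sector j).card - 1) * collinearME X g t sector j with ha
  set b : Fin m ⊕ Fin m → ℂ := fun j =>
    (lam : ℂ) ^ ((sectorSet sector j).card - 1) * F j (sectorSet sector j) with hb
  have hnorm : ∀ (k : ℕ) (z : ℂ), ‖(lam : ℂ) ^ k * z‖ = lam ^ k * ‖z‖ := fun k z => by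
    rw [norm_mul, norm_pow, Complex.norm_real, Real.norm_of_nonneg hlam.le]
  have hbb : ∀ j, ‖b j‖ ≤ cb := fun j => by
    have h1 := (hFb j (sectorSet sector j)).pure
    rw [hcard j, pow_succ] at h1
    rw [hb, hnorm]
    refine le_of_mul_le_mul_right ?_ hlam
    linarith
  have hab' : ∀ j, ‖a j - b j‖ ≤ E * lam := fun j => by
    have h1 := hdiff j
    rw [hcard j, pow_succ] at h1
    rw [ha, hb, ← mul_sub, hnorm]
    refine le_of_mul_le_mul_right ?_ hlam
    linarith
  have haa : ∀ j, ‖a j‖ ≤ cb + E := fun j => by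
    have h1 : ‖a j‖ ≤ ‖b j‖ + ‖a j - b j‖ := by
      have := norm_add_le (b j) (a j - b j)
      rwa [add_sub_cancel] at this
    have h2 : E * lam ≤ E := mul_le_of_le_one_right hE0 hlam1
    linarith [hbb j, hab' j]
  refine ⟨?_, fun j => ?_, fun pol' hpol' j => ?_⟩
  -- The `m + m` sectors, each nonempty, account for the difference; these powers of `lam` match
  -- those supplied by the fields at the hard vertex.
  · have hL : leadingExponent sector + (m + m) = Fintype.card α := by
      have h1 : ∑ j, (sectorSet sector j).card = Fintype.card α := sum_sectorSet_card sector
      rw [← h1, sum_congr rfl fun j _ => hcard j, sum_add_distrib, leadingExponent]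
      simp
    have hprod : ∀ f : Fin m ⊕ Fin m → ℂ,
        ∏ j, ((lam : ℂ) ^ ((sectorSet sector j).card - 1) * f j) =
          (lam : ℂ) ^ leadingExponent sector * ∏ j, f j := fun f => by
      rw [prod_mul_distrib, prod_pow_eq_pow_sum, leadingExponent]
    have h1 : lam ^ leadingExponent sector *
        ‖hardME X g m - ∏ j, F j (sectorSet sector j)‖ ≤ C₁ * lam := by
      have h2 := hard_sum_sub_le hcharge hlam hcb0 hF0 hFq hFb
      rw [hΦ, hΨ, ← hardME_eq X g m χ, ← hL, pow_add] at h2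
      refine le_of_mul_le_mul_right ?_ (pow_pos hlam (m + m))
      refine le_trans (le_of_eq ?_) (h2.trans (le_of_eq ?_))
      · ring
      · rw [hC₁]
        ring
    have h3 : lam ^ leadingExponent sector *
        ‖∏ j, F j (sectorSet sector j) - ∏ j, collinearME X g t sector j‖ ≤ C₂ * lam := by
      have h4 := norm_prod_sub_prod_le univ a b (by linarith : 1 ≤ cb + E) (fun j _ => haa j)
        (fun j _ => (hbb j).trans (by linarith)) fun j _ => hab' j
      rw [ha, hb, hprod, hprod, ← mul_sub, hnorm, card_univ, Fintype.card_sum,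
        Fintype.card_fin] at h4
      rw [norm_sub_rev]
      exact h4.trans (le_of_eq (by rw [hC₂]; ring))
    rw [le_div_iff₀ (pow_pos hlam _), mul_comm]
    have h5 : ‖hardME X g m - ∏ j, collinearME X g t sector j‖ ≤
        ‖hardME X g m - ∏ j, F j (sectorSet sector j)‖ +
          ‖∏ j, F j (sectorSet sector j) - ∏ j, collinearME X g t sector j‖ :=
      norm_sub_le_norm_sub_add_norm_sub _ _ _
    calc _ ≤ lam ^ leadingExponent sector * (‖hardME X g m - ∏ j, F j (sectorSet sector j)‖ +
          ‖∏ j, F j (sectorSet sector j) - ∏ j, collinearME X g t sector j‖) := by gcongr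
      _ ≤ C₁ * lam + C₂ * lam := by
          rw [mul_add]
          exact add_le_add h1 h3
      _ ≤ (C₁ + C₂ + (cb + E)) * lam := by
          have : 0 ≤ (cb + E) * lam := by positivity
          linarith
  · rw [le_div_iff₀ (pow_pos hlam _), mul_comm, ← hnorm]
    have := haa j
    rw [ha] at this
    linarith
  · have hz : ∃ z : α → ℂ, ∀ a, sp a = .photon → pol' a = X.pol a + z a • toC (X.mom a) := by
      refine ⟨fun a => if h : sp a = .photon then (hpol' a h).choose else 0, fun a h => ?_⟩
      simp only [dif_pos h]
      exact (hpol' a h).choose_spec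
    obtain ⟨z, hz⟩ := hz
    obtain ⟨ξ, e1, e2, e3⟩ := treeME_shift_pol X ⟨X.mom, pol'⟩ g hshell rfl z hz
    -- Evaluated in the gauge `ξ`, the original matrix element is the one built from the fields with
    -- shifted polarizations.
    rw [collinearME_eq X g t sector j (htne j) ξ, ← e1, ← e2, ← e3]
    rcases j with j | j
    · exact phiStarWilsonME_eq _ g _ _
    · exact wilsonDagPhiME_eq _ g _ _
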